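/- Let $n\ge 2$ and let $\Sigma\subset\mathbb R^n$ be a closed (i.e. compact, connected, non-empty, without boundary) smooth embedded hypersurface, with outward unit normal field $\nu$, normalized mean curvature $H_1=\frac{1}{n-1}\operatorname{tr}(d\nu)$ (the trace of the shape operator $v\mapsto D_v\nu$ on the tangent spaces of $\Sigma$, so that $H_1=1/r$ on a sphere of radius $r$) and area measure $d\mu$. Suppose that $\Sigma$ is mean-convex, i.e. $H_1>0$ on $\Sigma$. Then $\Sigma$ is a round sphere, i.e. $\Sigma=\{x : |x-c|=r\}$ for some $c\in\mathbb R^n$ and $r>0$, if and only if $$\int_\Sigma \frac{1}{H_1^2}\,\langle\nabla H_1, X\rangle\, d\mu\le 0,$$ where $\nabla H_1$ is the gradient of $H_1$ on $\Sigma$ and $X$ is the position vector. -/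

import Mathlib

open scoped ContDiff Topology RealInnerProductSpace MeasureTheory

noncomputable section

namespace EuclideanHypersurface

/-- `S` is a smooth embedded hypersurface (without boundary) of `ℝⁿ`: near each of its points it is
the regular zero set of a smooth real function. -/
def IsSmoothHypersurface {n : ℕ} (S : Set (EuclideanSpace ℝ (Fin n))) : Prop :=
  ∀ p ∈ S, ∃ (U : Set (EuclideanSpace ℝ (Fin n))) (f : EuclideanSpace ℝ (Fin n) → ℝ),
    IsOpen U ∧ p ∈ U ∧ ContDiffOn ℝ ∞ f U ∧ (∀ x ∈ U, fderiv ℝ f x ≠ 0) ∧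
      S ∩ U = {x ∈ U | f x = 0}

/-- A closed embedded hypersurface: compact, connected, nonempty, smooth and without boundary. -/
structure IsClosedEmbeddedHypersurface {n : ℕ} (S : Set (EuclideanSpace ℝ (Fin n))) : Prop where
  smooth : IsSmoothHypersurface S
  isCompact : IsCompact S
  isConnected : IsConnected S

/-- The tangent space `T_p S`, as a linear subspace of `ℝⁿ`. -/
def tangentSpace {n : ℕ} (S : Set (EuclideanSpace ℝ (Fin n))) (p : EuclideanSpace ℝ (Fin n)) :
    Submodule ℝ (EuclideanSpace ℝ (Fin n)) :=
  Submodule.span ℝ (tangentConeAt ℝ S p)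

/-- The region enclosed by `S`: the union of the bounded connected components of `ℝⁿ \ S`. -/
def enclosedRegion {n : ℕ} (S : Set (EuclideanSpace ℝ (Fin n))) :
    Set (EuclideanSpace ℝ (Fin n)) :=
  {x | x ∉ S ∧ Bornology.IsBounded (connectedComponentIn Sᶜ x)}

/-- `ν` is the outward unit normal field of `S`: along `S` it is continuous, of length one,
orthogonal to the tangent spaces, and it points out of the region enclosed by `S`.
The values of `ν` off `S` are irrelevant. -/
structure IsOutwardUnitNormal {n : ℕ} (S : Set (EuclideanSpace ℝ (Fin n)))
    (ν : EuclideanSpace ℝ (Fin n) → EuclideanSpace ℝ (Fin n)) : Prop where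
  continuousOn : ContinuousOn ν S
  norm_eq_one : ∀ p ∈ S, ‖ν p‖ = 1
  normal : ∀ p ∈ S, ν p ∈ (tangentSpace S p)ᗮ
  inward : ∀ p ∈ S, ∀ᶠ t : ℝ in 𝓝[>] 0, p - t • ν p ∈ enclosedRegion S
  outward : ∀ p ∈ S, ∀ᶠ t : ℝ in 𝓝[>] 0, p + t • ν p ∉ enclosedRegion S

/-- The shape operator `v ↦ D_v ν` of `S` on `T_p S`. The derivative is taken along `S`; on `T_p S`
it depends only on the restriction of `ν` to `S`. (It takes values in `T_p S` when `ν` is a unit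
normal field; the projection records this in the type.) -/
def shapeOperator {n : ℕ} (S : Set (EuclideanSpace ℝ (Fin n)))
    (ν : EuclideanSpace ℝ (Fin n) → EuclideanSpace ℝ (Fin n)) (p : EuclideanSpace ℝ (Fin n)) :
    tangentSpace S p →ₗ[ℝ] tangentSpace S p :=
  (tangentSpace S p).orthogonalProjectionOnto.toLinearMap ∘ₗ
    (fderivWithin ℝ ν S p).toLinearMap ∘ₗ (tangentSpace S p).subtype

/-- The normalized mean curvature `H₁`: the trace of the shape operator divided by `n - 1`. With
the outward normal it equals `1 / r` on a sphere of radius `r`. -/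
def meanCurvature {n : ℕ} (S : Set (EuclideanSpace ℝ (Fin n)))
    (ν : EuclideanSpace ℝ (Fin n) → EuclideanSpace ℝ (Fin n)) (p : EuclideanSpace ℝ (Fin n)) : ℝ :=
  LinearMap.trace ℝ (tangentSpace S p) (shapeOperator S ν p) / ((n : ℝ) - 1)

/-- Mean-convexity: the mean curvature with respect to the outward unit normal `ν` is positive. -/
def IsMeanConvex {n : ℕ} (S : Set (EuclideanSpace ℝ (Fin n)))
    (ν : EuclideanSpace ℝ (Fin n) → EuclideanSpace ℝ (Fin n)) : Prop :=
  ∀ p ∈ S, 0 < meanCurvature S ν p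

/-- The gradient on `S` (with the induced metric) of a function on `S`: the vector of `T_p S` that
represents the derivative of `h` along `S`. -/
def tangentialGradient {n : ℕ} (S : Set (EuclideanSpace ℝ (Fin n)))
    (h : EuclideanSpace ℝ (Fin n) → ℝ) (p : EuclideanSpace ℝ (Fin n)) :
    EuclideanSpace ℝ (Fin n) :=
  (tangentSpace S p).starProjection (gradientWithin h S p)

/-- `S` is a round sphere. -/
def IsRoundSphere {n : ℕ} (S : Set (EuclideanSpace ℝ (Fin n))) : Prop :=
  ∃ (c : EuclideanSpace ℝ (Fin n)) (r : ℝ), 0 < r ∧ S = Metric.sphere c r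

end EuclideanHypersurface

end

/-! The proof shows that the integral condition is the reverse of the Heintze-Karcher inequality,
and then settles the equality case by touching balls. Write n = m + 1, H for the mean curvature, V
for the enclosed volume and φ for a smooth function with φ = 1/H on S.

On S the integrand is minus the derivative of φ along the tangential part of X. The tangential
divergence theorem for φX, with ∫⟨N, X⟩ = (m + 1)V, turns the integral into m (∫ 1/H - (m + 1)V);
this is `IsInterior.integral_eq`. So the condition says ∫ 1/H ≤ (m + 1)V. Translating X changes
nothing, although the origin is arbitrary.

The opposite inequality comes from nearest points. Each point of the enclosed region is p - tN(p)
with an open ball of radius t around it that misses S and touches it at p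
(`IsInterior.exists_nearest`). At such a pair (p, t) the operator 1 - tA, with A the shape operator,
is positive semidefinite. Hence tH ≤ 1, and the arithmetic-geometric mean inequality bounds the
Jacobian of (p, t) ↦ p - tN(p) by (1 - tH)^m. Integrating over 0 < t ≤ 1/H gives V ≤ ∫ 1/((m + 1)H).

Under the condition these estimates are equalities, so almost every p, and by closedness every p,
has a touching ball of radius 1/H (`IsInterior.touching_of_integral_le`). Then 1 - A/H is
semidefinite with trace zero, so A = H · id. The next order of the touching condition gives dH = 0,
also for curves in the plane, where A = H · id says nothing. Thus p - N(p)/H is constant and S lies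
in a sphere (`IsExtendedNormal.exists_subset_sphere_of_touching`); boundedness of the enclosed
region excludes gaps (`IsInterior.eq_sphere`). Conversely, H is constant on a sphere and the
integrand vanishes.

The divergence theorem is proved by localization. Near a point, S is the graph of a function with
zero differential there, and its Hausdorff measure agrees with Lebesgue measure on the tangent plane
up to a factor close to 1. Cutoffs and compactness add the local errors, which are then sent to
zero. -/

noncomputable section

namespace EuclideanHypersurface

open Set Filter MeasureTheory Metric
open scoped ContDiff Topology RealInnerProductSpace MeasureTheory ENNReal NNReal

/-! ### Adapted coordinates, determinants and Lipschitz images -/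

section

/-- Orthonormal coordinates of `ℝᵐ⁺¹` in which `v` is the last coordinate direction. -/
structure AdaptedFrame {m : ℕ} (v : EuclideanSpace ℝ (Fin (m + 1))) where
  /-- the coordinate isomorphism -/
  toEquiv : (EuclideanSpace ℝ (Fin m) × ℝ) ≃L[ℝ] EuclideanSpace ℝ (Fin (m + 1))
  inner_apply : ∀ x y, ⟪toEquiv x, toEquiv y⟫ = ⟪x.1, y.1⟫ + x.2 * y.2
  apply_vertical : toEquiv (0, 1) = v
  measurePreserving : MeasurePreserving toEquiv

theorem exists_adaptedFrame {m : ℕ} {v : EuclideanSpace ℝ (Fin (m + 1))} (hv : ‖v‖ = 1) :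
    Nonempty (AdaptedFrame v) := by
  -- Used twice, for `v` and for the vertical vector of the L² product; the frame is the isometry
  -- matching the two bases. The L² product is needed because the plain product carries the sup
  -- norm.
  have key : ∀ (F : Type) [NormedAddCommGroup F] [InnerProductSpace ℝ F] [FiniteDimensional ℝ F],
      Module.finrank ℝ F = m + 1 → ∀ w : F, ‖w‖ = 1 →
        ∃ b : OrthonormalBasis (Fin (m + 1)) ℝ F, b 0 = w := by
    intro F _ _ _ hF w hw
    have ho : Orthonormal ℝ (({0} : Set (Fin (m + 1))).domRestrict fun _ => w) := by
      refine ⟨fun _ => hw, fun i j hij => (hij ?_).elim⟩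
      exact Subsingleton.elim i j
    obtain ⟨b, hb⟩ := ho.exists_orthonormalBasis_extension_of_card_eq (by simp [hF])
    exact ⟨b, hb 0 rfl⟩
  obtain ⟨b, hb⟩ := key (EuclideanSpace ℝ (Fin (m + 1))) (by simp) v hv
  have hrank : Module.finrank ℝ (WithLp 2 (EuclideanSpace ℝ (Fin m) × ℝ)) = m + 1 := by
    rw [(WithLp.linearEquiv 2 ℝ (EuclideanSpace ℝ (Fin m) × ℝ)).finrank_eq]
    simp
  obtain ⟨c, hc⟩ := key (WithLp 2 (EuclideanSpace ℝ (Fin m) × ℝ)) hrank (WithLp.toLp 2 (0, 1))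
    (by simp)
  let I := c.equiv b (Equiv.refl _)
  refine ⟨⟨(WithLp.prodContinuousLinearEquiv 2 ℝ (EuclideanSpace ℝ (Fin m)) ℝ).symm.trans
    I.toContinuousLinearEquiv, ?_, ?_, ?_⟩⟩
  · intro x y
    change ⟪I (WithLp.toLp 2 x), I (WithLp.toLp 2 y)⟫ = _
    rw [I.inner_map_map, WithLp.prod_inner_apply]
    simp [mul_comm]
  · change I (WithLp.toLp 2 (0, 1)) = v
    rw [← hc, OrthonormalBasis.equiv_apply_basis, Equiv.refl_apply, hb]
  · exact I.measurePreserving.comp (WithLp.volume_preserving_toLp _ _)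

namespace AdaptedFrame

variable {m : ℕ} {v : EuclideanSpace ℝ (Fin (m + 1))} (J : AdaptedFrame v)

theorem norm_sq_apply (x) : ‖J.toEquiv x‖ ^ 2 = ‖x.1‖ ^ 2 + x.2 ^ 2 := by
  rw [← real_inner_self_eq_norm_sq, J.inner_apply, real_inner_self_eq_norm_sq, sq x.2]

theorem norm_horizontal (y) : ‖J.toEquiv (y, 0)‖ = ‖y‖ := by
  have := J.norm_sq_apply (y, 0)
  simpa using this

theorem norm_fst_symm_le (x) : ‖(J.toEquiv.symm x).1‖ ≤ ‖x‖ := by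
  have := J.norm_sq_apply (J.toEquiv.symm x)
  rw [J.toEquiv.apply_symm_apply] at this
  exact abs_le_of_sq_le_sq' (by nlinarith [sq_nonneg (J.toEquiv.symm x).2]) (norm_nonneg _) |>.2

theorem apply_eq (y s) : J.toEquiv (y, s) = J.toEquiv (y, 0) + s • v := by
  have h : s • v = J.toEquiv (0, s) := by
    have := J.toEquiv.map_smul s (0, 1)
    rw [J.apply_vertical] at this
    simpa using this.symm
  rw [h, ← map_add]
  simp

theorem inner_vertical (x) : ⟪v, J.toEquiv x⟫ = x.2 := by
  have h := J.inner_apply (0, 1) x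
  rw [J.apply_vertical] at h
  simpa using h

theorem snd_symm (x) : (J.toEquiv.symm x).2 = ⟪v, x⟫ := by
  conv_rhs => rw [← J.toEquiv.apply_symm_apply x]
  rw [J.inner_vertical]

theorem measurePreserving_symm : MeasurePreserving J.toEquiv.symm :=
  J.measurePreserving.symm J.toEquiv.toHomeomorph.toMeasurableEquiv

end AdaptedFrame

/-- The determinant of a positive semidefinite operator is bounded by the arithmetic-geometric mean
inequality for its eigenvalues. -/
theorem det_nonneg_and_le_pow_of_isSymmetric {F : Type*} [NormedAddCommGroup F]
    [InnerProductSpace ℝ F] [FiniteDimensional ℝ F] {B : F →ₗ[ℝ] F} (hB : B.IsSymmetric)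
    (hpos : ∀ w, 0 ≤ ⟪B w, w⟫) (hF : 0 < Module.finrank ℝ F) :
    0 ≤ LinearMap.det B ∧
      LinearMap.det B ≤ (LinearMap.trace ℝ F B / Module.finrank ℝ F) ^ Module.finrank ℝ F := by
  set k := Module.finrank ℝ F with hk
  have hdet := hB.det_eq_prod_eigenvalues hk.symm
  have htr := hB.trace_eq_sum_eigenvalues hk.symm
  have hnn : ∀ i, 0 ≤ hB.eigenvalues hk.symm i := by
    intro i
    have h := hpos (hB.eigenvectorBasis hk.symm i)
    rw [hB.apply_eigenvectorBasis, real_inner_smul_left, real_inner_self_eq_norm_sq,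
      OrthonormalBasis.norm_eq_one] at h
    simpa using h
  have hk0 : (0 : ℝ) < k := by exact_mod_cast hF
  have hprod : LinearMap.det B = ∏ i, hB.eigenvalues hk.symm i := by simpa using hdet
  have hsum : LinearMap.trace ℝ F B = ∑ i, hB.eigenvalues hk.symm i := by simpa using htr
  refine ⟨hprod ▸ Finset.prod_nonneg fun i _ => hnn i, ?_⟩
  have amgm := Real.geom_mean_le_arith_mean Finset.univ (fun _ : Fin k => (1 : ℝ))
    (hB.eigenvalues hk.symm) (fun _ _ => zero_le_one) (by simpa using hF) (fun i _ => hnn i)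
  simp only [Real.rpow_one, one_mul, Finset.sum_const, Finset.card_univ, Fintype.card_fin,
    nsmul_eq_mul, mul_one, ← hprod, ← hsum] at amgm
  have h0 : 0 ≤ LinearMap.det B := hprod ▸ Finset.prod_nonneg fun i _ => hnn i
  calc LinearMap.det B = (LinearMap.det B ^ (k : ℝ)⁻¹) ^ k :=
        (Real.rpow_inv_natCast_pow h0 hF.ne').symm
    _ ≤ _ := pow_le_pow_left₀ (Real.rpow_nonneg h0 _) amgm _

/-- If `L` is the identity modulo an invariant subspace `W`, then its determinant is that of its
restriction to `W`. -/
theorem det_eq_det_restrict {F : Type*} [AddCommGroup F] [Module ℝ F] [FiniteDimensional ℝ F]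
    (W : Submodule ℝ F) (L : F →ₗ[ℝ] F) (hL : ∀ x, L x - x ∈ W) (hW : W ≤ W.comap L) :
    LinearMap.det L = LinearMap.det (L.restrict hW) := by
  rw [LinearMap.det_eq_det_mul_det W L hW]
  have : W.mapQ W L hW = LinearMap.id := by
    apply W.linearMap_qext
    ext x
    simpa using (Submodule.Quotient.eq W).2 (hL x)
  rw [this, LinearMap.det_id, mul_one]

/-- `μHE[d]` is a constant multiple of the Hausdorff measure, so the constant cancels from the
Lipschitz bound. -/
theorem euclideanHausdorffMeasure_image_le_of_lipschitzOnWith {X Y : Type*} [EMetricSpace X]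
    [MeasurableSpace X] [BorelSpace X] [EMetricSpace Y] [MeasurableSpace Y] [BorelSpace Y]
    {K : ℝ≥0} {f : X → Y} {s : Set X} (hf : LipschitzOnWith K f s) (d : ℕ) :
    μHE[d] (f '' s) ≤ (K : ℝ≥0∞) ^ d * μHE[d] s := by
  have h := hf.hausdorffMeasure_image_le (d := d) (Nat.cast_nonneg d)
  rw [ENNReal.rpow_natCast] at h
  simp only [Measure.euclideanHausdorffMeasure_def, Measure.smul_apply, ENNReal.smul_def,
    smul_eq_mul]
  rw [mul_left_comm]
  gcongr

end

/-! ### Tangent spaces and graph charts -/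

section

variable {m : ℕ} {S : Set (EuclideanSpace ℝ (Fin (m + 1)))}

/-- Derivatives within `S` are determined on the tangent cone, hence on its span. This allows data
known only on `S` to be replaced by smooth extensions. -/
theorem fderivWithin_eq_of_eqOn {n : ℕ} {S : Set (EuclideanSpace ℝ (Fin n))}
    {F : Type*} [NormedAddCommGroup F] [NormedSpace ℝ F]
    {g G : EuclideanSpace ℝ (Fin n) → F} {G' : EuclideanSpace ℝ (Fin n) →L[ℝ] F}
    {p : EuclideanSpace ℝ (Fin n)} (hp : p ∈ S) (hgG : EqOn g G S) (hG : HasFDerivAt G G' p)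
    {w : EuclideanSpace ℝ (Fin n)} (hw : w ∈ tangentSpace S p) :
    fderivWithin ℝ g S p w = G' w := by
  have h1 : HasFDerivWithinAt g G' S p := hG.hasFDerivWithinAt.congr hgG (hgG hp)
  have h2 : HasFDerivWithinAt g (fderivWithin ℝ g S p) S p :=
    h1.differentiableWithinAt.hasFDerivWithinAt
  refine Submodule.span_induction (p := fun w _ => fderivWithin ℝ g S p w = G' w)
    (fun x hx => h2.unique_on h1 hx) (by simp) (fun x y _ _ hx hy => by simp [hx, hy])
    (fun a x _ hx => by simp [hx]) hw

/-- The means of differentiating along `S` an identity that holds only on `S`. -/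
theorem fderiv_eq_zero_of_forall_eq {n : ℕ} {S : Set (EuclideanSpace ℝ (Fin n))}
    {F : Type*} [NormedAddCommGroup F] [NormedSpace ℝ F]
    {G : EuclideanSpace ℝ (Fin n) → F} {G' : EuclideanSpace ℝ (Fin n) →L[ℝ] F} {c : F}
    {p : EuclideanSpace ℝ (Fin n)} (hp : p ∈ S) (hG : HasFDerivAt G G' p)
    (hc : ∀ᶠ x in 𝓝[S] p, G x = c) {w : EuclideanSpace ℝ (Fin n)} (hw : w ∈ tangentSpace S p) :
    G' w = 0 := by
  have h1 : HasFDerivWithinAt G G' S p := hG.hasFDerivWithinAt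
  have h2 : HasFDerivWithinAt G (0 : EuclideanSpace ℝ (Fin n) →L[ℝ] F) S p :=
    (hasFDerivWithinAt_const c p S).congr_of_eventuallyEq hc (hc.self_of_nhdsWithin hp)
  refine Submodule.span_induction (p := fun w _ => G' w = 0)
    (fun x hx => h1.unique_on h2 hx) (by simp) (fun x y _ _ hx hy => by simp [hx, hy])
    (fun a x _ hx => by simp [hx]) hw

theorem mem_tangentSpace_of_hasDerivAt {n : ℕ} {S : Set (EuclideanSpace ℝ (Fin n))}
    {γ : ℝ → EuclideanSpace ℝ (Fin n)} {w : EuclideanSpace ℝ (Fin n)} {t : ℝ}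
    (hγ : HasDerivAt γ w t) (hS : ∀ᶠ s in 𝓝 t, γ s ∈ S) : w ∈ tangentSpace S (γ t) := by
  apply Submodule.subset_span
  have h1 := hγ.hasFDerivAt.hasFDerivWithinAt (s := {s | γ s ∈ S}) |>.mapsTo_tangent_cone
  have h2 : (1 : ℝ) ∈ tangentConeAt ℝ {s | γ s ∈ S} t := by
    rw [tangentConeAt_of_mem_nhds hS]; trivial
  have h3 := tangentConeAt_mono (𝕜 := ℝ) (x := γ t) (image_subset_iff.2 (fun s hs => hs) :
    γ '' {s | γ s ∈ S} ⊆ S) (h1 h2)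
  simpa using h3

/-- A presentation of `S` near `p` as the graph of a `C¹` function over the hyperplane through `p`
orthogonal to the unit vector `v`, tangent to `S` at `p`. -/
structure GraphChart (S : Set (EuclideanSpace ℝ (Fin (m + 1))))
    (p v : EuclideanSpace ℝ (Fin (m + 1))) where
  /-- the coordinate system -/
  frame : AdaptedFrame v
  /-- the height function -/
  height : EuclideanSpace ℝ (Fin m) → ℝ
  contDiff_height : ContDiff ℝ 1 height
  height_zero : height 0 = 0
  fderiv_height_zero : fderiv ℝ height 0 = 0
  /-- the domain of validity -/
  domain : Set (EuclideanSpace ℝ (Fin (m + 1)))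
  isOpen_domain : IsOpen domain
  mem_domain : p ∈ domain
  mem_iff : ∀ x ∈ domain, x ∈ S ↔
    (frame.toEquiv.symm (x - p)).2 = height (frame.toEquiv.symm (x - p)).1

/-- Precomposition with `y ↦ g y • y`, for a bump function `g`, sends all of space into the ball
where `u` is regular and is the identity near 0. It makes height functions globally C¹. -/
theorem exists_contDiff_eventuallyEq {V : Type*} [NormedAddCommGroup V] [InnerProductSpace ℝ V]
    [FiniteDimensional ℝ V] {u : V → ℝ} (hu : ContDiffAt ℝ 1 u 0) :
    ∃ u' : V → ℝ, ContDiff ℝ 1 u' ∧ u' =ᶠ[𝓝 0] u := by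
  obtain ⟨r, hr, hball⟩ := Metric.eventually_nhds_iff_ball.1 (hu.eventually (by simp))
  let g : ContDiffBump (0 : V) := ⟨r / 2, r, by positivity, by linarith⟩
  refine ⟨fun y => u (g y • y), ?_, ?_⟩
  · rw [contDiff_iff_contDiffAt]
    intro y
    have hmem : g y • y ∈ ball (0 : V) r := by
      by_cases hy : y ∈ ball (0 : V) r
      · rw [mem_ball_zero_iff] at hy ⊢
        rw [norm_smul, Real.norm_of_nonneg g.nonneg]
        nlinarith [g.le_one (x := y), g.nonneg (x := y), norm_nonneg y]
      · rw [g.zero_of_le_dist (by simpa using hy)]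
        simpa using hr
    exact ContDiffAt.comp (f := fun y => g y • y) y (hball _ hmem)
      (g.contDiff.contDiffAt.smul contDiffAt_id)
  · filter_upwards [g.eventuallyEq_one] with y hy
    simp [hy]

/-- The implicit function theorem for `f` in coordinates adapted to `v`: the vertical derivative at
`p` is `c ≠ 0`, and the horizontal one is zero, so the height function has zero differential at the
center. -/
theorem exists_graphChart {p v : EuclideanSpace ℝ (Fin (m + 1))} (hv : ‖v‖ = 1)
    {U : Set (EuclideanSpace ℝ (Fin (m + 1)))} {f : EuclideanSpace ℝ (Fin (m + 1)) → ℝ}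
    (hU : IsOpen U) (hp : p ∈ S) (hpU : p ∈ U) (hf : ContDiffOn ℝ ∞ f U)
    (hS : S ∩ U = {x ∈ U | f x = 0}) {c : ℝ} (hc : c ≠ 0)
    (hfv : ∀ w, fderiv ℝ f p w = c * ⟪v, w⟫) : Nonempty (GraphChart S p v) := by
  obtain ⟨J⟩ := exists_adaptedFrame hv
  let F : EuclideanSpace ℝ (Fin m) × ℝ → ℝ := fun x => f (p + J.toEquiv x)
  have hfp : ContDiffAt ℝ 1 f p := (hf.contDiffAt (hU.mem_nhds hpU)).of_le (by simp)
  have h0 : p + J.toEquiv (0 : EuclideanSpace ℝ (Fin m) × ℝ) = p := by simp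
  have hA : ContDiff ℝ 1 fun x => p + J.toEquiv x := by fun_prop
  have hF : ContDiffAt ℝ 1 F (0, 0) := by
    refine ContDiffAt.comp (g := f) _ ?_ hA.contDiffAt
    change ContDiffAt ℝ 1 f (p + J.toEquiv (0 : EuclideanSpace ℝ (Fin m) × ℝ))
    rwa [h0]
  have hF' : fderiv ℝ F (0, 0) = (fderiv ℝ f p).comp
      (J.toEquiv : _ →L[ℝ] EuclideanSpace ℝ (Fin (m + 1))) := by
    have h1 : HasFDerivAt (fun x => p + J.toEquiv x)
        (J.toEquiv : _ →L[ℝ] EuclideanSpace ℝ (Fin (m + 1))) (0, 0) :=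
      J.toEquiv.hasFDerivAt.const_add p
    have h2 : HasFDerivAt f (fderiv ℝ f p) (p + J.toEquiv (0, 0)) := by
      have : p + J.toEquiv ((0, 0) : EuclideanSpace ℝ (Fin m) × ℝ) = p := h0
      rw [this]
      exact (hfp.differentiableAt (by simp)).hasFDerivAt
    exact (HasFDerivAt.comp (f := fun x => p + J.toEquiv x) (0, 0) h2 h1).fderiv
  have hinr : fderiv ℝ F (0, 0) ∘L .inr ℝ (EuclideanSpace ℝ (Fin m)) ℝ =
      (ContinuousLinearEquiv.unitsEquivAut ℝ (Units.mk0 c hc) : ℝ →L[ℝ] ℝ) := by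
    ext
    simp [hF', hfv, J.inner_vertical]
  have hinv : (fderiv ℝ F (0, 0) ∘L .inr ℝ (EuclideanSpace ℝ (Fin m)) ℝ).IsInvertible :=
    ⟨_, hinr.symm⟩
  have hinl : fderiv ℝ F (0, 0) ∘L .inl ℝ (EuclideanSpace ℝ (Fin m)) ℝ = 0 := by
    ext w
    simp [hF', hfv, J.inner_vertical]
  set u₀ := hF.implicitFunction (by simp) hinv with hu₀
  have hu₀c : ContDiffAt ℝ 1 u₀ 0 := hF.contDiffAt_implicitFunction (by simp) hinv
  have hu₀0 : u₀ 0 = 0 := hF.implicitFunction_apply_self (by simp) hinv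
  have hu₀' : HasFDerivAt u₀ (0 : EuclideanSpace ℝ (Fin m) →L[ℝ] ℝ) 0 := by
    have := (hF.hasStrictFDerivAt_implicitFunction (by simp) hinv).hasFDerivAt
    rwa [hinl, ContinuousLinearMap.comp_zero, neg_zero] at this
  obtain ⟨u, huc, hu⟩ := exists_contDiff_eventuallyEq hu₀c
  have hev := hF.eventually_apply_eq_iff_implicitFunction (by simp) hinv
  have hev2 : ∀ᶠ x : EuclideanSpace ℝ (Fin m) × ℝ in 𝓝 (0, 0), u x.1 = u₀ x.1 :=
    (continuousAt_fst (p := ((0 : EuclideanSpace ℝ (Fin m)), (0 : ℝ)))).eventually hu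
  have hcont : Tendsto (fun x => J.toEquiv.symm (x - p)) (𝓝 p) (𝓝 (0, 0)) := by
    have : Continuous fun x => J.toEquiv.symm (x - p) := by fun_prop
    have h := this.tendsto p
    rw [sub_self, map_zero] at h
    exact h
  obtain ⟨W, hW, hWo, hpW⟩ := _root_.eventually_nhds_iff.1
    ((hcont.eventually (hev.and hev2)).and (hU.mem_nhds hpU))
  have hfp0 : f p = 0 := ((hS ▸ (⟨hp, hpU⟩ : p ∈ S ∩ U) : p ∈ {x ∈ U | f x = 0})).2
  refine ⟨⟨J, u, huc, by rw [hu.self_of_nhds, hu₀0], ?_, W, hWo, hpW, ?_⟩⟩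
  · rw [hu.fderiv_eq, hu₀'.fderiv]
  · intro x hx
    obtain ⟨⟨h1, h2⟩, hxU⟩ := hW x hx
    have h3 : x ∈ S ↔ f x = 0 := by
      have : x ∈ S ∩ U ↔ x ∈ {x ∈ U | f x = 0} := by rw [hS]
      exact ⟨fun h => (this.1 ⟨h, hxU⟩).2, fun h => (this.2 ⟨hxU, h⟩).1⟩
    have h4 : F (J.toEquiv.symm (x - p)) = f x := by simp [F]
    have h5 : F (0, 0) = 0 := by
      change f (p + J.toEquiv (0 : EuclideanSpace ℝ (Fin m) × ℝ)) = 0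
      rw [h0, hfp0]
    rw [h4, h5] at h1
    rw [h3, h1, h2, eq_comm]

namespace GraphChart

variable {p v : EuclideanSpace ℝ (Fin (m + 1))} (C : GraphChart S p v)

/-- The parametrization of a neighborhood of the chart in which `S` is flat. -/
def straighten (x : EuclideanSpace ℝ (Fin m) × ℝ) : EuclideanSpace ℝ (Fin (m + 1)) :=
  p + C.frame.toEquiv (x.1, C.height x.1 + x.2)

/-- The graph parametrization of `S`. -/
def graph (y : EuclideanSpace ℝ (Fin m)) : EuclideanSpace ℝ (Fin (m + 1)) :=
  p + C.frame.toEquiv (y, C.height y)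

/-- The orthogonal projection to the coordinate hyperplane. -/
def proj (x : EuclideanSpace ℝ (Fin (m + 1))) : EuclideanSpace ℝ (Fin m) :=
  (C.frame.toEquiv.symm (x - p)).1

theorem straighten_zero_right (y) : C.straighten (y, 0) = C.graph y := by
  simp [straighten, graph]

theorem straighten_eq (y s) : C.straighten (y, s) = C.graph y + s • v := by
  simp only [straighten, graph]
  rw [C.frame.apply_eq _ (C.height y + s), C.frame.apply_eq _ (C.height y), add_smul, add_assoc,
    add_assoc]

theorem graph_zero : C.graph 0 = p := by
  have : (C.frame.toEquiv (0, C.height 0)) = 0 := by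
    rw [C.height_zero]; exact map_zero C.frame.toEquiv
  rw [graph, this, add_zero]

theorem proj_graph (y) : C.proj (C.graph y) = y := by simp [proj, graph]

theorem contDiff_graph : ContDiff ℝ 1 C.graph := by
  have := C.contDiff_height
  unfold graph
  fun_prop

theorem contDiff_straighten : ContDiff ℝ 1 C.straighten := by
  have := C.contDiff_height
  unfold straighten
  fun_prop

theorem contDiff_proj : ContDiff ℝ 1 C.proj := by
  unfold proj
  fun_prop

theorem hasFDerivAt_graph (y) : HasFDerivAt C.graph ((C.frame.toEquiv : _ →L[ℝ] _).comp
    ((ContinuousLinearMap.id ℝ _).prod (fderiv ℝ C.height y))) y := by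
  have h1 : HasFDerivAt C.height (fderiv ℝ C.height y) y :=
    (C.contDiff_height.differentiable (by simp) y).hasFDerivAt
  have h2 := (C.frame.toEquiv.hasFDerivAt (x := (y, C.height y))).comp y ((hasFDerivAt_id y).prodMk h1)
  exact h2.const_add p

theorem fderiv_graph (y w) : fderiv ℝ C.graph y w =
    C.frame.toEquiv (w, 0) + fderiv ℝ C.height y w • v := by
  rw [(C.hasFDerivAt_graph y).fderiv, ← C.frame.apply_eq]
  rfl

theorem fderiv_graph_zero (w) : fderiv ℝ C.graph 0 w = C.frame.toEquiv (w, 0) := by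
  rw [fderiv_graph, C.fderiv_height_zero]; simp

theorem straighten_mem_iff {x} (hx : C.straighten x ∈ C.domain) :
    C.straighten x ∈ S ↔ x.2 = 0 := by
  rw [C.mem_iff _ hx]
  simp [straighten]

theorem graph_mem {y} (hy : C.graph y ∈ C.domain) : C.graph y ∈ S := by
  rw [← C.straighten_zero_right] at hy ⊢
  exact (C.straighten_mem_iff hy).2 rfl

theorem graph_proj {x} (hx : x ∈ C.domain) (hxS : x ∈ S) : C.graph (C.proj x) = x := by
  have h := (C.mem_iff x hx).1 hxS
  have h2 : (C.proj x, C.height (C.proj x)) = C.frame.toEquiv.symm (x - p) := by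
    rw [proj, ← h]
  rw [graph, h2]
  simp

theorem mem_of_center (C : GraphChart S p v) : p ∈ S := by
  have := C.graph_mem (y := 0) (by rw [C.graph_zero]; exact C.mem_domain)
  rwa [C.graph_zero] at this

theorem eventually_graph_mem : ∀ᶠ y in 𝓝 0, C.graph y ∈ C.domain := by
  apply C.contDiff_graph.continuous.continuousAt.eventually
  rw [C.graph_zero]
  exact C.isOpen_domain.mem_nhds C.mem_domain

/-- One inclusion differentiates the defining function `⟪v, x - p⟫ - C.height (C.proj x)`, whose
differential at `p` is `⟪v, ·⟫` because the height is flat there. The other uses the curves `t ↦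
C.graph (t • y)`. -/
theorem mem_tangentSpace_iff (C : GraphChart S p v) {w} : w ∈ tangentSpace S p ↔ ⟪v, w⟫ = 0 := by
  constructor
  · intro hw
    let g : EuclideanSpace ℝ (Fin (m + 1)) → ℝ := fun x => ⟪v, x - p⟫ - C.height (C.proj x)
    have hproj : HasFDerivAt C.proj ((ContinuousLinearMap.fst ℝ _ ℝ).comp
        (C.frame.toEquiv.symm : _ →L[ℝ] _)) p := by
      have := HasFDerivAt.comp (f := fun x => x - p) p
        (C.frame.toEquiv.symm.hasFDerivAt (x := p - p)) ((hasFDerivAt_id p).sub_const p)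
      exact this.fst
    have hh : HasFDerivAt C.height (0 : EuclideanSpace ℝ (Fin m) →L[ℝ] ℝ) (C.proj p) := by
      have : C.proj p = 0 := by simp [proj]
      rw [this, ← C.fderiv_height_zero]
      exact (C.contDiff_height.differentiable (by simp) 0).hasFDerivAt
    have hg : HasFDerivAt g (innerSL ℝ v) p := by
      have h1 : HasFDerivAt (fun x => ⟪v, x - p⟫) (innerSL ℝ v) p :=
        (innerSL ℝ v).hasFDerivAt.comp p ((hasFDerivAt_id p).sub_const p)
      have := h1.sub (hh.comp p hproj)
      rw [ContinuousLinearMap.zero_comp, sub_zero] at this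
      exact this
    have h0 : ∀ᶠ x in 𝓝[S] p, g x = 0 := by
      filter_upwards [self_mem_nhdsWithin, mem_nhdsWithin_of_mem_nhds
        (C.isOpen_domain.mem_nhds C.mem_domain)] with x hx hxd
      have := (C.mem_iff x hxd).1 hx
      rw [C.frame.snd_symm] at this
      simp only [g, this, proj, sub_self]
    exact fderiv_eq_zero_of_forall_eq C.mem_of_center hg h0 hw
  · intro hw
    obtain ⟨⟨y, s⟩, rfl⟩ := C.frame.toEquiv.surjective w
    have hs : s = 0 := by rwa [C.frame.inner_vertical] at hw
    subst hs
    have hγ : HasDerivAt (fun t : ℝ => C.graph (t • y)) (C.frame.toEquiv (y, 0)) 0 := by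
      have h1 : HasDerivAt (fun t : ℝ => t • y) y 0 := by
        simpa using (hasDerivAt_id (0 : ℝ)).smul_const y
      have h2 : HasFDerivAt C.graph (fderiv ℝ C.graph 0) ((0 : ℝ) • y) := by
        rw [zero_smul]
        exact (C.contDiff_graph.differentiable (by simp) 0).hasFDerivAt
      have := h2.comp_hasDerivAt 0 h1
      rwa [C.fderiv_graph_zero] at this
    have hmem : ∀ᶠ t : ℝ in 𝓝 0, C.graph (t • y) ∈ S := by
      have h1 : Tendsto (fun t : ℝ => t • y) (𝓝 0) (𝓝 0) := by
        have : Continuous fun t : ℝ => t • y := by fun_prop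
        simpa using this.tendsto 0
      exact (h1.eventually C.eventually_graph_mem).mono fun t ht => C.graph_mem ht
    have := mem_tangentSpace_of_hasDerivAt hγ hmem
    rwa [zero_smul, C.graph_zero] at this

theorem tangentSpace_eq (C : GraphChart S p v) : tangentSpace S p = (ℝ ∙ v)ᗮ := by
  ext w
  rw [C.mem_tangentSpace_iff, Submodule.mem_orthogonal_singleton_iff_inner_right]

/-- Every tangent vector is the velocity of a `C¹` curve in `S`. -/
theorem exists_curve (C : GraphChart S p v) {w} (hw : w ∈ tangentSpace S p) :
    ∃ γ : ℝ → EuclideanSpace ℝ (Fin (m + 1)), ContDiff ℝ 1 γ ∧ γ 0 = p ∧ deriv γ 0 = w ∧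
      ∀ᶠ t in 𝓝 0, γ t ∈ S := by
  obtain ⟨⟨y, s⟩, rfl⟩ := C.frame.toEquiv.surjective w
  have hs : s = 0 := by rwa [C.mem_tangentSpace_iff, C.frame.inner_vertical] at hw
  subst hs
  refine ⟨fun t => C.graph (t • y), C.contDiff_graph.comp (by fun_prop), ?_, ?_, ?_⟩
  · simp [C.graph_zero]
  · have h1 : HasDerivAt (fun t : ℝ => t • y) y 0 := by
      simpa using (hasDerivAt_id (0 : ℝ)).smul_const y
    have h2 : HasFDerivAt C.graph (fderiv ℝ C.graph 0) ((0 : ℝ) • y) := by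
      rw [zero_smul]
      exact (C.contDiff_graph.differentiable (by simp) 0).hasFDerivAt
    have := h2.comp_hasDerivAt 0 h1
    rw [C.fderiv_graph_zero] at this
    exact this.deriv
  · have h1 : Tendsto (fun t : ℝ => t • y) (𝓝 0) (𝓝 0) := by
      have : Continuous fun t : ℝ => t • y := by fun_prop
      simpa using this.tendsto 0
    exact (h1.eventually C.eventually_graph_mem).mono fun t ht => C.graph_mem ht

end GraphChart

end

/-! ### Smooth extension of the normal field and of the mean curvature -/

section

variable {m : ℕ} {S : Set (EuclideanSpace ℝ (Fin (m + 1)))}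

/-- The partition of unity principle for sections of convex sets, stated for vector spaces. -/
theorem exists_contDiff_forall_mem_convex_of_local {E F : Type*} [NormedAddCommGroup E]
    [NormedSpace ℝ E] [FiniteDimensional ℝ E] [NormedAddCommGroup F] [NormedSpace ℝ F]
    {t : E → Set F} (ht : ∀ x, Convex ℝ (t x))
    (h : ∀ x, ∃ U ∈ 𝓝 x, ∃ g, ContDiffOn ℝ ∞ g U ∧ ∀ y ∈ U, g y ∈ t y) :
    ∃ g : E → F, ContDiff ℝ ∞ g ∧ ∀ x, g x ∈ t x := by
  obtain ⟨g, hg⟩ := exists_contMDiffMap_forall_mem_convex_of_local (n := ⊤)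
    (modelWithCornersSelf ℝ E) ht (by
      intro x
      obtain ⟨U, hU, g, h1, h2⟩ := h x
      exact ⟨U, hU, g, h1.contMDiffOn, h2⟩)
  exact ⟨g, g.contMDiff.contDiff, hg⟩

/-- A function on a closed set that locally extends smoothly has a global smooth extension. -/
theorem exists_contDiff_extension {E F : Type*} [NormedAddCommGroup E]
    [NormedSpace ℝ E] [FiniteDimensional ℝ E] [NormedAddCommGroup F] [NormedSpace ℝ F]
    {S : Set E} (hS : IsClosed S) (a : E → F)
    (h : ∀ x ∈ S, ∃ U ∈ 𝓝 x, ∃ g, ContDiffOn ℝ ∞ g U ∧ ∀ y ∈ U, y ∈ S → a y = g y) :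
    ∃ g : E → F, ContDiff ℝ ∞ g ∧ ∀ x ∈ S, a x = g x := by
  -- The constraint is a single point over `S` and the whole space elsewhere, so it is convex
  -- everywhere.
  refine exists_contDiff_forall_mem_convex_of_local (t := fun x => {z | x ∈ S → a x = z})
    (fun x => ?_) (fun x => ?_)
  · by_cases hx : x ∈ S
    · have : {z | x ∈ S → a x = z} = {a x} := by ext z; simp [hx, eq_comm]
      rw [this]; exact convex_singleton _
    · have : {z | x ∈ S → a x = z} = univ := by ext z; simp [hx]
      rw [this]; exact convex_univ
  · by_cases hx : x ∈ S
    · exact h x hx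
    · exact ⟨Sᶜ, hS.isOpen_compl.mem_nhds hx, fun _ => 0, contDiffOn_const,
        fun y hy hyS => (hy hyS).elim⟩

/-- The graph chart in the direction of the gradient of `f` identifies the normal line of `S` with
the span of that gradient; the unit normal lies on this line. -/
theorem exists_fderiv_eq_inner {ν : EuclideanSpace ℝ (Fin (m + 1)) → EuclideanSpace ℝ (Fin (m + 1))}
    (hν1 : ∀ p ∈ S, ‖ν p‖ = 1) (hνT : ∀ p ∈ S, ν p ∈ (tangentSpace S p)ᗮ)
    {U : Set (EuclideanSpace ℝ (Fin (m + 1)))} {f : EuclideanSpace ℝ (Fin (m + 1)) → ℝ}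
    (hU : IsOpen U) (hf : ContDiffOn ℝ ∞ f U) (hf0 : ∀ x ∈ U, fderiv ℝ f x ≠ 0)
    (hS : S ∩ U = {x ∈ U | f x = 0}) {q : EuclideanSpace ℝ (Fin (m + 1))} (hq : q ∈ S)
    (hqU : q ∈ U) : ∃ c : ℝ, c ≠ 0 ∧ ∀ w, fderiv ℝ f q w = c * ⟪ν q, w⟫ := by
  set G := (InnerProductSpace.toDual ℝ (EuclideanSpace ℝ (Fin (m + 1)))).symm (fderiv ℝ f q)
    with hG
  have hGw : ∀ w, fderiv ℝ f q w = ⟪G, w⟫ := fun w => by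
    rw [hG, InnerProductSpace.toDual_symm_apply]
  have hG0 : G ≠ 0 := by
    rw [hG, Ne, LinearIsometryEquiv.map_eq_zero_iff]
    exact hf0 q hqU
  have hGn : ‖G‖ ≠ 0 := norm_ne_zero_iff.2 hG0
  obtain ⟨C⟩ := exists_graphChart (v := ‖G‖⁻¹ • G) (c := ‖G‖) (by
    rw [norm_smul, norm_inv, norm_norm, inv_mul_cancel₀ hGn]) hU hq hqU hf hS hGn (by
    intro w
    rw [hGw, real_inner_smul_left, mul_inv_cancel_left₀ hGn])
  have h1 := hνT q hq
  rw [C.tangentSpace_eq, Submodule.orthogonal_orthogonal] at h1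
  obtain ⟨a, ha⟩ := Submodule.mem_span_singleton.1 h1
  have ha0 : a ≠ 0 := by
    rintro rfl
    have := hν1 q hq
    rw [← ha] at this
    simp at this
  refine ⟨‖G‖ / a, div_ne_zero hGn ha0, fun w => ?_⟩
  rw [hGw, ← ha, real_inner_smul_left, real_inner_smul_left]
  field_simp

/-- `N` is a smooth map whose restriction to `S` is a unit normal field. -/
structure IsExtendedNormal (S : Set (EuclideanSpace ℝ (Fin (m + 1))))
    (N : EuclideanSpace ℝ (Fin (m + 1)) → EuclideanSpace ℝ (Fin (m + 1))) : Prop where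
  contDiff : ContDiff ℝ ∞ N
  norm_eq_one : ∀ p ∈ S, ‖N p‖ = 1
  chart : ∀ p ∈ S, Nonempty (GraphChart S p (N p))
  symm : ∀ p ∈ S, ∀ w ∈ tangentSpace S p, ∀ w' ∈ tangentSpace S p,
    ⟪fderiv ℝ N p w, w'⟫ = ⟪w, fderiv ℝ N p w'⟫

/-- Locally the normal is the normalized gradient of a defining function up to a sign, constant near
`p` by continuity of `ν`; the local extensions are glued. Symmetry of the derivative on tangent
vectors is inherited from the Hessian of the defining function. -/
theorem exists_isExtendedNormal
    {ν : EuclideanSpace ℝ (Fin (m + 1)) → EuclideanSpace ℝ (Fin (m + 1))}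
    (hS : IsSmoothHypersurface S) (hSc : IsClosed S) (hνc : ContinuousOn ν S)
    (hν1 : ∀ p ∈ S, ‖ν p‖ = 1) (hνT : ∀ p ∈ S, ν p ∈ (tangentSpace S p)ᗮ) :
    ∃ N, IsExtendedNormal S N ∧ EqOn ν N S := by
  have hlocal : ∀ p ∈ S, ∃ U ∈ 𝓝 p, ∃ g, ContDiffOn ℝ ∞ g U ∧ ∀ y ∈ U, y ∈ S → ν y = g y := by
    intro p hp
    obtain ⟨U, f, hU, hpU, hf, hf0, hSU⟩ := hS p hp
    let G : EuclideanSpace ℝ (Fin (m + 1)) → EuclideanSpace ℝ (Fin (m + 1)) :=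
      fun x => (InnerProductSpace.toDual ℝ (EuclideanSpace ℝ (Fin (m + 1)))).symm (fderiv ℝ f x)
    have hGw : ∀ x w, fderiv ℝ f x w = ⟪G x, w⟫ := fun x w => by
      rw [InnerProductSpace.toDual_symm_apply]
    have hGs : ContDiffOn ℝ ∞ G U :=
      (InnerProductSpace.toDual ℝ (EuclideanSpace ℝ (Fin (m + 1)))).symm.contDiff.comp_contDiffOn
        (hf.fderiv_of_isOpen hU (by simp))
    have hG0 : ∀ x ∈ U, G x ≠ 0 := fun x hx h => hf0 x hx (by
      exact (LinearIsometryEquiv.map_eq_zero_iff _).1 h)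
    have hGν : ∀ q ∈ S, q ∈ U → G q = ⟪G q, ν q⟫ • ν q ∧ |⟪G q, ν q⟫| = ‖G q‖ := by
      intro q hq hqU
      obtain ⟨c, -, hcw⟩ := exists_fderiv_eq_inner hν1 hνT hU hf hf0 hSU hq hqU
      have h1 : G q = c • ν q := ext_inner_right ℝ fun w => by
        rw [← hGw, hcw, real_inner_smul_left]
      have h2 : ⟪G q, ν q⟫ = c := by
        rw [h1, real_inner_smul_left, real_inner_self_eq_norm_sq, hν1 q hq]; simp
      rw [h2]
      refine ⟨h1, ?_⟩
      rw [h1, norm_smul, hν1 q hq, mul_one, Real.norm_eq_abs]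
    have hcont : ContinuousWithinAt (fun q => ⟪G p, ν p⟫ * ⟪G q, ν q⟫) S p := by
      have h1 : ContinuousWithinAt G S p :=
        (hGs.continuousOn.continuousAt (hU.mem_nhds hpU)).continuousWithinAt
      exact continuousWithinAt_const.mul (Filter.Tendsto.inner h1 (hνc p hp))
    have hpos : 0 < ⟪G p, ν p⟫ * ⟪G p, ν p⟫ := by
      have : ⟪G p, ν p⟫ ≠ 0 := by
        rw [← abs_ne_zero, (hGν p hp hpU).2]
        exact norm_ne_zero_iff.2 (hG0 p hpU)
      exact mul_self_pos.2 this
    have hev : ∀ᶠ q in 𝓝 p, q ∈ S → 0 < ⟪G p, ν p⟫ * ⟪G q, ν q⟫ :=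
      eventually_nhdsWithin_iff.1 (hcont.eventually (lt_mem_nhds hpos))
    -- The scalar factor is the sign of `⟪G p, ν p⟫`; on the chosen neighborhood `⟪G q, ν q⟫` has
    -- the same sign at points of `S`.
    refine ⟨U ∩ {q | q ∈ S → 0 < ⟪G p, ν p⟫ * ⟪G q, ν q⟫},
      inter_mem (hU.mem_nhds hpU) hev,
      fun x => (⟪G p, ν p⟫ / |⟪G p, ν p⟫|) • ‖G x‖⁻¹ • G x, ?_, ?_⟩
    · apply ContDiffOn.mono _ inter_subset_left
      have h1 : ContDiffOn ℝ ∞ (fun x => ‖G x‖⁻¹) U := (hGs.norm ℝ hG0).inv fun x hx =>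
        norm_ne_zero_iff.2 (hG0 x hx)
      have h2 : ContDiffOn ℝ ∞ (fun x => ‖G x‖⁻¹ • G x) U := h1.smul hGs
      exact (contDiffOn_const (c := ⟪G p, ν p⟫ / |⟪G p, ν p⟫|)).smul h2
    · rintro q ⟨hqU, hq⟩ hqS
      obtain ⟨h1, h2⟩ := hGν q hqS hqU
      specialize hq hqS
      have hn := norm_ne_zero_iff.2 (hG0 q hqU)
      set a := ⟪G p, ν p⟫
      set b := ⟪G q, ν q⟫
      change ν q = (a / |a|) • ‖G q‖⁻¹ • G q
      rw [← h2, h1, smul_smul, smul_smul]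
      have : a / |a| * (|b|⁻¹ * b) = 1 := by
        rcases lt_or_gt_of_ne (left_ne_zero_of_mul hq.ne') with ha | ha
        · have hb : b < 0 := by nlinarith
          rw [abs_of_neg ha, abs_of_neg hb]
          field_simp [ha.ne, hb.ne]
        · have hb : 0 < b := by nlinarith
          rw [abs_of_pos ha, abs_of_pos hb]
          field_simp
      rw [mul_assoc, this, one_smul]
  obtain ⟨N, hN, hNν⟩ := exists_contDiff_extension hSc ν hlocal
  refine ⟨N, ⟨hN, fun p hp => by rw [← hNν p hp]; exact hν1 p hp, ?_, ?_⟩, hNν⟩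
  · intro p hp
    obtain ⟨U, f, hU, hpU, hf, hf0, hSU⟩ := hS p hp
    obtain ⟨c, hc, hcw⟩ := exists_fderiv_eq_inner hν1 hνT hU hf hf0 hSU hp hpU
    rw [← hNν p hp]
    exact exists_graphChart (hν1 p hp) hU hp hpU hf hSU hc hcw
  · intro p hp
    obtain ⟨U, f, hU, hpU, hf, hf0, hSU⟩ := hS p hp
    have hGd : DifferentiableAt ℝ (fderiv ℝ f) p :=
      ((hf.fderiv_of_isOpen (m := ∞) hU (by simp)).contDiffAt (hU.mem_nhds hpU)).differentiableAt
        (by simp)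
    have hNd : DifferentiableAt ℝ N p := hN.differentiable (by simp) p
    have hperp : ∀ w ∈ tangentSpace S p, ⟪N p, w⟫ = 0 := fun w hw => by
      rw [← hNν p hp, real_inner_comm]
      exact (Submodule.mem_orthogonal _ _).1 (hνT p hp) w hw
    obtain ⟨c, hc, hcw⟩ := exists_fderiv_eq_inner hν1 hνT hU hf hf0 hSU hp hpU
    have hcN : fderiv ℝ f p (N p) = c := by
      rw [hcw, hNν p hp, real_inner_self_eq_norm_sq, ← hNν p hp, hν1 p hp]; ring
    have key : ∀ w ∈ tangentSpace S p, ∀ w' ∈ tangentSpace S p,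
        fderiv ℝ (fderiv ℝ f) p w w' = c * ⟪fderiv ℝ N p w, w'⟫ := by
      intro w hw w' hw'
      -- On `S` near `p` this function vanishes because the gradient is normal, for any fixed `w'`.
      -- Differentiating along `w` and using that `w'` is tangent at `p`, only the Hessian of `f`
      -- and `c * ⟪fderiv ℝ N p w, w'⟫` survive.
      have hd1 : HasFDerivAt (fun x => fderiv ℝ f x w' - fderiv ℝ f x (N x) * ⟪N x, w'⟫)
          (_ : EuclideanSpace ℝ (Fin (m + 1)) →L[ℝ] ℝ) p :=
        (hGd.hasFDerivAt.clm_apply (hasFDerivAt_const w' p)).sub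
          ((hGd.hasFDerivAt.clm_apply hNd.hasFDerivAt).mul
            (hNd.hasFDerivAt.inner ℝ (hasFDerivAt_const w' p)))
      have h0 : ∀ᶠ x in 𝓝[S] p, fderiv ℝ f x w' - fderiv ℝ f x (N x) * ⟪N x, w'⟫ = 0 := by
        filter_upwards [self_mem_nhdsWithin, mem_nhdsWithin_of_mem_nhds (hU.mem_nhds hpU)]
          with x hx hxU
        obtain ⟨c', -, hcw'⟩ := exists_fderiv_eq_inner hν1 hνT hU hf hf0 hSU hx hxU
        rw [hcw', hcw', ← hNν x hx, real_inner_self_eq_norm_sq, hν1 x hx]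
        ring
      have h1 := fderiv_eq_zero_of_forall_eq hp hd1 h0 hw
      simp [hperp w' hw', hcN] at h1
      linarith
    intro w hw w' hw'
    have hsymm : IsSymmSndFDerivAt ℝ f p :=
      (hf.contDiffAt (hU.mem_nhds hpU)).isSymmSndFDerivAt (by simp; exact WithTop.coe_le_coe.2 le_top)
    have h1 := key w hw w' hw'
    have h2 := key w' hw' w hw
    rw [hsymm.eq w w', h2] at h1
    rw [real_inner_comm _ w]
    exact (mul_left_cancel₀ hc h1).symm

/-- The mean curvature expressed through an extension of the normal field. -/
def extendedMeanCurvature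
    (N : EuclideanSpace ℝ (Fin (m + 1)) → EuclideanSpace ℝ (Fin (m + 1)))
    (x : EuclideanSpace ℝ (Fin (m + 1))) : ℝ :=
  (LinearMap.trace ℝ _ (fderiv ℝ N x).toLinearMap - ⟪N x, fderiv ℝ N x (N x)⟫) / m

theorem contDiff_extendedMeanCurvature
    {N : EuclideanSpace ℝ (Fin (m + 1)) → EuclideanSpace ℝ (Fin (m + 1))} (hN : ContDiff ℝ ∞ N) :
    ContDiff ℝ ∞ (extendedMeanCurvature N) := by
  have h1 : ContDiff ℝ ∞ (fderiv ℝ N) := hN.fderiv_right (by simp)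
  have h2 : ContDiff ℝ ∞ fun x => LinearMap.trace ℝ _ (fderiv ℝ N x).toLinearMap :=
    ((LinearMap.trace ℝ (EuclideanSpace ℝ (Fin (m + 1)))) ∘ₗ
      (ContinuousLinearMap.coeLM ℝ)).toContinuousLinearMap.contDiff.comp h1
  exact (h2.sub (hN.inner ℝ (h1.clm_apply hN))).div_const _

namespace IsExtendedNormal

variable {N : EuclideanSpace ℝ (Fin (m + 1)) → EuclideanSpace ℝ (Fin (m + 1))}
  {p : EuclideanSpace ℝ (Fin (m + 1))}

theorem mem_tangentSpace_iff (hN : IsExtendedNormal S N) (hp : p ∈ S) {w} :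
    w ∈ tangentSpace S p ↔ ⟪N p, w⟫ = 0 :=
  (hN.chart p hp).some.mem_tangentSpace_iff

/-- Differentiate `⟪N, N⟫ = 1` along `S`; off `S` the extension need not have length one, so `w`
must be tangent. -/
theorem inner_fderiv (hN : IsExtendedNormal S N) (hp : p ∈ S) {w} (hw : w ∈ tangentSpace S p) :
    ⟪N p, fderiv ℝ N p w⟫ = 0 := by
  have hd : HasFDerivAt N (fderiv ℝ N p) p := (hN.contDiff.differentiable (by simp) p).hasFDerivAt
  have h0 : ∀ᶠ x in 𝓝[S] p, ⟪N x, N x⟫ = 1 := by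
    filter_upwards [self_mem_nhdsWithin] with x hx
    rw [real_inner_self_eq_norm_sq, hN.norm_eq_one x hx]; simp
  have h1 := fderiv_eq_zero_of_forall_eq hp (hd.inner ℝ hd) h0 hw
  simp only [ContinuousLinearMap.comp_apply, ContinuousLinearMap.prod_apply,
    fderivInnerCLM_apply] at h1
  rw [real_inner_comm (N p) (fderiv ℝ N p w)] at h1
  linarith

theorem fderiv_mem_tangentSpace (hN : IsExtendedNormal S N) (hp : p ∈ S) {w}
    (hw : w ∈ tangentSpace S p) : fderiv ℝ N p w ∈ tangentSpace S p :=
  (hN.mem_tangentSpace_iff hp).2 (hN.inner_fderiv hp hw)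

theorem starProjection_apply (hN : IsExtendedNormal S N) (hp : p ∈ S) (x) :
    (tangentSpace S p).starProjection x = x - ⟪N p, x⟫ • N p := by
  have h : (tangentSpace S p) = (ℝ ∙ N p)ᗮ := (hN.chart p hp).some.tangentSpace_eq
  have h2 := Submodule.starProjection_orthogonal_val (K := ℝ ∙ N p) x
  rw [Submodule.starProjection_unit_singleton ℝ (hN.norm_eq_one p hp)] at h2
  rw [← h2]
  congr!

theorem finrank_tangentSpace (hN : IsExtendedNormal S N) (hp : p ∈ S) :
    Module.finrank ℝ (tangentSpace S p) = m := by
  have h : (tangentSpace S p) = (ℝ ∙ N p)ᗮ := (hN.chart p hp).some.tangentSpace_eq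
  rw [h]
  have h0 : N p ≠ 0 := by
    intro h0
    have := hN.norm_eq_one p hp
    simp [h0] at this
  have : Fact (Module.finrank ℝ (EuclideanSpace ℝ (Fin (m + 1))) = m + 1) := ⟨by simp⟩
  exact Submodule.finrank_orthogonal_span_singleton h0

theorem coe_shapeOperator (hN : IsExtendedNormal S N)
    {ν : EuclideanSpace ℝ (Fin (m + 1)) → EuclideanSpace ℝ (Fin (m + 1))} (hν : EqOn ν N S)
    (hp : p ∈ S) (w : tangentSpace S p) : (shapeOperator S ν p w : EuclideanSpace ℝ (Fin (m + 1))) =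
      fderiv ℝ N p w := by
  have h1 := fderivWithin_eq_of_eqOn hp hν
    (hN.contDiff.differentiable (by simp) p).hasFDerivAt w.2
  change ((tangentSpace S p).orthogonalProjectionOnto (fderivWithin ℝ ν S p w) :
    EuclideanSpace ℝ (Fin (m + 1))) = _
  rw [h1, ← Submodule.starProjection_apply, Submodule.starProjection_eq_self_iff]
  exact hN.fderiv_mem_tangentSpace hp w.2

/-- By cyclicity, the trace is that of the derivative of `N` composed with the tangential
projection, that is, the derivative minus a rank-one operator. This explains the correction term in
`extendedMeanCurvature`. -/
theorem trace_shapeOperator (hN : IsExtendedNormal S N)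
    {ν : EuclideanSpace ℝ (Fin (m + 1)) → EuclideanSpace ℝ (Fin (m + 1))} (hν : EqOn ν N S)
    (hp : p ∈ S) (hm : m ≠ 0) : LinearMap.trace ℝ (tangentSpace S p) (shapeOperator S ν p) =
      m * extendedMeanCurvature N p := by
  have h1 : shapeOperator S ν p = (tangentSpace S p).orthogonalProjectionOnto.toLinearMap ∘ₗ
      ((fderiv ℝ N p).toLinearMap ∘ₗ (tangentSpace S p).subtype) := by
    apply LinearMap.ext
    intro w
    change (tangentSpace S p).orthogonalProjectionOnto (fderivWithin ℝ ν S p w) =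
      (tangentSpace S p).orthogonalProjectionOnto (fderiv ℝ N p w)
    rw [fderivWithin_eq_of_eqOn hp hν
      (hN.contDiff.differentiable (by simp) p).hasFDerivAt w.2]
  have h2 : ((fderiv ℝ N p).toLinearMap ∘ₗ (tangentSpace S p).subtype) ∘ₗ
      (tangentSpace S p).orthogonalProjectionOnto.toLinearMap =
      (fderiv ℝ N p).toLinearMap -
        (innerSL ℝ (N p)).toLinearMap.smulRight (fderiv ℝ N p (N p)) := by
    apply LinearMap.ext
    intro x
    change fderiv ℝ N p ((tangentSpace S p).starProjection x) =
      fderiv ℝ N p x - ⟪N p, x⟫ • fderiv ℝ N p (N p)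
    rw [hN.starProjection_apply hp, map_sub, map_smul]
  rw [h1, LinearMap.trace_comp_comm', h2, map_sub, LinearMap.trace_smulRight,
    extendedMeanCurvature]
  have : (m : ℝ) ≠ 0 := by exact_mod_cast hm
  rw [mul_div_cancel₀ _ this]
  rfl

theorem meanCurvature_eq (hN : IsExtendedNormal S N)
    {ν : EuclideanSpace ℝ (Fin (m + 1)) → EuclideanSpace ℝ (Fin (m + 1))} (hν : EqOn ν N S)
    (hp : p ∈ S) (hm : m ≠ 0) : meanCurvature S ν p = extendedMeanCurvature N p := by
  have : (m : ℝ) ≠ 0 := by exact_mod_cast hm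
  rw [meanCurvature, hN.trace_shapeOperator hν hp hm]
  push_cast
  rw [add_sub_cancel_right, mul_div_cancel_left₀ _ this]

end IsExtendedNormal

end

/-! ### The enclosed region, nearest points and touching balls -/

section

variable {m : ℕ} {S Ω : Set (EuclideanSpace ℝ (Fin (m + 1)))}
  {N : EuclideanSpace ℝ (Fin (m + 1)) → EuclideanSpace ℝ (Fin (m + 1))}
  {p : EuclideanSpace ℝ (Fin (m + 1))}

/-- `Ω` is a bounded open set, a union of components of the complement of `S`, and `N` points out of
`Ω` along `S`. -/
structure IsInterior (S : Set (EuclideanSpace ℝ (Fin (m + 1))))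
    (N : EuclideanSpace ℝ (Fin (m + 1)) → EuclideanSpace ℝ (Fin (m + 1)))
    (Ω : Set (EuclideanSpace ℝ (Fin (m + 1)))) : Prop where
  isOpen : IsOpen Ω
  isBounded : Bornology.IsBounded Ω
  subset_compl : Ω ⊆ Sᶜ
  subset_of_isPreconnected : ∀ T, IsPreconnected T → T ⊆ Sᶜ → (T ∩ Ω).Nonempty → T ⊆ Ω
  inward : ∀ p ∈ S, ∀ᶠ t : ℝ in 𝓝[>] 0, p - t • N p ∈ Ω
  outward : ∀ p ∈ S, ∀ᶠ t : ℝ in 𝓝[>] 0, p + t • N p ∉ Ω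

/-- Boundedness is the only delicate point, since a union of bounded components might be unbounded.
From a point outside a ball containing `S`, the radial ray to infinity misses `S`, so its component
is unbounded. -/
theorem IsOutwardUnitNormal.isInterior
    {ν : EuclideanSpace ℝ (Fin (m + 1)) → EuclideanSpace ℝ (Fin (m + 1))}
    (hν : IsOutwardUnitNormal S ν) (hνN : EqOn ν N S) (hS : IsCompact S) :
    IsInterior S N (enclosedRegion S) := by
  have hsub : ∀ T, IsPreconnected T → T ⊆ Sᶜ → (T ∩ enclosedRegion S).Nonempty →
      T ⊆ enclosedRegion S := by
    rintro T hT hTS ⟨x, hxT, hxS, hxb⟩ y hy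
    refine ⟨hTS hy, hxb.subset ?_⟩
    have h1 : y ∈ connectedComponentIn Sᶜ x := hT.subset_connectedComponentIn hxT hTS hy
    rw [connectedComponentIn_eq h1]
  refine ⟨?_, ?_, fun x hx => hx.1, hsub, fun p hp => ?_, fun p hp => ?_⟩
  · rw [Metric.isOpen_iff]
    intro x hx
    obtain ⟨r, hr, hball⟩ := Metric.isOpen_iff.1 hS.isClosed.isOpen_compl x hx.1
    exact ⟨r, hr, hsub _ (convex_ball x r).isPreconnected hball
      ⟨x, mem_ball_self hr, hx⟩⟩
  · obtain ⟨R, hR⟩ := hS.isBounded.subset_ball 0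
    refine (isBounded_closedBall (x := (0 : EuclideanSpace ℝ (Fin (m + 1)))) (r := |R|)).subset ?_
    rintro x hx
    by_contra hxR
    rw [mem_closedBall_zero_iff, not_le] at hxR
    have hx0 : 0 < ‖x‖ := (abs_nonneg R).trans_lt hxR
    have hray : (fun s : ℝ => s • x) '' Ici 1 ⊆ enclosedRegion S := by
      apply hsub
      · exact (convex_Ici 1).isPreconnected.image _ (by fun_prop)
      · rintro _ ⟨s, hs, rfl⟩ hsS
        have h1 := hR hsS
        rw [mem_ball_zero_iff, norm_smul, Real.norm_of_nonneg (zero_le_one.trans hs)] at h1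
        have h2 : ‖x‖ ≤ s * ‖x‖ := le_mul_of_one_le_left hx0.le hs
        have := le_abs_self R
        linarith
      · exact ⟨x, ⟨1, self_mem_Ici, one_smul ℝ x⟩, hx⟩
    have hunb : (fun s : ℝ => s • x) '' Ici 1 ⊆ connectedComponentIn Sᶜ x := by
      apply IsPreconnected.subset_connectedComponentIn
      · exact (convex_Ici 1).isPreconnected.image _ (by fun_prop)
      · exact ⟨1, self_mem_Ici, one_smul ℝ x⟩
      · exact fun y hy => (hray hy).1
    obtain ⟨B, hB⟩ := hx.2.exists_norm_le
    -- The factor `1 + |B| / ‖x‖` gives a point of norm `‖x‖ + |B|`, beyond the bound `B`.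
    have h := hB _ (hunb ⟨1 + |B| / ‖x‖, by simp only [mem_Ici, le_add_iff_nonneg_right]; positivity, rfl⟩)
    rw [norm_smul, Real.norm_of_nonneg (by positivity), add_mul, div_mul_cancel₀ _ hx0.ne'] at h
    have := le_abs_self B
    linarith
  · rw [← hνN hp]; exact hν.inward p hp
  · rw [← hνN hp]; exact hν.outward p hp

namespace IsInterior

/-- In a graph chart, the enclosed region is the part below the graph. -/
theorem exists_straighten_mem_iff (hΩ : IsInterior S N Ω) (C : GraphChart S p (N p)) :
    ∃ δ > 0, ∀ y : EuclideanSpace ℝ (Fin m), ‖y‖ < δ → ∀ s : ℝ, |s| < δ →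
      C.straighten (y, s) ∈ C.domain ∧ (C.straighten (y, s) ∈ Ω ↔ s < 0) := by
  have h0 : C.straighten 0 = p := by
    have := C.straighten_zero_right 0
    rw [C.graph_zero] at this; exact this
  have hmem : ∀ᶠ x in 𝓝 (0 : EuclideanSpace ℝ (Fin m) × ℝ), C.straighten x ∈ C.domain := by
    apply C.contDiff_straighten.continuous.continuousAt.eventually
    rw [h0]
    exact C.isOpen_domain.mem_nhds C.mem_domain
  obtain ⟨δ, hδ, hball⟩ := Metric.eventually_nhds_iff_ball.1 hmem
  have hdom : ∀ y : EuclideanSpace ℝ (Fin m), ‖y‖ < δ → ∀ s : ℝ, |s| < δ →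
      C.straighten (y, s) ∈ C.domain := fun y hy s hs => hball _ (by
    rw [mem_ball_zero_iff, Prod.norm_mk, max_lt_iff]; exact ⟨hy, hs⟩)
  have hcv : ∀ t : ℝ, C.straighten (0, t) = p + t • N p := fun t => by
    rw [C.straighten_eq, C.graph_zero]
  have hp : p ∈ S := C.mem_of_center
  have hpre : ∀ I : Set ℝ, Convex ℝ I →
      IsPreconnected (C.straighten '' (ball (0 : EuclideanSpace ℝ (Fin m)) δ ×ˢ I)) := fun I hI =>
    ((convex_ball _ _).prod hI).isPreconnected.image _ C.contDiff_straighten.continuous.continuousOn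
  have hcompl : ∀ I : Set ℝ, I ⊆ Ioo (-δ) δ → (0 : ℝ) ∉ I →
      C.straighten '' (ball (0 : EuclideanSpace ℝ (Fin m)) δ ×ˢ I) ⊆ Sᶜ := by
    rintro I hI h0I _ ⟨⟨y, s⟩, ⟨hy, hs⟩, rfl⟩ hS
    have h1 := hdom y (mem_ball_zero_iff.1 hy) s (abs_lt.2 (hI hs))
    have h2 := (C.straighten_mem_iff h1).1 hS
    simp only at h2 hs
    exact h0I (h2 ▸ hs)
  -- Each open half of the box is connected and misses `S`, so one point of it decides whether it
  -- lies in `Ω`; the inward and outward normal segments supply such points.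
  have hneg : C.straighten '' (ball (0 : EuclideanSpace ℝ (Fin m)) δ ×ˢ Ioo (-δ) 0) ⊆ Ω := by
    refine hΩ.subset_of_isPreconnected _ (hpre _ (convex_Ioo _ _))
      (hcompl _ (Ioo_subset_Ioo_right hδ.le) (by simp)) ?_
    obtain ⟨t, ht, ht2⟩ := ((hΩ.inward p hp).and (Ioo_mem_nhdsGT hδ)).exists
    refine ⟨p - t • N p, ⟨(0, -t), ⟨mem_ball_self hδ, ?_⟩, ?_⟩, ht⟩
    · exact ⟨neg_lt_neg ht2.2, neg_neg_of_pos ht2.1⟩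
    · rw [hcv, neg_smul, sub_eq_add_neg]
  refine ⟨δ, hδ, fun y hy s hs => ⟨hdom y hy s hs, fun hmem => ?_, fun hs0 => ?_⟩⟩
  · by_contra! hs0
    rcases hs0.eq_or_lt with rfl | hs0
    · exact hΩ.subset_compl hmem ((C.straighten_mem_iff (hdom y hy 0 hs)).2 rfl)
    have hpos : C.straighten '' (ball (0 : EuclideanSpace ℝ (Fin m)) δ ×ˢ Ioo 0 δ) ⊆ Ω := by
      refine hΩ.subset_of_isPreconnected _ (hpre _ (convex_Ioo _ _))
        (hcompl _ (Ioo_subset_Ioo_left (neg_nonpos.2 hδ.le)) (by simp)) ?_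
      exact ⟨_, ⟨(y, s), ⟨mem_ball_zero_iff.2 hy, hs0, (abs_lt.1 hs).2⟩, rfl⟩, hmem⟩
    obtain ⟨t, ht, ht2⟩ := ((hΩ.outward p hp).and (Ioo_mem_nhdsGT hδ)).exists
    exact ht (hpos ⟨(0, t), ⟨mem_ball_self hδ, ht2⟩, hcv t⟩)
  · exact hneg ⟨(y, s), ⟨mem_ball_zero_iff.2 hy, (abs_lt.1 hs).1, hs0⟩, rfl⟩

/-- Every point of the enclosed region is reached along the inward normal from a nearest point. -/
theorem exists_nearest (hΩ : IsInterior S N Ω) (hN : IsExtendedNormal S N) (hS : IsCompact S)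
    (hne : S.Nonempty) {x : EuclideanSpace ℝ (Fin (m + 1))} (hx : x ∈ Ω) :
    ∃ p ∈ S, ∃ t > 0, x = p - t • N p ∧ ∀ q ∈ S, t ≤ ‖q - p + t • N p‖ := by
  obtain ⟨p, hp, hpx⟩ := hS.exists_infDist_eq_dist hne x
  have hmin : ∀ q ∈ S, ‖p - x‖ ≤ ‖q - x‖ := fun q hq => by
    rw [← dist_eq_norm, ← dist_eq_norm, dist_comm p, dist_comm q, ← hpx]
    exact infDist_le_dist_of_mem hq
  have hρ : 0 < ‖p - x‖ := norm_pos_iff.2 (sub_ne_zero.2 fun h => hΩ.subset_compl hx (h ▸ hp))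
  obtain ⟨C⟩ := hN.chart p hp
  -- First variation of the squared distance to `x` along curves in `S`.
  have hperp : p - x ∈ (tangentSpace S p)ᗮ := by
    rw [Submodule.mem_orthogonal]
    intro w hw
    obtain ⟨γ, hγ, hγ0, hγ', hγS⟩ := C.exists_curve hw
    have hd : HasDerivAt γ w 0 := hγ' ▸ (hγ.differentiable (by simp) 0).hasDerivAt
    have h1 : HasDerivAt (fun s => ‖γ s - x‖ ^ 2) (2 * ⟪γ 0 - x, w⟫) 0 :=
      (hd.sub_const x).norm_sq
    have h2 : IsLocalMin (fun s => ‖γ s - x‖ ^ 2) 0 := by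
      filter_upwards [hγS] with s hs
      rw [hγ0]
      exact pow_le_pow_left₀ (norm_nonneg _) (hmin _ hs) 2
    have h3 := h2.hasDerivAt_eq_zero h1
    rw [hγ0, real_inner_comm] at h3
    linarith
  rw [C.tangentSpace_eq, Submodule.orthogonal_orthogonal] at hperp
  obtain ⟨a, ha⟩ := Submodule.mem_span_singleton.1 hperp
  have hax : x = p - a • N p := by rw [ha]; abel
  have haρ : |a| = ‖p - x‖ := by rw [← ha, norm_smul, hN.norm_eq_one p hp, mul_one, Real.norm_eq_abs]
  -- The open ball up to the nearest point misses `S`, so it lies in `Ω`. If `a ≤ 0`, it would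
  -- contain points just outside `S` along the outward normal.
  have hball : ball x ‖p - x‖ ⊆ Ω := by
    refine hΩ.subset_of_isPreconnected _ (convex_ball _ _).isPreconnected (fun q hq hqS => ?_)
      ⟨x, mem_ball_self hρ, hx⟩
    rw [mem_ball, dist_eq_norm] at hq
    exact absurd (hmin q hqS) (not_le.2 hq)
  have ha0 : 0 < a := by
    by_contra! ha0
    obtain ⟨t, ht, ht2⟩ := ((hΩ.outward p hp).and (Ioo_mem_nhdsGT hρ)).exists
    apply ht
    apply hball
    rw [mem_ball, dist_eq_norm, hax]
    have : p + t • N p - (p - a • N p) = (t + a) • N p := by rw [add_smul]; abel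
    rw [this, norm_smul, hN.norm_eq_one p hp, mul_one, Real.norm_eq_abs]
    rw [abs_of_nonpos ha0] at haρ
    rw [← hax, ← haρ, abs_lt]
    constructor <;> linarith [ht2.1, ht2.2]
  refine ⟨p, hp, a, ha0, hax, fun q hq => ?_⟩
  have h1 := hmin q hq
  rw [← haρ, abs_of_pos ha0, hax] at h1
  convert h1 using 2
  abel

end IsInterior

/-- If `L` were negative, `g` would strictly decrease from 0. Working with the first derivative
divided by a power of `s` extracts the second and third order conditions (`k = 1` and `k = 2`) from
curves that are only C¹. -/
theorem nonneg_of_tendsto_deriv_div_pow {g g' : ℝ → ℝ} {L : ℝ} {k : ℕ} (h0 : g 0 = 0)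
    (hd : ∀ᶠ s in 𝓝 0, HasDerivAt g (g' s) s) (hpos : ∀ᶠ s in 𝓝[>] 0, 0 ≤ g s)
    (hL : Tendsto (fun s => g' s / s ^ k) (𝓝[>] 0) (𝓝 L)) : 0 ≤ L := by
  by_contra! hneg
  have h1 : ∀ᶠ s in 𝓝[>] (0 : ℝ), g' s / s ^ k < 0 := hL.eventually_lt_const hneg
  obtain ⟨ε, hε, hd⟩ := Metric.eventually_nhds_iff_ball.1 hd
  obtain ⟨b, hb0, hb⟩ := mem_nhdsGT_iff_exists_Ioo_subset.1 (h1.and hpos)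
  simp only [mem_Ioi] at hb0
  have hc : 0 < min (ε / 2) (b / 2) := by positivity
  set c := min (ε / 2) (b / 2)
  have hcb : c < b := by have := min_le_right (ε / 2) (b / 2); linarith
  have hcε : c < ε := by have := min_le_left (ε / 2) (b / 2); linarith
  have hdc : ∀ s ∈ Icc 0 c, HasDerivAt g (g' s) s := fun s hs => hd s (by
    rw [Real.ball_eq_Ioo]; constructor <;> linarith [hs.1, hs.2])
  have hanti : StrictAntiOn g (Icc 0 c) := by
    refine strictAntiOn_of_deriv_neg (convex_Icc 0 c)
      (fun s hs => (hdc s hs).continuousAt.continuousWithinAt) fun s hs => ?_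
    rw [interior_Icc] at hs
    rw [(hdc s ⟨hs.1.le, hs.2.le⟩).deriv]
    have h2 := (hb ⟨hs.1, hs.2.trans hcb⟩).1
    have h3 : 0 < s ^ k := pow_pos hs.1 k
    exact (div_neg_iff.1 h2).resolve_left (fun h => absurd h.2 (not_lt.2 h3.le)) |>.1
  have h4 := hanti (left_mem_Icc.2 hc.le) (right_mem_Icc.2 hc.le) hc
  rw [h0] at h4
  exact absurd (hb ⟨hc, hcb⟩).2 (not_le.2 h4)

namespace IsExtendedNormal

/-- If the open ball of radius `t` touching `S` from inside at `p` does not meet `S`, then its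
touching function is nonnegative along curves in `S`. Its derivative is as indicated. -/
theorem touching_function (hN : IsExtendedNormal S N) (hp : p ∈ S) {t : ℝ} (ht : 0 ≤ t)
    (hball : ∀ q ∈ S, t ≤ ‖q - p + t • N p‖) {γ : ℝ → EuclideanSpace ℝ (Fin (m + 1))}
    (hγ : ContDiff ℝ 1 γ) (hγS : ∀ᶠ s in 𝓝 0, γ s ∈ S) :
    (∀ᶠ s in 𝓝 0, 0 ≤ ‖γ s - p‖ ^ 2 + 2 * t * ⟪N p, γ s - p⟫) ∧
    ∀ᶠ s in 𝓝 0, HasDerivAt (fun s => ‖γ s - p‖ ^ 2 + 2 * t * ⟪N p, γ s - p⟫)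
      (2 * ⟪γ s - p - t • (N (γ s) - N p), deriv γ s⟫) s := by
  constructor
  · filter_upwards [hγS] with s hs
    have h1 := pow_le_pow_left₀ ht (hball _ hs) 2
    rw [norm_add_sq_real, norm_smul, hN.norm_eq_one p hp, real_inner_smul_right, Real.norm_eq_abs,
      mul_one, sq_abs, real_inner_comm] at h1
    linarith
  · filter_upwards [hγS.eventually_nhds] with s hs
    have hd : HasDerivAt γ (deriv γ s) s := (hγ.differentiable (by simp) s).hasDerivAt
    have hT := mem_tangentSpace_of_hasDerivAt hd hs
    rw [hN.mem_tangentSpace_iff hs.self_of_nhds] at hT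
    have h1 := (hd.sub_const p).norm_sq
    have h2 : HasDerivAt (fun s => ⟪N p, γ s - p⟫) (⟪N p, deriv γ s⟫) s :=
      ((innerSL ℝ (N p)).hasFDerivAt.comp_hasDerivAt s (hd.sub_const p))
    have h3 := h1.add (h2.const_mul (2 * t))
    -- Since `deriv γ s` is orthogonal to `N (γ s)`, that normal can be inserted freely. The left
    -- factor then vanishes at `p` and can be expanded without a second derivative of `γ`.
    have h4 : 2 * ⟪γ s - p - t • (N (γ s) - N p), deriv γ s⟫ =
        2 * ⟪γ s - p, deriv γ s⟫ + 2 * t * ⟪N p, deriv γ s⟫ := by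
      rw [inner_sub_left (γ s - p), real_inner_smul_left, inner_sub_left (N (γ s)), hT]
      ring
    rw [h4]
    exact h3

/-- A ball touching `S` from inside at `p` bounds the shape operator from above. -/
theorem shape_le_of_touching (hN : IsExtendedNormal S N) (hp : p ∈ S) {t : ℝ} (ht : 0 ≤ t)
    (hball : ∀ q ∈ S, t ≤ ‖q - p + t • N p‖) {w} (hw : w ∈ tangentSpace S p) :
    0 ≤ ⟪w - t • fderiv ℝ N p w, w⟫ := by
  obtain ⟨γ, hγ, hγ0, hγ', hγS⟩ := (hN.chart p hp).some.exists_curve hw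
  obtain ⟨h1, h2⟩ := hN.touching_function hp ht hball hγ hγS
  have hd : HasDerivAt γ w 0 := hγ' ▸ (hγ.differentiable (by simp) 0).hasDerivAt
  have hNd : HasFDerivAt N (fderiv ℝ N p) (γ 0) := by
    rw [hγ0]; exact (hN.contDiff.differentiable (by simp) p).hasFDerivAt
  have hk : HasDerivAt (fun s => γ s - p - t • (N (γ s) - N p)) (w - t • fderiv ℝ N p w) 0 :=
    (hd.sub_const p).sub (((hNd.comp_hasDerivAt 0 hd).sub_const (N p)).const_smul t)
  have hk2 : Tendsto (fun s : ℝ => s⁻¹ • (γ s - p - t • (N (γ s) - N p))) (𝓝[>] 0)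
      (𝓝 (w - t • fderiv ℝ N p w)) := by
    have := hk.tendsto_slope_zero_right
    simpa [hγ0] using this
  have hγc : Tendsto (deriv γ) (𝓝[>] 0) (𝓝 w) := by
    rw [← hγ']
    exact (hγ.continuous_deriv (by simp)).continuousAt.tendsto.mono_left nhdsWithin_le_nhds
  have hlim : Tendsto (fun s => 2 * ⟪γ s - p - t • (N (γ s) - N p), deriv γ s⟫ / s ^ 1) (𝓝[>] 0)
      (𝓝 (2 * ⟪w - t • fderiv ℝ N p w, w⟫)) := by
    refine ((Filter.Tendsto.inner hk2 hγc).const_mul 2).congr fun s => ?_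
    rw [real_inner_smul_left]
    ring
  have := nonneg_of_tendsto_deriv_div_pow (by simp [hγ0]) h2 (h1.filter_mono nhdsWithin_le_nhds) hlim
  linarith

end IsExtendedNormal

end

/-! ### Surface measure in graph charts -/

section

variable {m : ℕ} {S Ω : Set (EuclideanSpace ℝ (Fin (m + 1)))}
  {N : EuclideanSpace ℝ (Fin (m + 1)) → EuclideanSpace ℝ (Fin (m + 1))}
  {p v : EuclideanSpace ℝ (Fin (m + 1))}

namespace GraphChart

variable (C : GraphChart S p v)

theorem lipschitzWith_proj : LipschitzWith 1 C.proj := by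
  apply LipschitzWith.of_dist_le_mul
  intro x y
  rw [dist_eq_norm, dist_eq_norm, NNReal.coe_one, one_mul]
  have : C.proj x - C.proj y = (C.frame.toEquiv.symm (x - y)).1 := by
    rw [proj, proj, ← Prod.fst_sub, ← map_sub, sub_sub_sub_cancel_right]
  rw [this]
  exact C.frame.norm_fst_symm_le _

/-- The graph parametrization is Lipschitz near the center with a constant close to `1`. -/
theorem exists_lipschitzOnWith_graph {K : ℝ≥0} (hK : 1 < K) :
    ∃ t ∈ 𝓝 (0 : EuclideanSpace ℝ (Fin m)), LipschitzOnWith K C.graph t := by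
  refine C.contDiff_graph.contDiffAt.exists_lipschitzOnWith_of_nnnorm_lt K (lt_of_le_of_lt ?_ hK)
  rw [← NNReal.coe_le_coe, coe_nnnorm, NNReal.coe_one]
  refine ContinuousLinearMap.opNorm_le_bound _ zero_le_one fun w => ?_
  rw [C.fderiv_graph_zero, C.frame.norm_horizontal, one_mul]

theorem measurable_graph : Measurable C.graph := C.contDiff_graph.continuous.measurable

/-- The surface measure is comparable to Lebesgue measure in a graph chart, with a constant
arbitrarily close to `1` near the center. -/
theorem exists_measure_comparison {ε : ℝ≥0} (hε : 0 < ε) :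
    ∃ δ₀ > 0, ∀ δ, 0 < δ → δ ≤ δ₀ → (∀ y, ‖y‖ < δ → C.graph y ∈ C.domain) ∧
      (volume.restrict (ball 0 δ)).map C.graph ≤ μHE[m].restrict S ∧
      ∀ A, MeasurableSet A → A ⊆ C.domain → MapsTo C.proj A (ball 0 δ) →
        μHE[m].restrict S A ≤ (1 + ε) * (volume.restrict (ball 0 δ)).map C.graph A := by
  -- A `K`-Lipschitz map enlarges `m`-dimensional measure by at most `K ^ m`.
  obtain ⟨K, hK1, hK⟩ : ∃ K : ℝ≥0, 1 < K ∧ K ^ m ≤ 1 + ε := by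
    have h1 : Tendsto (fun K : ℝ≥0 => K ^ m) (𝓝[>] 1) (𝓝 1) := by
      have : Continuous fun K : ℝ≥0 => K ^ m := by fun_prop
      simpa using (this.tendsto 1).mono_left nhdsWithin_le_nhds
    have h2 : ∀ᶠ K : ℝ≥0 in 𝓝[>] 1, K ^ m < 1 + ε :=
      h1.eventually_lt_const (by simpa using hε)
    have h3 : ∀ᶠ K : ℝ≥0 in 𝓝[>] 1, 1 < K := eventually_mem_nhdsWithin
    obtain ⟨K, h4, h5⟩ := (h2.and h3).exists
    exact ⟨K, h5, h4.le⟩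
  obtain ⟨t, ht, hLip⟩ := C.exists_lipschitzOnWith_graph hK1
  obtain ⟨δ₀, hδ₀, hball⟩ := Metric.eventually_nhds_iff_ball.1
    (C.eventually_graph_mem.and (show ∀ᶠ y in 𝓝 0, y ∈ t from ht))
  refine ⟨δ₀, hδ₀, fun δ hδ hδle => ?_⟩
  have hdom : ∀ y, ‖y‖ < δ → C.graph y ∈ C.domain := fun y hy =>
    (hball y (mem_ball_zero_iff.2 (hy.trans_le hδle))).1
  have hvol : ∀ B : Set (EuclideanSpace ℝ (Fin m)), μHE[m] B = volume B := fun B => by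
    rw [EuclideanSpace.euclideanHausdorffMeasure_eq_volume]
  have hmap : ∀ A, MeasurableSet A → (volume.restrict (ball 0 δ)).map C.graph A =
      volume (C.graph ⁻¹' A ∩ ball 0 δ) := fun A hA => by
    rw [Measure.map_apply C.measurable_graph hA, Measure.restrict_apply (C.measurable_graph hA)]
  refine ⟨hdom, ?_, ?_⟩
  · refine Measure.le_iff.2 fun A hA => ?_
    rw [hmap A hA, Measure.restrict_apply hA, ← hvol]
    -- The lower bound for surface measure: orthogonal projection is 1-Lipschitz and inverts the
    -- graph map.
    have h1 : C.graph ⁻¹' A ∩ ball 0 δ =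
        C.proj '' (C.graph '' (C.graph ⁻¹' A ∩ ball 0 δ)) := by
      rw [image_image]; simp [C.proj_graph]
    rw [h1]
    refine (euclideanHausdorffMeasure_image_le_of_lipschitzOnWith
      C.lipschitzWith_proj.lipschitzOnWith m).trans ?_
    simp only [ENNReal.coe_one, one_pow, one_mul]
    refine measure_mono ?_
    rintro _ ⟨y, ⟨hy1, hy2⟩, rfl⟩
    exact ⟨hy1, C.graph_mem (hdom y (mem_ball_zero_iff.1 hy2))⟩
  · intro A hA hAd hAp
    rw [hmap A hA, Measure.restrict_apply hA, ← hvol]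
    have h1 : A ∩ S ⊆ C.graph '' (C.graph ⁻¹' A ∩ ball 0 δ) := by
      rintro x ⟨hx, hxS⟩
      have h2 := C.graph_proj (hAd hx) hxS
      exact ⟨C.proj x, ⟨by rw [mem_preimage, h2]; exact hx, hAp hx⟩, h2⟩
    have h2 : LipschitzOnWith K C.graph (C.graph ⁻¹' A ∩ ball 0 δ) :=
      hLip.mono fun y hy => (hball y (ball_subset_ball hδle hy.2)).2
    refine (measure_mono h1).trans ((euclideanHausdorffMeasure_image_le_of_lipschitzOnWith h2 m).trans ?_)
    gcongr
    exact_mod_cast hK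

end GraphChart

/-- Locally the surface measure is at most twice the image of Lebesgue measure on a ball;
compactness does the rest. -/
theorem IsExtendedNormal.isFiniteMeasure (hN : IsExtendedNormal S N) (hS : IsCompact S) :
    IsFiniteMeasure (μHE[m].restrict S) := by
  refine ⟨?_⟩
  have key : (μHE[m].restrict S) S < ⊤ := by
    refine hS.measure_lt_top_of_nhdsWithin fun p hp => ?_
    obtain ⟨C⟩ := hN.chart p hp
    obtain ⟨δ, hδ, h⟩ := C.exists_measure_comparison (ε := 1) one_pos
    obtain ⟨-, -, h2⟩ := h δ hδ le_rfl
    have hopen : IsOpen (C.domain ∩ C.proj ⁻¹' ball 0 δ) :=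
      C.isOpen_domain.inter (isOpen_ball.preimage C.contDiff_proj.continuous)
    refine ⟨C.domain ∩ C.proj ⁻¹' ball 0 δ, mem_nhdsWithin_of_mem_nhds (hopen.mem_nhds
      ⟨C.mem_domain, by simp [GraphChart.proj, hδ]⟩), ?_⟩
    refine (h2 _ hopen.measurableSet inter_subset_left fun x hx => hx.2).trans_lt ?_
    refine ENNReal.mul_lt_top (by simp) ?_
    refine (measure_mono (subset_univ _)).trans_lt ?_
    rw [Measure.map_apply C.measurable_graph MeasurableSet.univ, preimage_univ,
      Measure.restrict_apply_univ]
    exact measure_ball_lt_top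
  rw [Measure.restrict_apply_self] at key
  rwa [Measure.restrict_apply_univ]

/-- Relatively open nonempty subsets of `S` have positive measure. -/
theorem IsExtendedNormal.measure_pos (hN : IsExtendedNormal S N) (hp : p ∈ S)
    {U : Set (EuclideanSpace ℝ (Fin (m + 1)))} (hU : IsOpen U) (hpU : p ∈ U) :
    0 < μHE[m].restrict S U := by
  obtain ⟨C⟩ := hN.chart p hp
  obtain ⟨δ, hδ, h⟩ := C.exists_measure_comparison (ε := 1) one_pos
  refine lt_of_lt_of_le ?_ ((h δ hδ le_rfl).2.1 U)
  rw [Measure.map_apply C.measurable_graph hU.measurableSet,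
    Measure.restrict_apply (C.measurable_graph hU.measurableSet)]
  refine ((hU.preimage C.contDiff_graph.continuous).inter isOpen_ball).measure_pos _
    ⟨0, ?_, mem_ball_self hδ⟩
  rw [mem_preimage, C.graph_zero]
  exact hpU

/-- Almost equal finite measures have almost equal integrals. -/
theorem abs_integral_sub_integral_le {X : Type*} [TopologicalSpace X] [MeasurableSpace X]
    [OpensMeasurableSpace X] {lam μ : Measure X} [IsFiniteMeasure lam] [IsFiniteMeasure μ]
    (hle : lam ≤ μ) {ε : ℝ≥0} {U : Set X} (hU : MeasurableSet U)
    (hge : ∀ A, MeasurableSet A → A ⊆ U → μ A ≤ (1 + ε) * lam A)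
    {φ : X → ℝ} (hφ : Continuous φ) (hφc : HasCompactSupport φ) (hφU : Function.support φ ⊆ U) :
    |∫ x, φ x ∂lam - ∫ x, φ x ∂μ| ≤ ε * ∫ x, |φ x| ∂μ := by
  have hiμ : Integrable φ μ := hφ.integrable_of_hasCompactSupport hφc
  have hil : Integrable φ lam := hiμ.mono_measure hle
  have hmono : ∀ g : X → ℝ, Integrable g μ → (∀ x, 0 ≤ g x) → ∫ x, g x ∂lam ≤ ∫ x, g x ∂μ :=
    fun g hg hg0 => integral_mono_measure hle (Eventually.of_forall hg0) hg
  -- Monotonicity for the nonnegative functions `|φ| + φ` and `|φ| - φ` bounds the difference of the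
  -- integrals of `φ` by the difference of those of `|φ|`, which `hge` controls.
  have h1 := hmono (fun x => |φ x| + φ x) (hiμ.abs.add hiμ) fun x => by
    linarith [neg_abs_le (φ x)]
  have h2 := hmono (fun x => |φ x| - φ x) (hiμ.abs.sub hiμ) fun x => by
    linarith [le_abs_self (φ x)]
  have h0 := hmono (fun x => |φ x|) hiμ.abs fun x => abs_nonneg _
  rw [integral_add hil.abs hil, integral_add hiμ.abs hiμ] at h1
  rw [integral_sub hil.abs hil, integral_sub hiμ.abs hiμ] at h2
  have hrestrict : μ.restrict U ≤ (1 + ε) • lam := by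
    refine Measure.le_iff.2 fun A hA => ?_
    rw [Measure.restrict_apply hA]
    refine (hge _ (hA.inter hU) inter_subset_right).trans ?_
    rw [Measure.smul_apply, ENNReal.smul_def, smul_eq_mul]
    push_cast
    gcongr
    exact inter_subset_left
  have h3 : ∫ x, |φ x| ∂μ ≤ (1 + ε) * ∫ x, |φ x| ∂lam := by
    have h4 : ∫ x, |φ x| ∂μ = ∫ x in U, |φ x| ∂μ := by
      rw [setIntegral_eq_integral_of_forall_compl_eq_zero]
      intro x hx
      rw [abs_eq_zero]
      by_contra h
      exact hx (hφU h)
    rw [h4]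
    refine (integral_mono_measure hrestrict (Eventually.of_forall fun x => abs_nonneg _)
      (hil.abs.smul_measure_nnreal)).trans ?_
    rw [integral_smul_nnreal_measure, NNReal.smul_def, smul_eq_mul]
    push_cast
    exact le_rfl
  have h5 : (ε : ℝ) * ∫ x, |φ x| ∂lam ≤ ε * ∫ x, |φ x| ∂μ := by gcongr
  rw [abs_le]
  constructor <;> linarith

end

/-! ### The divergence theorem near a boundary point -/

section

variable {m : ℕ} {S Ω : Set (EuclideanSpace ℝ (Fin (m + 1)))}
  {N : EuclideanSpace ℝ (Fin (m + 1)) → EuclideanSpace ℝ (Fin (m + 1))}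
  {p v : EuclideanSpace ℝ (Fin (m + 1))}

theorem integrable_fderiv_apply {F : Type*} [NormedAddCommGroup F] [NormedSpace ℝ F]
    [MeasurableSpace F] [BorelSpace F] {μ : Measure F} [IsFiniteMeasureOnCompacts μ] {g : F → ℝ}
    (hg : ContDiff ℝ 1 g) (hgc : HasCompactSupport g) (w : F) :
    Integrable (fun x => fderiv ℝ g x w) μ := by
  apply Continuous.integrable_of_hasCompactSupport
  · exact (hg.continuous_fderiv (by simp)).clm_apply continuous_const
  · exact hgc.fderiv_apply (𝕜 := ℝ) w

/-- The integral of a directional derivative of a compactly supported function vanishes. -/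
theorem integral_fderiv_apply_eq_zero {F : Type*} [NormedAddCommGroup F] [NormedSpace ℝ F]
    [FiniteDimensional ℝ F] [MeasurableSpace F] [BorelSpace F] {μ : Measure F}
    [μ.IsAddHaarMeasure] {g : F → ℝ} (hg : ContDiff ℝ 1 g) (hgc : HasCompactSupport g) (w : F) :
    ∫ x, fderiv ℝ g x w ∂μ = 0 := by
  have h := integral_mul_fderiv_eq_neg_fderiv_mul_of_integrable (μ := μ) (f := fun _ => (1 : ℝ))
    (g := g) (v := w) (by simp) (by simpa using integrable_fderiv_apply hg hgc w)
    (by simpa using hg.continuous.integrable_of_hasCompactSupport hgc)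
    (fun x _ => differentiableAt_const _) (fun x _ => hg.differentiable (by simp) x)
  simpa using h

namespace GraphChart

variable (C : GraphChart S p v)

/-- The straightening map as a homeomorphism. -/
def straightenHomeomorph : (EuclideanSpace ℝ (Fin m) × ℝ) ≃ₜ EuclideanSpace ℝ (Fin (m + 1)) where
  toFun := C.straighten
  invFun x := (C.proj x, (C.frame.toEquiv.symm (x - p)).2 - C.height (C.proj x))
  left_inv x := by simp [straighten, proj]
  right_inv x := by
    have h : ((C.frame.toEquiv.symm (x - p)).1, (C.frame.toEquiv.symm (x - p)).2) =
      C.frame.toEquiv.symm (x - p) := rfl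
    simp only [straighten, proj, add_sub_cancel, h, ContinuousLinearEquiv.apply_symm_apply]
  continuous_toFun := C.contDiff_straighten.continuous
  continuous_invFun := by
    have h1 := C.contDiff_height.continuous
    have h2 := C.contDiff_proj.continuous
    fun_prop

theorem measurePreserving_straighten : MeasurePreserving C.straighten := by
  have h1 : MeasurePreserving (fun x : EuclideanSpace ℝ (Fin m) × ℝ => (x.1, C.height x.1 + x.2)) := by
    refine (MeasurePreserving.id volume).skew_product (g := fun y s => C.height y + s) ?_ ?_
    · have := C.contDiff_height.continuous
      exact Continuous.measurable (by fun_prop)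
    · exact Eventually.of_forall fun y => (measurePreserving_add_left volume (C.height y)).map_eq
  exact (measurePreserving_add_left volume p).comp (C.frame.measurePreserving.comp h1)

theorem fderiv_comp_straighten {φ : EuclideanSpace ℝ (Fin (m + 1)) → ℝ} (hφ : ContDiff ℝ 1 φ)
    (y w : EuclideanSpace ℝ (Fin m)) (s τ : ℝ) :
    fderiv ℝ (φ ∘ C.straighten) (y, s) (w, τ) =
      fderiv ℝ φ (C.straighten (y, s)) (C.frame.toEquiv (w, fderiv ℝ C.height y w + τ)) := by
  have h1 : HasFDerivAt (fun x : EuclideanSpace ℝ (Fin m) × ℝ => C.height x.1)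
      ((fderiv ℝ C.height y).comp (ContinuousLinearMap.fst ℝ _ ℝ)) (y, s) :=
    HasFDerivAt.comp (f := Prod.fst) (y, s)
      ((C.contDiff_height.differentiable (by simp) y).hasFDerivAt) hasFDerivAt_fst
  have h2 : HasFDerivAt (fun x : EuclideanSpace ℝ (Fin m) × ℝ => (x.1, C.height x.1 + x.2))
      ((ContinuousLinearMap.fst ℝ _ ℝ).prod
        ((fderiv ℝ C.height y).comp (ContinuousLinearMap.fst ℝ _ ℝ) +
          ContinuousLinearMap.snd ℝ _ ℝ)) (y, s) :=
    hasFDerivAt_fst.prodMk (h1.add hasFDerivAt_snd)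
  have h3 : HasFDerivAt C.straighten _ (y, s) :=
    (HasFDerivAt.comp (f := fun x : EuclideanSpace ℝ (Fin m) × ℝ => (x.1, C.height x.1 + x.2))
      (y, s) C.frame.toEquiv.hasFDerivAt h2).const_add p
  have h4 := ((hφ.differentiable (by simp) (C.straighten (y, s))).hasFDerivAt.comp (y, s) h3).fderiv
  rw [h4]
  rfl

/-- The integral of a directional derivative over the region below a graph. -/
theorem integral_fderiv_below {φ : EuclideanSpace ℝ (Fin (m + 1)) → ℝ} (hφ : ContDiff ℝ 1 φ)
    (hφc : HasCompactSupport φ) (w : EuclideanSpace ℝ (Fin m)) (a : ℝ) :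
    ∫ z in {z : EuclideanSpace ℝ (Fin m) × ℝ | z.2 < 0},
      fderiv ℝ φ (C.straighten z) (C.frame.toEquiv (w, a)) =
    ∫ y, (a - fderiv ℝ C.height y w) * φ (C.graph y) := by
  set ψ := φ ∘ C.straighten with hψ
  have hψ1 : ContDiff ℝ 1 ψ := hφ.comp C.contDiff_straighten
  have hψc : HasCompactSupport ψ := hφc.comp_homeomorph C.straightenHomeomorph
  -- In straightened coordinates the direction splits into a horizontal part, whose integral over
  -- each slice vanishes, and a multiple of the vertical direction, constant on vertical lines, to
  -- which the fundamental theorem of calculus applies.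
  have hsplit : ∀ z : EuclideanSpace ℝ (Fin m) × ℝ,
      fderiv ℝ φ (C.straighten z) (C.frame.toEquiv (w, a)) =
      fderiv ℝ ψ z (w, 0) + (a - fderiv ℝ C.height z.1 w) * fderiv ℝ ψ z (0, 1) := by
    rintro ⟨y, s⟩
    have h1 := C.fderiv_comp_straighten hφ y w s (a - fderiv ℝ C.height y w)
    rw [add_sub_cancel] at h1
    rw [← h1, ← hψ, ← smul_eq_mul, ← map_smul, ← map_add]
    simp
  simp_rw [hsplit]
  have hset : (volume : Measure (EuclideanSpace ℝ (Fin m) × ℝ)).restrict {z | z.2 < 0} =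
      (volume : Measure (EuclideanSpace ℝ (Fin m))).prod (volume.restrict (Iio (0 : ℝ))) := by
    have : {z : EuclideanSpace ℝ (Fin m) × ℝ | z.2 < 0} = univ ×ˢ Iio 0 := by ext; simp
    rw [this, Measure.volume_eq_prod, ← Measure.prod_restrict, Measure.restrict_univ]
  have hi1 : Integrable (fun z => fderiv ℝ ψ z (w, 0))
      ((volume : Measure (EuclideanSpace ℝ (Fin m))).prod (volume.restrict (Iio (0 : ℝ)))) := by
    rw [← hset]
    exact (integrable_fderiv_apply hψ1 hψc _).restrict
  have hcont : Continuous fun z : EuclideanSpace ℝ (Fin m) × ℝ => a - fderiv ℝ C.height z.1 w := by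
    have := C.contDiff_height.continuous_fderiv (by simp)
    fun_prop
  have hi2 : Integrable (fun z => (a - fderiv ℝ C.height z.1 w) * fderiv ℝ ψ z (0, 1))
      ((volume : Measure (EuclideanSpace ℝ (Fin m))).prod (volume.restrict (Iio (0 : ℝ)))) := by
    rw [← hset]
    refine Integrable.restrict (Continuous.integrable_of_hasCompactSupport ?_ ?_)
    · exact hcont.mul ((hψ1.continuous_fderiv (by simp)).clm_apply continuous_const)
    · exact (hψc.fderiv_apply (𝕜 := ℝ) _).mul_left
  rw [hset, integral_add hi1 hi2, integral_prod_symm _ hi1, integral_prod _ hi2]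
  have hz1 : ∀ s : ℝ, ∫ y, fderiv ℝ ψ (y, s) (w, 0) = 0 := by
    intro s
    have hc : HasCompactSupport fun y => ψ (y, s) := hψc.comp_isClosedEmbedding
      (Topology.IsClosedEmbedding.of_continuous_injective_isClosedMap (by fun_prop)
        (fun _ _ h => (Prod.ext_iff.1 h).1) (isClosedMap_prodMk_right s))
    have hd : ContDiff ℝ 1 fun y => ψ (y, s) := hψ1.comp (by fun_prop)
    have h := integral_fderiv_apply_eq_zero (μ := volume) hd hc w
    refine Eq.trans (integral_congr_ae (Eventually.of_forall fun y => ?_)) h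
    have h1 : HasFDerivAt (fun y : EuclideanSpace ℝ (Fin m) => (y, s))
        (ContinuousLinearMap.inl ℝ _ ℝ) y := hasFDerivAt_prodMk_left y s
    have h2 := ((hψ1.differentiable (by simp) (y, s)).hasFDerivAt.comp y h1).fderiv
    change fderiv ℝ ψ (y, s) (w, 0) = fderiv ℝ (ψ ∘ fun y => (y, s)) y w
    rw [h2]
    rfl
  have hz2 : ∀ y, ∫ s in Iio (0 : ℝ), (a - fderiv ℝ C.height y w) * fderiv ℝ ψ (y, s) (0, 1) =
      (a - fderiv ℝ C.height y w) * φ (C.graph y) := by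
    intro y
    rw [integral_const_mul, ← integral_Iic_eq_integral_Iio]
    have hc : HasCompactSupport fun s => ψ (y, s) := hψc.comp_isClosedEmbedding
      (Topology.IsClosedEmbedding.of_continuous_injective_isClosedMap (by fun_prop)
        (fun _ _ h => (Prod.ext_iff.1 h).2) (isClosedMap_prodMk_left y))
    have hd : ContDiff ℝ 1 fun s => ψ (y, s) := hψ1.comp (by fun_prop)
    have h := HasCompactSupport.integral_Iic_deriv_eq hd hc 0
    have h0 : ψ (y, 0) = φ (C.graph y) := by
      rw [hψ, Function.comp_apply, C.straighten_zero_right]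
    rw [← h0, ← h]
    congr 2
    ext s
    have h1 : HasDerivAt (fun s : ℝ => (y, s)) ((0 : EuclideanSpace ℝ (Fin m)), (1 : ℝ)) s :=
      (hasDerivAt_const s y).prodMk (hasDerivAt_id s)
    have h2 := ((hψ1.differentiable (by simp) (y, s)).hasFDerivAt.comp_hasDerivAt s h1).deriv
    exact h2.symm
  simp_rw [hz1, hz2]
  simp

end GraphChart

/-- The divergence theorem near a boundary point, up to a small relative error. -/
theorem IsInterior.exists_local_divergence (hΩ : IsInterior S N Ω) (hN : IsExtendedNormal S N)
    (hS : IsCompact S) (hp : p ∈ S) (e : EuclideanSpace ℝ (Fin (m + 1))) {ε : ℝ} (hε : 0 < ε) :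
    ∃ U, IsOpen U ∧ p ∈ U ∧ ∀ φ : EuclideanSpace ℝ (Fin (m + 1)) → ℝ, ContDiff ℝ 1 φ →
      HasCompactSupport φ → tsupport φ ⊆ U →
      |(∫ x in Ω, fderiv ℝ φ x e) - ∫ x in S, φ x * ⟪N x, e⟫ ∂μHE[m]| ≤
        ε * ∫ x in S, |φ x| ∂μHE[m] := by
  have hfin := hN.isFiniteMeasure hS
  obtain ⟨C⟩ := hN.chart p hp
  obtain ⟨⟨w, a⟩, hwa⟩ := C.frame.toEquiv.surjective e
  have ha : a = ⟪N p, e⟫ := by rw [← hwa, C.frame.inner_vertical]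
  -- Three errors are incurred: `η` for flattening the graph, `|a| * η` for changing the measure and
  -- `η` for freezing the normal. Their sum `(2 + |a|) * η` is at most `ε`.
  set η : ℝ≥0 := ⟨ε / (3 * (1 + |a|)), by positivity⟩ with hη
  have hη0 : 0 < η := by
    rw [← NNReal.coe_pos]
    change 0 < ε / (3 * (1 + |a|))
    positivity
  have hη1 : (η : ℝ) * (1 + |a|) = ε / 3 := by
    change ε / (3 * (1 + |a|)) * (1 + |a|) = ε / 3
    field_simp
  obtain ⟨δ₁, hδ₁, hmeas⟩ := C.exists_measure_comparison hη0
  obtain ⟨δ₂, hδ₂, hside⟩ := hΩ.exists_straighten_mem_iff C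
  have hb : ∀ᶠ y in 𝓝 (0 : EuclideanSpace ℝ (Fin m)), |(a - fderiv ℝ C.height y w) - a| < η := by
    have hc : Continuous fun y => |(a - fderiv ℝ C.height y w) - a| := by
      have := C.contDiff_height.continuous_fderiv (by simp)
      fun_prop
    refine (hc.tendsto 0).eventually_lt_const ?_
    simpa [C.fderiv_height_zero] using hη0
  obtain ⟨δ₃, hδ₃, hb⟩ := Metric.eventually_nhds_iff_ball.1 hb
  set δ := min δ₁ (min δ₂ δ₃) with hδ
  have hδ0 : 0 < δ := by positivity
  obtain ⟨hdom, hle, hge⟩ := hmeas δ hδ0 (min_le_left _ _)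
  have hδ2 : δ ≤ δ₂ := (min_le_right _ _).trans (min_le_left _ _)
  have hδ3 : δ ≤ δ₃ := (min_le_right _ _).trans (min_le_right _ _)
  set lam := (volume.restrict (ball 0 δ)).map C.graph with hlam
  have hlamfin : IsFiniteMeasure lam := isFiniteMeasure_of_le _ hle
  let box : Set (EuclideanSpace ℝ (Fin m) × ℝ) := ball 0 δ ×ˢ ball 0 δ
  have hNc : Continuous fun x => |⟪N x, e⟫ - a| :=
    ((hN.contDiff.continuous.inner continuous_const).sub continuous_const).abs
  refine ⟨C.domain ∩ C.straightenHomeomorph.symm ⁻¹' box ∩ {x | |⟪N x, e⟫ - a| < η},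
    (C.isOpen_domain.inter ((isOpen_ball.prod isOpen_ball).preimage
      C.straightenHomeomorph.symm.continuous)).inter (isOpen_lt hNc continuous_const),
    ⟨⟨C.mem_domain, ?_⟩, ?_⟩, ?_⟩
  · have : C.straightenHomeomorph.symm p = 0 := by
      rw [Homeomorph.symm_apply_eq]
      change p = C.straighten (0, 0)
      rw [C.straighten_zero_right, C.graph_zero]
    rw [mem_preimage, this]
    exact ⟨mem_ball_self hδ0, mem_ball_self hδ0⟩
  · simpa [ha] using hη0
  intro φ hφ hφc hφU
  have hsupp : ∀ x, φ x ≠ 0 → x ∈ C.domain ∧ C.proj x ∈ ball (0 : EuclideanSpace ℝ (Fin m)) δ ∧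
      |⟪N x, e⟫ - a| < η := by
    intro x hx
    obtain ⟨⟨h1, h2⟩, h3⟩ := hφU (subset_tsupport φ hx)
    exact ⟨h1, h2.1, h3⟩
  -- On the support of `φ`, `Ω` is the half space `z.2 < 0` in straightened coordinates, and
  -- straightening preserves volume.
  have hvol : ∫ x in Ω, fderiv ℝ φ x e = ∫ y, (a - fderiv ℝ C.height y w) * φ (C.graph y) := by
    rw [← C.integral_fderiv_below hφ hφc w a, ← integral_indicator hΩ.isOpen.measurableSet,
      ← integral_indicator (measurableSet_lt measurable_snd measurable_const),
      ← C.measurePreserving_straighten.integral_comp C.straightenHomeomorph.measurableEmbedding]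
    congr 1
    ext z
    by_cases hz : fderiv ℝ φ (C.straighten z) = 0
    · simp [indicator, hz]
    · have h1 : C.straighten z ∈ tsupport φ := by
        by_contra h
        exact hz (fderiv_of_notMem_tsupport ℝ h)
      have h2 : C.straightenHomeomorph.symm (C.straighten z) ∈ box := (hφU h1).1.2
      have h3 : C.straightenHomeomorph.symm (C.straighten z) = z :=
        C.straightenHomeomorph.symm_apply_apply z
      rw [h3] at h2
      obtain ⟨-, h4⟩ := hside z.1 ((mem_ball_zero_iff.1 h2.1).trans_le hδ2) z.2
        ((mem_ball_zero_iff.1 h2.2).trans_le hδ2)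
      have h5 : (C.straighten z ∈ Ω) = (z ∈ {z : EuclideanSpace ℝ (Fin m) × ℝ | z.2 < 0}) :=
        propext h4
      simp only [indicator, h5, hwa]
  have hiφ : Integrable φ (μHE[m].restrict S) := hφ.continuous.integrable_of_hasCompactSupport hφc
  have hilam : Integrable φ lam := hiφ.mono_measure hle
  have hmeasg : AEMeasurable C.graph (volume.restrict (ball 0 δ)) := C.measurable_graph.aemeasurable
  have hlamint : ∀ g : EuclideanSpace ℝ (Fin (m + 1)) → ℝ, Continuous g →
      ∫ x, g x ∂lam = ∫ y in ball 0 δ, g (C.graph y) := fun g hg =>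
    integral_map hmeasg hg.aestronglyMeasurable
  have hgi : Integrable (fun y => φ (C.graph y)) (volume.restrict (ball 0 δ)) := by
    have := (integrable_map_measure hφ.continuous.aestronglyMeasurable hmeasg).1 hilam
    exact this
  have hbc : Continuous fun y => a - fderiv ℝ C.height y w := by
    have := C.contDiff_height.continuous_fderiv (by simp)
    fun_prop
  have hφgc : HasCompactSupport fun y => φ (C.graph y) := by
    have h1 : HasCompactSupport (φ ∘ C.straighten) := hφc.comp_homeomorph C.straightenHomeomorph
    have h2 := h1.comp_isClosedEmbedding (g := fun y : EuclideanSpace ℝ (Fin m) => (y, (0 : ℝ)))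
      (Topology.IsClosedEmbedding.of_continuous_injective_isClosedMap (by fun_prop)
        (fun _ _ h => (Prod.ext_iff.1 h).1) (isClosedMap_prodMk_right 0))
    have h3 : (fun y => φ (C.graph y)) = (φ ∘ C.straighten) ∘ fun y => (y, (0 : ℝ)) := by
      ext y
      simp [C.straighten_zero_right]
    rw [h3]
    exact h2
  have hbi : Integrable (fun y => (a - fderiv ℝ C.height y w) * φ (C.graph y))
      (volume.restrict (ball 0 δ)) :=
    ((hbc.mul (hφ.continuous.comp C.contDiff_graph.continuous)).integrable_of_hasCompactSupport
      hφgc.mul_left).restrict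
  have e1 : |(∫ y, (a - fderiv ℝ C.height y w) * φ (C.graph y)) - a * ∫ x, φ x ∂lam| ≤
      η * ∫ x in S, |φ x| ∂μHE[m] := by
    have h1 : ∫ y, (a - fderiv ℝ C.height y w) * φ (C.graph y) =
        ∫ y in ball 0 δ, (a - fderiv ℝ C.height y w) * φ (C.graph y) := by
      rw [setIntegral_eq_integral_of_forall_compl_eq_zero]
      intro y hy
      by_contra h
      apply hy
      have := (hsupp _ (right_ne_zero_of_mul h)).2.1
      rwa [C.proj_graph] at this
    rw [h1, hlamint φ hφ.continuous, ← integral_const_mul, ← integral_sub hbi (hgi.const_mul a)]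
    have h2 : ∫ x, |φ x| ∂lam ≤ ∫ x in S, |φ x| ∂μHE[m] :=
      integral_mono_measure hle (Eventually.of_forall fun x => abs_nonneg _) hiφ.abs
    refine le_trans ?_ (mul_le_mul_of_nonneg_left h2 η.2)
    rw [hlamint _ hφ.continuous.abs, ← integral_const_mul]
    refine (abs_integral_le_integral_abs).trans ?_
    refine setIntegral_mono_on ?_ (hgi.abs.const_mul _) measurableSet_ball fun y hy => ?_
    · exact (hbi.sub (hgi.const_mul a)).abs
    · rw [← sub_mul, abs_mul]
      gcongr
      exact (hb y (ball_subset_ball hδ3 hy)).le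
  have e2 : |a * ∫ x, φ x ∂lam - a * ∫ x in S, φ x ∂μHE[m]| ≤
      |a| * (η * ∫ x in S, |φ x| ∂μHE[m]) := by
    rw [← mul_sub, abs_mul]
    gcongr
    refine abs_integral_sub_integral_le hle
      (C.isOpen_domain.inter (isOpen_ball.preimage C.contDiff_proj.continuous)).measurableSet
      (fun A hA hAU => hge A hA (hAU.trans inter_subset_left) fun x hx => (hAU hx).2)
      hφ.continuous hφc fun x hx => ⟨(hsupp x hx).1, (hsupp x hx).2.1⟩
  have hiφN : Integrable (fun x => φ x * ⟪N x, e⟫) (μHE[m].restrict S) :=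
    (hφ.continuous.mul (hN.contDiff.continuous.inner continuous_const)).integrable_of_hasCompactSupport
      hφc.mul_right
  have e3 : |a * ∫ x in S, φ x ∂μHE[m] - ∫ x in S, φ x * ⟪N x, e⟫ ∂μHE[m]| ≤
      η * ∫ x in S, |φ x| ∂μHE[m] := by
    rw [← integral_const_mul, ← integral_sub (hiφ.const_mul a) hiφN, ← integral_const_mul]
    refine (abs_integral_le_integral_abs).trans ?_
    refine integral_mono ((hiφ.const_mul a).sub hiφN).abs (hiφ.abs.const_mul _) fun x => ?_
    by_cases hx : φ x = 0
    · simp [hx]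
    · change |a * φ x - φ x * ⟪N x, e⟫| ≤ η * |φ x|
      have : a * φ x - φ x * ⟪N x, e⟫ = -((⟪N x, e⟫ - a) * φ x) := by ring
      rw [this, abs_neg, abs_mul]
      gcongr
      exact (hsupp x hx).2.2.le
  rw [hvol]
  have hI : 0 ≤ ∫ x in S, |φ x| ∂μHE[m] := integral_nonneg fun x => abs_nonneg _
  set I := ∫ x in S, |φ x| ∂μHE[m]
  have t1 := abs_sub_le (∫ y, (a - fderiv ℝ C.height y w) * φ (C.graph y)) (a * ∫ x, φ x ∂lam)
    (∫ x in S, φ x * ⟪N x, e⟫ ∂μHE[m])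
  have t2 := abs_sub_le (a * ∫ x, φ x ∂lam) (a * ∫ x in S, φ x ∂μHE[m])
    (∫ x in S, φ x * ⟪N x, e⟫ ∂μHE[m])
  have t3 : 2 * (η : ℝ) + |a| * η ≤ ε := by
    have : (0 : ℝ) ≤ η * |a| := by positivity
    nlinarith
  have t4 := mul_le_mul_of_nonneg_right t3 hI
  nlinarith

end

/-! ### The global divergence theorem and Stokes' theorem -/

section

variable {m : ℕ} {S Ω : Set (EuclideanSpace ℝ (Fin (m + 1)))}
  {N : EuclideanSpace ℝ (Fin (m + 1)) → EuclideanSpace ℝ (Fin (m + 1))}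
  {p v : EuclideanSpace ℝ (Fin (m + 1))}

/-- A smooth function, supported in an open set `U` and equal to `1` near a closed subset of it. -/
theorem exists_contDiff_cutoff {E : Type*} [NormedAddCommGroup E] [NormedSpace ℝ E]
    [FiniteDimensional ℝ E] {A U : Set E} (hA : IsClosed A) (hU : IsOpen U) (hAU : A ⊆ U) :
    ∃ χ : E → ℝ, ContDiff ℝ 1 χ ∧ (∀ x ∉ U, ∀ᶠ y in 𝓝 x, χ y = 0) ∧
      (∀ x ∈ A, ∀ᶠ y in 𝓝 x, χ y = 1) ∧ ∀ x, 0 ≤ χ x ∧ χ x ≤ 1 := by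
  obtain ⟨χ, h0, h1, h01⟩ := exists_contMDiffMap_zero_one_nhds_of_isClosed (n := 1)
    (modelWithCornersSelf ℝ E) hU.isClosed_compl hA
    (disjoint_left.2 fun x hx hxA => hx (hAU hxA))
  exact ⟨χ, χ.contMDiff.contDiff, fun x hx => h0.filter_mono (nhds_le_nhdsSet hx),
    fun x hx => h1.filter_mono (nhds_le_nhdsSet hx), h01⟩

/-- Locality principle: an estimate by an integral with an additive left-hand side may be checked
on functions with small support. -/
theorem exists_open_estimate {E : Type*} [NormedAddCommGroup E] [NormedSpace ℝ E]
    [FiniteDimensional ℝ E] [MeasurableSpace E] [BorelSpace E] {μ : Measure E} [IsFiniteMeasure μ]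
    {L : (E → ℝ) → ℝ} {ε : ℝ}
    (hL : ∀ f g : E → ℝ, ContDiff ℝ 1 f → HasCompactSupport f → ContDiff ℝ 1 g →
      HasCompactSupport g → L (f + g) = L f + L g)
    {K : Set E} (hK : IsCompact K)
    (hloc : ∀ x ∈ K, ∃ U, IsOpen U ∧ x ∈ U ∧ ∀ φ : E → ℝ, ContDiff ℝ 1 φ → HasCompactSupport φ →
      tsupport φ ⊆ U → |L φ| ≤ ε * ∫ x, |φ x| ∂μ) :
    ∃ U, IsOpen U ∧ K ⊆ U ∧ ∀ φ : E → ℝ, ContDiff ℝ 1 φ → HasCompactSupport φ →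
      tsupport φ ⊆ U → |L φ| ≤ ε * ∫ x, |φ x| ∂μ := by
  refine hK.induction_on (p := fun s => ∃ U, IsOpen U ∧ s ⊆ U ∧ ∀ φ : E → ℝ, ContDiff ℝ 1 φ →
      HasCompactSupport φ → tsupport φ ⊆ U → |L φ| ≤ ε * ∫ x, |φ x| ∂μ) ?_ ?_ ?_ ?_
  · refine ⟨∅, isOpen_empty, subset_rfl, fun φ hφ hφc hφU => ?_⟩
    have h0 : φ = 0 := by
      rw [← tsupport_eq_empty_iff]; exact subset_empty_iff.1 hφU
    have h1 := hL 0 0 contDiff_const HasCompactSupport.zero contDiff_const HasCompactSupport.zero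
    rw [add_zero] at h1
    have h2 : L 0 = 0 := by linarith
    simp [h0, h2]
  · rintro s t hst ⟨U, hU, htU, h⟩
    exact ⟨U, hU, hst.trans htU, h⟩
  · rintro s t ⟨U, hU, hsU, h1⟩ ⟨V, hV, htV, h2⟩
    refine ⟨U ∪ V, hU.union hV, union_subset_union hsU htV, fun φ hφ hφc hφUV => ?_⟩
    -- `χ * φ` is supported in `U` and `(1 - χ) * φ` in `V`. Since `0 ≤ χ ≤ 1`, the integral of
    -- `|φ|` splits exactly, so the constant `ε` does not grow with the number of pieces.
    obtain ⟨χ, hχ, hχ0, hχ1, hχ01⟩ := exists_contDiff_cutoff (A := tsupport φ \ V)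
      ((isClosed_tsupport φ).sdiff hV) hU fun x hx => (hφUV hx.1).resolve_right hx.2
    have hf : ContDiff ℝ 1 (χ * φ) := hχ.mul hφ
    have hg : ContDiff ℝ 1 ((1 - χ) * φ) := (contDiff_const.sub hχ).mul hφ
    have hfc : HasCompactSupport (χ * φ) := hφc.mul_left
    have hgc : HasCompactSupport ((1 - χ) * φ) := hφc.mul_left
    have hsum : χ * φ + (1 - χ) * φ = φ := by ring
    have hfU : tsupport (χ * φ) ⊆ U := by
      intro x hx
      by_contra hxU
      refine absurd hx ?_
      rw [notMem_tsupport_iff_eventuallyEq]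
      filter_upwards [hχ0 x hxU] with y hy
      simp [hy]
    have hgV : tsupport ((1 - χ) * φ) ⊆ V := by
      intro x hx
      by_contra hxV
      refine absurd hx ?_
      rw [notMem_tsupport_iff_eventuallyEq]
      by_cases hxφ : x ∈ tsupport φ
      · filter_upwards [hχ1 x ⟨hxφ, hxV⟩] with y hy
        simp [hy]
      · rw [notMem_tsupport_iff_eventuallyEq] at hxφ
        filter_upwards [hxφ] with y hy
        simp [hy]
    have e1 := h1 _ hf hfc hfU
    have e2 := h2 _ hg hgc hgV
    have e3 := hL _ _ hf hfc hg hgc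
    rw [hsum] at e3
    have e4 : ∫ x, |φ x| ∂μ = ∫ x, |(χ * φ) x| ∂μ + ∫ x, |((1 - χ) * φ) x| ∂μ := by
      rw [← integral_add (hf.continuous.integrable_of_hasCompactSupport hfc).abs
        (hg.continuous.integrable_of_hasCompactSupport hgc).abs]
      congr 1
      ext x
      simp only [Pi.mul_apply, Pi.sub_apply, Pi.one_apply, abs_mul, abs_of_nonneg (hχ01 x).1,
        abs_of_nonneg (sub_nonneg.2 (hχ01 x).2)]
      ring
    rw [e3, e4, mul_add]
    exact (abs_add_le _ _).trans (add_le_add e1 e2)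
  · intro x hx
    obtain ⟨U, hU, hxU, h⟩ := hloc x hx
    exact ⟨U, mem_nhdsWithin_of_mem_nhds (hU.mem_nhds hxU), U, hU, subset_rfl, h⟩

namespace IsInterior

/-- A ball missing `S` lies inside `Ω` or is disjoint from it; in either case the volume integral
vanishes. -/
theorem integral_eq_zero_of_notMem (hΩ : IsInterior S N Ω) (hS : IsCompact S)
    {x : EuclideanSpace ℝ (Fin (m + 1))} (hx : x ∉ S) (e : EuclideanSpace ℝ (Fin (m + 1))) :
    ∃ U, IsOpen U ∧ x ∈ U ∧ ∀ φ : EuclideanSpace ℝ (Fin (m + 1)) → ℝ, ContDiff ℝ 1 φ →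
      HasCompactSupport φ → tsupport φ ⊆ U →
      ∫ x in Ω, fderiv ℝ φ x e = 0 ∧ ∫ x in S, φ x * ⟪N x, e⟫ ∂μHE[m] = 0 := by
  obtain ⟨r, hr, hball⟩ := Metric.isOpen_iff.1 hS.isClosed.isOpen_compl x hx
  refine ⟨ball x r, isOpen_ball, mem_ball_self hr, fun φ hφ hφc hφU => ⟨?_, ?_⟩⟩
  · by_cases hne : (ball x r ∩ Ω).Nonempty
    · have hsub := hΩ.subset_of_isPreconnected _ (convex_ball x r).isPreconnected hball hne
      rw [setIntegral_eq_integral_of_forall_compl_eq_zero,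
        integral_fderiv_apply_eq_zero hφ hφc e]
      intro y hy
      rw [fderiv_of_notMem_tsupport ℝ fun h => hy (hsub (hφU h))]
      rfl
    · refine setIntegral_eq_zero_of_forall_eq_zero fun y hy => ?_
      rw [fderiv_of_notMem_tsupport ℝ fun h => hne ⟨y, hφU h, hy⟩]
      rfl
  · refine setIntegral_eq_zero_of_forall_eq_zero fun y hy => ?_
    rw [image_eq_zero_of_notMem_tsupport fun h => hball (hφU h) hy, zero_mul]

/-- The divergence theorem for a function times a constant vector. -/
theorem integral_fderiv_eq (hΩ : IsInterior S N Ω) (hN : IsExtendedNormal S N)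
    (hS : IsCompact S) {φ : EuclideanSpace ℝ (Fin (m + 1)) → ℝ} (hφ : ContDiff ℝ 1 φ)
    (e : EuclideanSpace ℝ (Fin (m + 1))) :
    ∫ x in Ω, fderiv ℝ φ x e = ∫ x in S, φ x * ⟪N x, e⟫ ∂μHE[m] := by
  have hfin := hN.isFiniteMeasure hS
  have hNc : Continuous fun x => ⟪N x, e⟫ := hN.contDiff.continuous.inner continuous_const
  let L : (EuclideanSpace ℝ (Fin (m + 1)) → ℝ) → ℝ := fun φ =>
    (∫ x in Ω, fderiv ℝ φ x e) - ∫ x in S, φ x * ⟪N x, e⟫ ∂μHE[m]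
  have hL : ∀ f g : EuclideanSpace ℝ (Fin (m + 1)) → ℝ, ContDiff ℝ 1 f → HasCompactSupport f →
      ContDiff ℝ 1 g → HasCompactSupport g → L (f + g) = L f + L g := by
    intro f g hf hfc hg hgc
    have h1 : ∫ x in Ω, fderiv ℝ (f + g) x e =
        (∫ x in Ω, fderiv ℝ f x e) + ∫ x in Ω, fderiv ℝ g x e := by
      rw [← integral_add (integrable_fderiv_apply hf hfc e).restrict
        (integrable_fderiv_apply hg hgc e).restrict]
      congr 1
      ext x
      rw [fderiv_add (hf.differentiable (by simp) x) (hg.differentiable (by simp) x)]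
      rfl
    have h2 : ∫ x in S, (f + g) x * ⟪N x, e⟫ ∂μHE[m] =
        ∫ x in S, f x * ⟪N x, e⟫ ∂μHE[m] + ∫ x in S, g x * ⟪N x, e⟫ ∂μHE[m] := by
      have hi : ∀ f : EuclideanSpace ℝ (Fin (m + 1)) → ℝ, ContDiff ℝ 1 f → HasCompactSupport f →
          Integrable (fun x => f x * ⟪N x, e⟫) (μHE[m].restrict S) := fun f hf hfc =>
        (hf.continuous.mul hNc).integrable_of_hasCompactSupport hfc.mul_right
      rw [← integral_add (hi f hf hfc) (hi g hg hgc)]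
      congr 1
      ext x
      exact add_mul _ _ _
    simp only [L, h1, h2]
    ring
  obtain ⟨R, hR⟩ := (hΩ.isBounded.union hS.isBounded).subset_closedBall 0
  have hK : IsCompact (closedBall (0 : EuclideanSpace ℝ (Fin (m + 1))) (R + 1)) :=
    isCompact_closedBall _ _
  -- Only values of `φ` near `Ω` and `S` matter, so compact support may be arranged by a cutoff.
  obtain ⟨χ, hχ, hχ0, hχ1, -⟩ := exists_contDiff_cutoff
    (isClosed_closedBall (x := (0 : EuclideanSpace ℝ (Fin (m + 1)))) (ε := R)) isOpen_ball
    (closedBall_subset_ball (lt_add_one R))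
  have hts : tsupport (χ * φ) ⊆ closedBall 0 (R + 1) := by
    refine closure_minimal (fun x hx => ?_) isClosed_closedBall
    by_contra h
    refine hx ?_
    have := (hχ0 x fun h' => h (ball_subset_closedBall h')).self_of_nhds
    simp [this]
  have hc : HasCompactSupport (χ * φ) := hK.of_isClosed_subset (isClosed_tsupport _) hts
  have hχφ : ContDiff ℝ 1 (χ * φ) := hχ.mul hφ
  have hI : 0 ≤ ∫ x in S, |(χ * φ) x| ∂μHE[m] := integral_nonneg fun x => abs_nonneg _
  have hzero : L (χ * φ) = 0 := by
    rw [← abs_nonpos_iff]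
    refine le_of_forall_pos_le_add fun ε hε => ?_
    set I := ∫ x in S, |(χ * φ) x| ∂μHE[m]
    -- The relative error is scaled so that the total error is at most `ε`; the summand 1 covers the
    -- case `I = 0`.
    have hε' : 0 < ε / (1 + I) := by positivity
    obtain ⟨U, hU, hKU, h⟩ := exists_open_estimate (μ := μHE[m].restrict S) (ε := ε / (1 + I)) hL hK
      (fun x _ => by
        by_cases hx : x ∈ S
        · exact hΩ.exists_local_divergence hN hS hx e hε'
        · obtain ⟨U, hU, hxU, h⟩ := hΩ.integral_eq_zero_of_notMem hS hx e
          refine ⟨U, hU, hxU, fun φ hφ hφc hφU => ?_⟩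
          obtain ⟨h1, h2⟩ := h φ hφ hφc hφU
          simp only [L, h1, h2, sub_zero, abs_zero]
          exact mul_nonneg hε'.le (integral_nonneg fun x => abs_nonneg _))
    refine (h _ hχφ hc (hts.trans hKU)).trans ?_
    change ε / (1 + I) * I ≤ 0 + ε
    rw [zero_add, div_mul_eq_mul_div, div_le_iff₀ (by positivity)]
    nlinarith
  have h1 : ∫ x in Ω, fderiv ℝ (χ * φ) x e = ∫ x in Ω, fderiv ℝ φ x e := by
    refine setIntegral_congr_fun hΩ.isOpen.measurableSet fun x hx => ?_
    have : χ * φ =ᶠ[𝓝 x] φ := by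
      filter_upwards [hχ1 x (hR (Or.inl hx))] with y hy
      simp [hy]
    simp only [this.fderiv_eq]
  have h2 : ∫ x in S, (χ * φ) x * ⟪N x, e⟫ ∂μHE[m] = ∫ x in S, φ x * ⟪N x, e⟫ ∂μHE[m] := by
    refine setIntegral_congr_fun hS.measurableSet fun x hx => ?_
    simp [(hχ1 x (hR (Or.inr hx))).self_of_nhds]
  simp only [L, h1, h2] at hzero
  linarith

/-- Stokes' theorem for tangential derivatives. -/
theorem integral_tangential_fderiv (hΩ : IsInterior S N Ω) (hN : IsExtendedNormal S N)
    (hS : IsCompact S) {a : EuclideanSpace ℝ (Fin (m + 1)) → ℝ} (ha : ContDiff ℝ ∞ a)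
    (e e' : EuclideanSpace ℝ (Fin (m + 1))) :
    ∫ x in S, fderiv ℝ a x e * ⟪N x, e'⟫ ∂μHE[m] = ∫ x in S, fderiv ℝ a x e' * ⟪N x, e⟫ ∂μHE[m] := by
  have h1 : ContDiff ℝ ∞ (fderiv ℝ a) := ha.fderiv_right (by simp)
  have h2 : ∀ e, ContDiff ℝ 1 fun x => fderiv ℝ a x e := fun e =>
    (h1.clm_apply contDiff_const).of_le (by simp)
  -- Both sides become integrals over `Ω` of mixed second derivatives of `a`, equal by symmetry.
  rw [← hΩ.integral_fderiv_eq hN hS (h2 e) e', ← hΩ.integral_fderiv_eq hN hS (h2 e') e]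
  congr 1
  ext x
  have hd : HasFDerivAt (fderiv ℝ a) (fderiv ℝ (fderiv ℝ a) x) x :=
    (h1.differentiable (by simp) x).hasFDerivAt
  have h3 : ∀ e e', fderiv ℝ (fun x => fderiv ℝ a x e) x e' = fderiv ℝ (fderiv ℝ a) x e' e := by
    intro e e'
    have h4 := (hd.clm_apply (hasFDerivAt_const e x)).fderiv
    rw [h4]
    simp
  have hsymm : IsSymmSndFDerivAt ℝ a x :=
    ha.contDiffAt.isSymmSndFDerivAt (by simp; exact WithTop.coe_le_coe.2 le_top)
  rw [h3, h3, hsymm.eq]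

end IsInterior

end

/-! ### The Minkowski-type integral identity -/

section

variable {m : ℕ} {S Ω : Set (EuclideanSpace ℝ (Fin (m + 1)))}
  {N : EuclideanSpace ℝ (Fin (m + 1)) → EuclideanSpace ℝ (Fin (m + 1))}
  {p v : EuclideanSpace ℝ (Fin (m + 1))}

theorem IsExtendedNormal.integrable (hN : IsExtendedNormal S N) (hS : IsCompact S)
    {g : EuclideanSpace ℝ (Fin (m + 1)) → ℝ} (hg : Continuous g) :
    Integrable g (μHE[m].restrict S) := by
  have hfin := hN.isFiniteMeasure hS
  have h := hg.continuousOn.integrableOn_compact (μ := μHE[m].restrict S) hS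
  rwa [IntegrableOn, Measure.restrict_restrict hS.measurableSet, inter_self] at h

/-- `n` times the enclosed volume is the integral of the support function. -/
theorem IsInterior.integral_inner_eq_volume (hΩ : IsInterior S N Ω) (hN : IsExtendedNormal S N)
    (hS : IsCompact S) :
    ∫ x in S, ⟪N x, x⟫ ∂μHE[m] = (m + 1) * volume.real Ω := by
  set b := EuclideanSpace.basisFun (Fin (m + 1)) ℝ
  -- In coordinates, the divergence theorem is applied to each coordinate function along its own
  -- axis.
  have h1 : ∀ x : EuclideanSpace ℝ (Fin (m + 1)), ⟪N x, x⟫ = ∑ i, ⟪x, b i⟫ * ⟪N x, b i⟫ := fun x => by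
    rw [← b.sum_inner_mul_inner]
    exact Finset.sum_congr rfl fun i _ => by rw [mul_comm, real_inner_comm x]
  simp_rw [h1]
  rw [integral_finsetSum]
  · have h2 : ∀ i, ∫ x in S, ⟪x, b i⟫ * ⟪N x, b i⟫ ∂μHE[m] = volume.real Ω := by
      intro i
      rw [← hΩ.integral_fderiv_eq hN hS (φ := fun x => ⟪x, b i⟫)
        (contDiff_id.inner ℝ contDiff_const) (b i)]
      have h3 : ∀ x, fderiv ℝ (fun x : EuclideanSpace ℝ (Fin (m + 1)) => ⟪x, b i⟫) x (b i) = 1 := by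
        intro x
        have h4 := ((hasFDerivAt_id (𝕜 := ℝ) x).inner ℝ (hasFDerivAt_const (b i) x)).fderiv
        simp only [id] at h4
        rw [h4]
        simp
      simp_rw [h3]
      simp
    simp_rw [h2]
    simp
  · intro i _
    have := hN.contDiff.continuous
    exact hN.integrable hS (by fun_prop)

/-- The tangential divergence theorem for `φ` times the position vector, where `φ` is the
reciprocal of the mean curvature. -/
theorem IsInterior.integral_tangential_derivative (hΩ : IsInterior S N Ω)
    (hN : IsExtendedNormal S N) (hS : IsCompact S) (hm : m ≠ 0)
    {φ : EuclideanSpace ℝ (Fin (m + 1)) → ℝ} (hφ : ContDiff ℝ ∞ φ)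
    (hφS : ∀ p ∈ S, φ p * extendedMeanCurvature N p = 1) :
    ∫ x in S, fderiv ℝ φ x (x - ⟪N x, x⟫ • N x) ∂μHE[m] =
      m * ((m + 1) * volume.real Ω - ∫ x in S, φ x ∂μHE[m]) := by
  set b := EuclideanSpace.basisFun (Fin (m + 1)) ℝ
  have hNc := hN.contDiff.continuous
  have hφc := hφ.continuous
  have hDφ : Continuous (fderiv ℝ φ) := hφ.continuous_fderiv (by simp)
  have hDN : Continuous (fderiv ℝ N) := hN.contDiff.continuous_fderiv (by simp)
  -- Stokes' theorem for `φ xᵢ Nⱼ` with the directions `b i` and `b j`, summed over `i` and `j`, is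
  -- the tangential divergence theorem for `φ` times the position vector.
  let a : Fin (m + 1) → Fin (m + 1) → EuclideanSpace ℝ (Fin (m + 1)) → ℝ :=
    fun i j x => φ x * ⟪x, b i⟫ * ⟪N x, b j⟫
  have ha : ∀ i j, ContDiff ℝ ∞ (a i j) := fun i j =>
    (hφ.mul (contDiff_id.inner ℝ contDiff_const)).mul (hN.contDiff.inner ℝ contDiff_const)
  have hda : ∀ i j x e, fderiv ℝ (a i j) x e = fderiv ℝ φ x e * ⟪x, b i⟫ * ⟪N x, b j⟫ +
      φ x * ⟪e, b i⟫ * ⟪N x, b j⟫ + φ x * ⟪x, b i⟫ * ⟪fderiv ℝ N x e, b j⟫ := by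
    intro i j x e
    have h1 : HasFDerivAt φ (fderiv ℝ φ x) x := (hφ.differentiable (by simp) x).hasFDerivAt
    have h2 : HasFDerivAt N (fderiv ℝ N x) x := (hN.contDiff.differentiable (by simp) x).hasFDerivAt
    have h3 := ((h1.mul ((hasFDerivAt_id (𝕜 := ℝ) x).inner ℝ (hasFDerivAt_const (b i) x))).mul
      (h2.inner ℝ (hasFDerivAt_const (b j) x))).fderiv
    have h4 : fderiv ℝ (a i j) x = _ := h3
    rw [h4]
    simp
    ring
  have hac : ∀ i j e e', Continuous fun x => fderiv ℝ (a i j) x e * ⟪N x, e'⟫ := fun i j e e' =>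
    (((ha i j).continuous_fderiv (by simp)).clm_apply continuous_const).mul
      (hNc.inner continuous_const)
  have hlin : ∀ (ℓ : EuclideanSpace ℝ (Fin (m + 1)) →L[ℝ] ℝ) (u : EuclideanSpace ℝ (Fin (m + 1))),
      ∑ i, ⟪u, b i⟫ * ℓ (b i) = ℓ u := by
    intro ℓ u
    conv_rhs => rw [← b.sum_repr' u]
    rw [map_sum]
    exact Finset.sum_congr rfl fun i _ => by rw [map_smul, smul_eq_mul, real_inner_comm]
  have hin : ∀ u w : EuclideanSpace ℝ (Fin (m + 1)), ∑ i, ⟪u, b i⟫ * ⟪w, b i⟫ = ⟪w, u⟫ :=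
    fun u w => hlin (innerSL ℝ w) u
  have hleft : ∀ x, ∑ i, ∑ j, fderiv ℝ (a i j) x (b j) * ⟪N x, b i⟫ =
      fderiv ℝ φ x (N x) * ⟪N x, x⟫ + φ x * ⟪N x, N x⟫ +
        φ x * ⟪N x, x⟫ * LinearMap.trace ℝ _ (fderiv ℝ N x).toLinearMap := by
    intro x
    have htr : ∑ j, ⟪fderiv ℝ N x (b j), b j⟫ =
        LinearMap.trace ℝ _ (fderiv ℝ N x).toLinearMap := by
      rw [LinearMap.trace_eq_sum_inner _ b]
      exact Finset.sum_congr rfl fun i _ => real_inner_comm _ _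
    have h1 : ∀ i, ∑ j, fderiv ℝ (a i j) x (b j) * ⟪N x, b i⟫ =
        fderiv ℝ φ x (N x) * (⟪x, b i⟫ * ⟪N x, b i⟫) + φ x * (⟪N x, b i⟫ * ⟪N x, b i⟫) +
        φ x * LinearMap.trace ℝ _ (fderiv ℝ N x).toLinearMap * (⟪x, b i⟫ * ⟪N x, b i⟫) := by
      intro i
      have h2 : ∀ j, fderiv ℝ (a i j) x (b j) * ⟪N x, b i⟫ =
          (⟪N x, b j⟫ * fderiv ℝ φ x (b j)) * (⟪x, b i⟫ * ⟪N x, b i⟫) +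
          (⟪N x, b j⟫ * innerSL ℝ (b i) (b j)) * (φ x * ⟪N x, b i⟫) +
          ⟪fderiv ℝ N x (b j), b j⟫ * (φ x * (⟪x, b i⟫ * ⟪N x, b i⟫)) := by
        intro j
        rw [hda, innerSL_apply_apply, real_inner_comm (b i) (b j)]
        ring
      simp_rw [h2]
      rw [Finset.sum_add_distrib, Finset.sum_add_distrib, ← Finset.sum_mul, ← Finset.sum_mul,
        ← Finset.sum_mul, hlin, hlin, htr, innerSL_apply_apply, real_inner_comm (N x) (b i)]
      ring
    simp_rw [h1]
    rw [Finset.sum_add_distrib, Finset.sum_add_distrib, ← Finset.mul_sum, ← Finset.mul_sum,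
      ← Finset.mul_sum, hin, hin]
    ring
  have hright : ∀ x, ∑ i, ∑ j, fderiv ℝ (a i j) x (b i) * ⟪N x, b j⟫ =
      fderiv ℝ φ x x * ⟪N x, N x⟫ + (m + 1) * (φ x * ⟪N x, N x⟫) +
        φ x * ⟪N x, fderiv ℝ N x x⟫ := by
    intro x
    have h1 : ∀ i, ∑ j, fderiv ℝ (a i j) x (b i) * ⟪N x, b j⟫ =
        (⟪x, b i⟫ * fderiv ℝ φ x (b i)) * ⟪N x, N x⟫ + φ x * ⟪N x, N x⟫ +
          φ x * (⟪x, b i⟫ * ((innerSL ℝ (N x)).comp (fderiv ℝ N x)) (b i)) := by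
      intro i
      have h2 : ∀ j, fderiv ℝ (a i j) x (b i) * ⟪N x, b j⟫ =
          (fderiv ℝ φ x (b i) * ⟪x, b i⟫ + φ x * ⟪b i, b i⟫) * (⟪N x, b j⟫ * ⟪N x, b j⟫) +
            φ x * ⟪x, b i⟫ * (⟪N x, b j⟫ * ⟪fderiv ℝ N x (b i), b j⟫) := by
        intro j
        rw [hda]
        ring
      simp_rw [h2]
      rw [Finset.sum_add_distrib, ← Finset.mul_sum, ← Finset.mul_sum, hin, hin,
        real_inner_self_eq_norm_sq (b i), b.norm_eq_one, ContinuousLinearMap.comp_apply,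
        innerSL_apply_apply, real_inner_comm (N x) (fderiv ℝ N x (b i))]
      ring
    simp_rw [h1]
    rw [Finset.sum_add_distrib, Finset.sum_add_distrib, ← Finset.sum_mul, Finset.sum_const,
      ← Finset.mul_sum, hlin, hlin]
    simp
  have hstokes : ∫ x in S, ∑ i, ∑ j, fderiv ℝ (a i j) x (b j) * ⟪N x, b i⟫ ∂μHE[m] =
      ∫ x in S, ∑ i, ∑ j, fderiv ℝ (a i j) x (b i) * ⟪N x, b j⟫ ∂μHE[m] := by
    have hi := fun i j e e' => hN.integrable hS (hac i j e e')
    rw [integral_finsetSum _ fun i _ => integrable_finsetSum _ fun j _ => hi i j _ _,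
      integral_finsetSum _ fun i _ => integrable_finsetSum _ fun j _ => hi i j _ _]
    refine Finset.sum_congr rfl fun i _ => ?_
    rw [integral_finsetSum _ fun j _ => hi i j _ _, integral_finsetSum _ fun j _ => hi i j _ _]
    exact Finset.sum_congr rfl fun j _ => hΩ.integral_tangential_fderiv hN hS (ha i j) _ _
  have hpoint : ∀ x ∈ S, fderiv ℝ φ x (x - ⟪N x, x⟫ • N x) =
      (∑ i, ∑ j, fderiv ℝ (a i j) x (b i) * ⟪N x, b j⟫ -
        ∑ i, ∑ j, fderiv ℝ (a i j) x (b j) * ⟪N x, b i⟫) + (m * ⟪N x, x⟫ - m * φ x) := by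
    intro x hx
    have hN1 : ⟪N x, N x⟫ = 1 := by
      rw [real_inner_self_eq_norm_sq, hN.norm_eq_one x hx, one_pow]
    have hT : x - ⟪N x, x⟫ • N x ∈ tangentSpace S x := by
      rw [hN.mem_tangentSpace_iff hx, inner_sub_right, real_inner_smul_right, hN1]
      ring
    -- This identity trades `⟪N, dN x⟫` for `⟪N, x⟫ ⟪N, dN N⟫`, which completes the trace to `m`
    -- times the mean curvature; then `φ * H = 1` removes `φ` from that term.
    have h1 := hN.inner_fderiv hx hT
    rw [map_sub, map_smul, inner_sub_right, real_inner_smul_right] at h1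
    have h2 := hφS x hx
    rw [extendedMeanCurvature] at h2
    have hm' : (m : ℝ) ≠ 0 := by exact_mod_cast hm
    rw [hleft, hright, hN1, map_sub, map_smul, smul_eq_mul]
    have h3 : φ x * (LinearMap.trace ℝ _ (fderiv ℝ N x).toLinearMap -
        ⟪N x, fderiv ℝ N x (N x)⟫) = m := by
      rw [← mul_div_assoc, div_eq_one_iff_eq hm'] at h2
      exact h2
    linear_combination (-φ x) * h1 + ⟪N x, x⟫ * h3
  have hi1 : Integrable (fun x => ∑ i, ∑ j, fderiv ℝ (a i j) x (b i) * ⟪N x, b j⟫)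
      (μHE[m].restrict S) :=
    integrable_finsetSum _ fun i _ => integrable_finsetSum _ fun j _ => hN.integrable hS (hac i j _ _)
  have hi2 : Integrable (fun x => ∑ i, ∑ j, fderiv ℝ (a i j) x (b j) * ⟪N x, b i⟫)
      (μHE[m].restrict S) :=
    integrable_finsetSum _ fun i _ => integrable_finsetSum _ fun j _ => hN.integrable hS (hac i j _ _)
  have hi3 : Integrable (fun x => m * ⟪N x, x⟫) (μHE[m].restrict S) :=
    hN.integrable hS (by fun_prop)
  have hi4 : Integrable (fun x => m * φ x) (μHE[m].restrict S) := hN.integrable hS (by fun_prop)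
  have hi12 : Integrable (fun x => ∑ i, ∑ j, fderiv ℝ (a i j) x (b i) * ⟪N x, b j⟫ -
      ∑ i, ∑ j, fderiv ℝ (a i j) x (b j) * ⟪N x, b i⟫) (μHE[m].restrict S) := hi1.sub hi2
  have hi34 : Integrable (fun x => m * ⟪N x, x⟫ - m * φ x) (μHE[m].restrict S) := hi3.sub hi4
  rw [setIntegral_congr_fun hS.measurableSet hpoint, integral_add hi12 hi34,
    integral_sub hi1 hi2, integral_sub hi3 hi4, hstokes, integral_const_mul, integral_const_mul,
    hΩ.integral_inner_eq_volume hN hS]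
  ring

/-- The smooth extension of the reciprocal of a function that does not vanish on a closed set. -/
theorem exists_contDiff_reciprocal (hS : IsClosed S) {h : EuclideanSpace ℝ (Fin (m + 1)) → ℝ}
    (hh : ContDiff ℝ ∞ h) (h0 : ∀ p ∈ S, h p ≠ 0) :
    ∃ φ : EuclideanSpace ℝ (Fin (m + 1)) → ℝ, ContDiff ℝ ∞ φ ∧ ∀ p ∈ S, φ p * h p = 1 := by
  obtain ⟨φ, hφ, hφS⟩ := exists_contDiff_extension hS (fun x => (h x)⁻¹) fun x hx =>
    ⟨{y | h y ≠ 0}, (isOpen_ne_fun hh.continuous continuous_const).mem_nhds (h0 x hx),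
      fun x => (h x)⁻¹, hh.contDiffOn.inv fun y hy => hy, fun y _ _ => rfl⟩
  exact ⟨φ, hφ, fun p hp => by rw [← hφS p hp, inv_mul_cancel₀ (h0 p hp)]⟩

/-- The projection is self-adjoint, so it can be moved to `x`; on the resulting tangent vector the
derivative depends only on values on `S`. -/
theorem IsExtendedNormal.inner_tangentialGradient (hN : IsExtendedNormal S N)
    {g G : EuclideanSpace ℝ (Fin (m + 1)) → ℝ} (hgG : EqOn g G S) (hG : DifferentiableAt ℝ G p)
    (hp : p ∈ S) (x : EuclideanSpace ℝ (Fin (m + 1))) :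
    ⟪tangentialGradient S g p, x⟫ = fderiv ℝ G p (x - ⟪N p, x⟫ • N p) := by
  have h1 : (tangentSpace S p).starProjection x ∈ tangentSpace S p :=
    Submodule.starProjection_apply_mem _ _
  have h2 := fderivWithin_eq_of_eqOn hp hgG hG.hasFDerivAt h1
  rw [← hN.starProjection_apply hp, ← h2, tangentialGradient,
    Submodule.inner_starProjection_left_eq_right, gradientWithin,
    InnerProductSpace.toDual_symm_apply]

/-- The integral of the theorem, in terms of the total reciprocal mean curvature and the enclosed
volume. -/
theorem IsInterior.integral_eq (hΩ : IsInterior S N Ω) (hN : IsExtendedNormal S N)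
    (hS : IsCompact S) (hm : m ≠ 0)
    {ν : EuclideanSpace ℝ (Fin (m + 1)) → EuclideanSpace ℝ (Fin (m + 1))} (hν : EqOn ν N S)
    {φ : EuclideanSpace ℝ (Fin (m + 1)) → ℝ} (hφ : ContDiff ℝ ∞ φ)
    (hφS : ∀ p ∈ S, φ p * extendedMeanCurvature N p = 1) :
    ∫ p in S, (1 / meanCurvature S ν p ^ 2) *
        ⟪tangentialGradient S (meanCurvature S ν) p, p⟫ ∂μHE[m] =
      m * (∫ x in S, φ x ∂μHE[m] - (m + 1) * volume.real Ω) := by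
  have hH : EqOn (meanCurvature S ν) (extendedMeanCurvature N) S := fun p hp =>
    hN.meanCurvature_eq hν hp hm
  have hh := contDiff_extendedMeanCurvature hN.contDiff
  have h1 : ∀ x ∈ S, (1 / meanCurvature S ν x ^ 2) *
      ⟪tangentialGradient S (meanCurvature S ν) x, x⟫ =
      -fderiv ℝ φ x (x - ⟪N x, x⟫ • N x) := by
    intro x hx
    have hd := hh.differentiable (by simp) x
    rw [hN.inner_tangentialGradient hH hd hx, hH hx]
    set w := x - ⟪N x, x⟫ • N x with hw
    have hT : w ∈ tangentSpace S x := by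
      rw [hN.mem_tangentSpace_iff hx, hw, inner_sub_right, real_inner_smul_right,
        real_inner_self_eq_norm_sq, hN.norm_eq_one x hx]
      ring
    -- Differentiating `φ * H = 1` along `S` gives `dφ = -dH / H²` on tangent vectors.
    have h2 := fderiv_eq_zero_of_forall_eq hx
      ((hφ.differentiable (by simp) x).hasFDerivAt.mul hd.hasFDerivAt)
      (eventually_mem_nhdsWithin.mono fun y hy => hφS y hy) hT
    have h3 := hφS x hx
    have h4 : extendedMeanCurvature N x ≠ 0 := right_ne_zero_of_mul (h3 ▸ one_ne_zero)
    simp only [add_apply, smul_apply, smul_eq_mul] at h2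
    have h5 : φ x = 1 / extendedMeanCurvature N x := by field_simp; exact h3
    rw [h5] at h2
    field_simp at h2 ⊢
    linarith
  rw [setIntegral_congr_fun hS.measurableSet h1, integral_neg,
    hΩ.integral_tangential_derivative hN hS hm hφ hφS]
  ring

end

/-! ### The Jacobian of the parallel maps -/

section

variable {m : ℕ} {S Ω : Set (EuclideanSpace ℝ (Fin (m + 1)))}
  {N : EuclideanSpace ℝ (Fin (m + 1)) → EuclideanSpace ℝ (Fin (m + 1))}
  {p v : EuclideanSpace ℝ (Fin (m + 1))}

/-- The derivative of the parallel map `q ↦ q - t N(q)` in the tangential directions, extended by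
the identity to the normal direction. -/
def parallelDerivative (N : EuclideanSpace ℝ (Fin (m + 1)) → EuclideanSpace ℝ (Fin (m + 1)))
    (t : ℝ) (q : EuclideanSpace ℝ (Fin (m + 1))) :
    EuclideanSpace ℝ (Fin (m + 1)) →L[ℝ] EuclideanSpace ℝ (Fin (m + 1)) :=
  .id ℝ _ - t • (fderiv ℝ N q).comp (.id ℝ _ - (innerSL ℝ (N q)).smulRight (N q))

theorem parallelDerivative_apply (t q x) : parallelDerivative N t q x =
    x - t • fderiv ℝ N q (x - ⟪N q, x⟫ • N q) := by
  simp [parallelDerivative]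

namespace IsExtendedNormal

theorem parallelDerivative_apply_of_mem (hN : IsExtendedNormal S N) (hp : p ∈ S) (t) {w}
    (hw : w ∈ tangentSpace S p) : parallelDerivative N t p w = w - t • fderiv ℝ N p w := by
  rw [parallelDerivative_apply, (hN.mem_tangentSpace_iff hp).1 hw, zero_smul, sub_zero]

theorem parallelDerivative_normal (hN : IsExtendedNormal S N) (hp : p ∈ S) (t) :
    parallelDerivative N t p (N p) = N p := by
  rw [parallelDerivative_apply, real_inner_self_eq_norm_sq, hN.norm_eq_one p hp]
  simp

/-- At a point where an interior ball of radius `t` touches, the identity minus `t` times the shape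
operator is positive semidefinite. -/
theorem exists_touching_operator (hN : IsExtendedNormal S N) (hm : m ≠ 0) (hp : p ∈ S) {t : ℝ}
    (ht : 0 ≤ t) (hball : ∀ q ∈ S, t ≤ ‖q - p + t • N p‖) :
    ∃ B : tangentSpace S p →ₗ[ℝ] tangentSpace S p, B.IsSymmetric ∧ (∀ w, 0 ≤ ⟪B w, w⟫) ∧
      (∀ w : tangentSpace S p,
        (B w : EuclideanSpace ℝ (Fin (m + 1))) = w - t • fderiv ℝ N p w) ∧
      LinearMap.trace ℝ _ B = m * (1 - t * extendedMeanCurvature N p) := by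
  set B : tangentSpace S p →ₗ[ℝ] tangentSpace S p := LinearMap.id - t • shapeOperator S N p with hB
  have hBapp : ∀ w : tangentSpace S p,
      (B w : EuclideanSpace ℝ (Fin (m + 1))) = w - t • fderiv ℝ N p w := by
    intro w
    rw [hB, ← hN.coe_shapeOperator (fun _ _ => rfl) hp w]
    rfl
  refine ⟨B, fun w w' => ?_, fun w => ?_, hBapp, ?_⟩
  · rw [Submodule.coe_inner, Submodule.coe_inner, hBapp, hBapp, inner_sub_left, inner_sub_right,
      real_inner_smul_left, real_inner_smul_right, hN.symm p hp w w.2 w' w'.2]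
  · rw [Submodule.coe_inner, hBapp]
    exact hN.shape_le_of_touching hp ht hball w.2
  · rw [hB, map_sub, map_smul, hN.trace_shapeOperator (fun _ _ => rfl) hp hm, LinearMap.trace_id,
      hN.finrank_tangentSpace hp, smul_eq_mul]
    ring

/-- At a point where an interior ball of radius `t` touches, the Jacobian of the parallel map is
controlled by the mean curvature. -/
theorem abs_det_parallelDerivative_le (hN : IsExtendedNormal S N) (hm : m ≠ 0) (hp : p ∈ S) {t : ℝ}
    (ht : 0 ≤ t) (hball : ∀ q ∈ S, t ≤ ‖q - p + t • N p‖) :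
    t * extendedMeanCurvature N p ≤ 1 ∧
      |(parallelDerivative N t p).det| ≤ (1 - t * extendedMeanCurvature N p) ^ m := by
  have hm' : (m : ℝ) ≠ 0 := by exact_mod_cast hm
  have hmpos : (0 : ℝ) < m := by positivity
  obtain ⟨B, hsymm, hpos, hBapp, htr⟩ := hN.exists_touching_operator hm hp ht hball
  have hfin := hN.finrank_tangentSpace hp
  have htr0 : 0 ≤ LinearMap.trace ℝ _ B := by
    rw [LinearMap.trace_eq_sum_inner B (stdOrthonormalBasis ℝ (tangentSpace S p))]
    exact Finset.sum_nonneg fun i _ => by rw [real_inner_comm]; exact hpos _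
  -- The arithmetic-geometric mean inequality, with `trace B / m = 1 - t * H`.
  obtain ⟨hdet0, hdet⟩ := det_nonneg_and_le_pow_of_isSymmetric hsymm hpos
    (by rw [hfin]; exact Nat.pos_of_ne_zero hm)
  rw [htr, hfin, mul_div_cancel_left₀ _ hm'] at hdet
  rw [htr] at htr0
  refine ⟨by linarith [nonneg_of_mul_nonneg_right htr0 hmpos], ?_⟩
  have hW : tangentSpace S p ≤ (tangentSpace S p).comap
      (parallelDerivative N t p : EuclideanSpace ℝ (Fin (m + 1)) →ₗ[ℝ] _) := by
    intro w hw
    change parallelDerivative N t p w ∈ tangentSpace S p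
    rw [hN.parallelDerivative_apply_of_mem hp t hw]
    exact sub_mem hw (Submodule.smul_mem _ _ (hN.fderiv_mem_tangentSpace hp hw))
  -- The parallel derivative is the identity modulo the tangent space, so the normal direction
  -- contributes a factor 1.
  have h1 := det_eq_det_restrict (tangentSpace S p)
    (parallelDerivative N t p : EuclideanSpace ℝ (Fin (m + 1)) →ₗ[ℝ] _) (by
      intro x
      change parallelDerivative N t p x - x ∈ tangentSpace S p
      rw [parallelDerivative_apply, sub_sub_cancel_left, ← smul_neg, ← map_neg]
      refine Submodule.smul_mem _ _ (hN.fderiv_mem_tangentSpace hp (neg_mem ?_))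
      rw [hN.mem_tangentSpace_iff hp, inner_sub_right, real_inner_smul_right,
        real_inner_self_eq_norm_sq, hN.norm_eq_one p hp]
      ring) hW
  have h2 : (parallelDerivative N t p : EuclideanSpace ℝ (Fin (m + 1)) →ₗ[ℝ] _).restrict hW = B := by
    apply LinearMap.ext
    intro w
    apply Subtype.ext
    rw [hBapp]
    exact hN.parallelDerivative_apply_of_mem hp t w.2
  rw [ContinuousLinearMap.det, h1, h2, abs_of_nonneg hdet0]
  exact hdet

end IsExtendedNormal

/-- The pairs of a point `p` and a radius `t` such that the ball of radius `t` touching `S` at `p`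
from inside contains no point of `S`. -/
def touchingSet (S : Set (EuclideanSpace ℝ (Fin (m + 1))))
    (N : EuclideanSpace ℝ (Fin (m + 1)) → EuclideanSpace ℝ (Fin (m + 1))) :
    Set (EuclideanSpace ℝ (Fin (m + 1)) × ℝ) :=
  {x | x.1 ∈ S ∧ 0 < x.2 ∧ ∀ q ∈ S, x.2 ≤ ‖q - x.1 + x.2 • N x.1‖}

theorem measurableSet_touchingSet (hS : IsCompact S) (hN : Continuous N) :
    MeasurableSet (touchingSet S N) := by
  have h1 : IsClosed {x : EuclideanSpace ℝ (Fin (m + 1)) × ℝ |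
      ∀ q ∈ S, x.2 ≤ ‖q - x.1 + x.2 • N x.1‖} := by
    simp only [ofPred_forall]
    exact isClosed_iInter fun q => isClosed_iInter fun _ => isClosed_le (by fun_prop) (by fun_prop)
  exact (measurable_fst hS.measurableSet).inter
    ((measurable_snd measurableSet_Ioi).inter h1.measurableSet)

/-- The density of the volume swept out by the inner touching balls. -/
def touchingDensity (S : Set (EuclideanSpace ℝ (Fin (m + 1))))
    (N : EuclideanSpace ℝ (Fin (m + 1)) → EuclideanSpace ℝ (Fin (m + 1))) :
    EuclideanSpace ℝ (Fin (m + 1)) × ℝ → ℝ≥0∞ :=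
  (touchingSet S N).indicator fun x => ENNReal.ofReal ((1 - x.2 * extendedMeanCurvature N x.1) ^ m)

theorem IsExtendedNormal.measurable_touchingDensity (hN : IsExtendedNormal S N) (hS : IsCompact S) :
    Measurable (touchingDensity S N) := by
  have h1 := (contDiff_extendedMeanCurvature hN.contDiff).continuous
  exact Measurable.indicator (by fun_prop) (measurableSet_touchingSet hS hN.contDiff.continuous)

namespace GraphChart

variable (C : GraphChart S p v)

/-- The derivative of the normal exponential map of a graph chart on the hypersurface. -/
def normalFrame (N : EuclideanSpace ℝ (Fin (m + 1)) → EuclideanSpace ℝ (Fin (m + 1)))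
    (y : EuclideanSpace ℝ (Fin m)) :
    EuclideanSpace ℝ (Fin (m + 1)) →L[ℝ] EuclideanSpace ℝ (Fin (m + 1)) :=
  ((fderiv ℝ C.graph y).comp (.fst ℝ _ ℝ) -
    (ContinuousLinearMap.snd ℝ (EuclideanSpace ℝ (Fin m)) ℝ).smulRight (N (C.graph y))).comp
      (C.frame.toEquiv.symm : _ →L[ℝ] _)

theorem continuous_normalFrame (hN : Continuous N) : Continuous (C.normalFrame N) := by
  have h1 : Continuous (fderiv ℝ C.graph) := C.contDiff_graph.continuous_fderiv (by simp)
  have h2 := C.contDiff_graph.continuous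
  unfold normalFrame
  fun_prop

/-- At the center the map is the reflection `(y, s) ↦ (y, -s)` in the frame, an involution. -/
theorem abs_det_normalFrame_zero (C : GraphChart S p (N p)) : |(C.normalFrame N 0).det| = 1 := by
  have h1 : ∀ y s, C.normalFrame N 0 (C.frame.toEquiv (y, s)) = C.frame.toEquiv (y, -s) := by
    intro y s
    rw [C.frame.apply_eq _ (-s)]
    simp [normalFrame, C.fderiv_graph_zero, C.graph_zero, sub_eq_add_neg]
  have h2 : (C.normalFrame N 0).comp (C.normalFrame N 0) = .id ℝ _ := by
    ext1 x
    obtain ⟨⟨y, s⟩, rfl⟩ := C.frame.toEquiv.surjective x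
    simp [h1]
  have h3 : (C.normalFrame N 0).det * (C.normalFrame N 0).det = 1 := by
    have h4 : (C.normalFrame N 0 : EuclideanSpace ℝ (Fin (m + 1)) →ₗ[ℝ] _) ∘ₗ
        (C.normalFrame N 0 : EuclideanSpace ℝ (Fin (m + 1)) →ₗ[ℝ] _) = LinearMap.id :=
      congrArg ContinuousLinearMap.toLinearMap h2
    rw [ContinuousLinearMap.det, ← LinearMap.det_comp, h4, LinearMap.det_id]
  rcases mul_self_eq_one_iff.1 h3 with h | h <;> simp [h]

theorem fderiv_graph_mem_tangentSpace {y} (hy : C.graph y ∈ C.domain) (w) :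
    fderiv ℝ C.graph y w ∈ tangentSpace S (C.graph y) := by
  have h1 : HasDerivAt (fun s : ℝ => y + s • w) w 0 := by
    simpa using ((hasDerivAt_id (0 : ℝ)).smul_const w).const_add y
  have h2 : HasFDerivAt C.graph (fderiv ℝ C.graph y) (y + (0 : ℝ) • w) := by
    rw [zero_smul, add_zero]
    exact (C.contDiff_graph.differentiable (by simp) y).hasFDerivAt
  have h3 := h2.comp_hasDerivAt 0 h1
  have h4 := mem_tangentSpace_of_hasDerivAt (S := S) h3 (by
    have h5 : ContinuousAt (fun s : ℝ => C.graph (y + s • w)) 0 :=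
      (C.contDiff_graph.continuous.comp (by fun_prop)).continuousAt
    filter_upwards [h5.eventually (C.isOpen_domain.mem_nhds (by simpa using hy))] with s hs
    exact C.graph_mem hs)
  simpa using h4

/-- The parallel derivative fixes the normal and is `1 - t dN` on tangent vectors, so it factors out
of the derivative of `(y, t) ↦ q - t N(q)`. This separates the part controlled by mean curvature
from a chart factor with determinant close to ±1. -/
theorem hasFDerivAt_normalMap (hN : IsExtendedNormal S N) {y} (hy : C.graph y ∈ C.domain) (t : ℝ) :
    HasFDerivAt (fun x => C.graph (C.frame.toEquiv.symm x).1 -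
      (C.frame.toEquiv.symm x).2 • N (C.graph (C.frame.toEquiv.symm x).1))
      ((parallelDerivative N t (C.graph y)).comp (C.normalFrame N y)) (C.frame.toEquiv (y, t)) := by
  set x₀ := C.frame.toEquiv (y, t)
  have hx₀ : C.frame.toEquiv.symm x₀ = (y, t) := C.frame.toEquiv.symm_apply_apply _
  have hJ := C.frame.toEquiv.symm.hasFDerivAt (x := x₀)
  have hg : HasFDerivAt C.graph (fderiv ℝ C.graph y) (C.frame.toEquiv.symm x₀).1 := by
    rw [hx₀]; exact (C.contDiff_graph.differentiable (by simp) y).hasFDerivAt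
  have h1 := hg.comp x₀ hJ.fst
  have hNd : HasFDerivAt N (fderiv ℝ N (C.graph y)) (C.graph (C.frame.toEquiv.symm x₀).1) := by
    rw [hx₀]; exact (hN.contDiff.differentiable (by simp) _).hasFDerivAt
  have h2 := hNd.comp x₀ h1
  have h3 := h1.sub (hJ.snd.smul h2)
  refine h3.congr_fderiv ?_
  ext1 x
  obtain ⟨⟨w, s⟩, rfl⟩ := C.frame.toEquiv.surjective x
  have hq := C.graph_mem hy
  have hM : C.normalFrame N y (C.frame.toEquiv (w, s)) =
      fderiv ℝ C.graph y w - s • N (C.graph y) := by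
    simp [normalFrame]
  rw [ContinuousLinearMap.comp_apply, hM, map_sub, map_smul, hN.parallelDerivative_normal hq,
    hN.parallelDerivative_apply_of_mem hq t (C.fderiv_graph_mem_tangentSpace hy w)]
  simp [hx₀]
  abel

end GraphChart

end

/-! ### The Heintze-Karcher inequality and its equality case -/

section

variable {m : ℕ} {S Ω : Set (EuclideanSpace ℝ (Fin (m + 1)))}
  {N : EuclideanSpace ℝ (Fin (m + 1)) → EuclideanSpace ℝ (Fin (m + 1))}
  {p v : EuclideanSpace ℝ (Fin (m + 1))}

/-- The centers of the interior balls touching `S` at points of `A`. -/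
def touchingCenters (S : Set (EuclideanSpace ℝ (Fin (m + 1))))
    (N : EuclideanSpace ℝ (Fin (m + 1)) → EuclideanSpace ℝ (Fin (m + 1)))
    (A : Set (EuclideanSpace ℝ (Fin (m + 1)))) : Set (EuclideanSpace ℝ (Fin (m + 1))) :=
  (fun x : EuclideanSpace ℝ (Fin (m + 1)) × ℝ => x.1 - x.2 • N x.1) ''
    (touchingSet S N ∩ Prod.fst ⁻¹' A)

/-- The volume of an image is at most the integral of the Jacobian, with no injectivity needed. On
touching pairs the Jacobian is at most `(1 + ε) * (1 - t * H) ^ m`, and Fubini separates `t` from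
the base point. -/
theorem GraphChart.exists_volume_touchingCenters_le (C : GraphChart S p (N p))
    (hN : IsExtendedNormal S N) (hS : IsCompact S) (hm : m ≠ 0) {ε : ℝ≥0} (hε : 0 < ε) :
    ∃ U, IsOpen U ∧ p ∈ U ∧ ∀ A, MeasurableSet A → A ⊆ U → volume (touchingCenters S N A) ≤
      (1 + ε) * ∫⁻ q in A, (∫⁻ t, touchingDensity S N (q, t)) ∂(μHE[m].restrict S) := by
  -- Only the bound of Lebesgue measure by surface measure is used, so the constant 1 here is
  -- immaterial; `ε` enters through the determinant of the normal frame.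
  obtain ⟨δ₀, hδ₀, hδ⟩ := C.exists_measure_comparison (ε := 1) one_pos
  have hNc := hN.contDiff.continuous
  have hdet : ∀ᶠ y in 𝓝 (0 : EuclideanSpace ℝ (Fin m)), |(C.normalFrame N y).det| < 1 + ε := by
    have hc : Continuous fun y => |(C.normalFrame N y).det| :=
      (ContinuousLinearMap.continuous_det.comp (C.continuous_normalFrame hNc)).abs
    refine hc.continuousAt.eventually_lt_const ?_
    change |(C.normalFrame N 0).det| < 1 + ε
    rw [C.abs_det_normalFrame_zero]
    exact lt_add_of_pos_right _ hε
  obtain ⟨δ₁, hδ₁, hdet⟩ := Metric.eventually_nhds_iff_ball.1 hdet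
  set δ := min δ₀ δ₁
  have hδpos : 0 < δ := lt_min hδ₀ hδ₁
  obtain ⟨hdom, hle, -⟩ := hδ δ hδpos (min_le_left _ _)
  have hp0 : C.proj p = 0 := by simp [proj]
  refine ⟨C.domain ∩ C.proj ⁻¹' ball 0 δ, C.isOpen_domain.inter
    (isOpen_ball.preimage C.contDiff_proj.continuous), ⟨C.mem_domain, ?_⟩, fun A hA hAU => ?_⟩
  · rw [mem_preimage, hp0]
    exact mem_ball_self hδpos
  set J := C.frame.toEquiv
  have hD := hN.measurable_touchingDensity hS
  have hZ := measurableSet_touchingSet hS hNc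
  set Φ : EuclideanSpace ℝ (Fin m) × ℝ → EuclideanSpace ℝ (Fin (m + 1)) × ℝ :=
    fun x => (C.graph x.1, x.2)
  have hΦ : Measurable Φ := (C.measurable_graph.comp measurable_fst).prodMk measurable_snd
  have hB : MeasurableSet (C.graph ⁻¹' A ∩ ball 0 δ) :=
    (C.measurable_graph hA).inter measurableSet_ball
  set s' : Set (EuclideanSpace ℝ (Fin m) × ℝ) := ((C.graph ⁻¹' A ∩ ball 0 δ) ×ˢ univ) ∩
    Φ ⁻¹' touchingSet S N
  have hs' : MeasurableSet s' := (hB.prod MeasurableSet.univ).inter (hΦ hZ)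
  set s := J.symm ⁻¹' s'
  have hs : MeasurableSet s := J.symm.continuous.measurable hs'
  set f : EuclideanSpace ℝ (Fin (m + 1)) → EuclideanSpace ℝ (Fin (m + 1)) :=
    fun x => C.graph (J.symm x).1 - (J.symm x).2 • N (C.graph (J.symm x).1)
  have hf : ∀ z ∈ s, HasFDerivWithinAt f ((parallelDerivative N (J.symm z).2
      (C.graph (J.symm z).1)).comp (C.normalFrame N (J.symm z).1)) s z := by
    intro z hz
    have hy : C.graph (J.symm z).1 ∈ C.domain := hdom _ (by simpa using hz.1.1.2)
    have h1 := C.hasFDerivAt_normalMap hN hy (J.symm z).2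
    have h2 : C.frame.toEquiv ((J.symm z).1, (J.symm z).2) = z := J.apply_symm_apply z
    rw [h2] at h1
    exact h1.hasFDerivWithinAt
  have himage : touchingCenters S N A ⊆ f '' s := by
    rintro _ ⟨⟨q, t⟩, ⟨hq, hqA⟩, rfl⟩
    obtain ⟨hqd, hqb⟩ := hAU hqA
    have hg := C.graph_proj hqd hq.1
    have hJ : J.symm (J (C.proj q, t)) = (C.proj q, t) := J.symm_apply_apply _
    refine ⟨J (C.proj q, t), ?_, ?_⟩
    · change J.symm (J (C.proj q, t)) ∈ s'
      rw [hJ]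
      refine ⟨⟨⟨?_, hqb⟩, trivial⟩, ?_⟩
      · rw [mem_preimage, hg]
        exact hqA
      · rw [mem_preimage]
        simp only [Φ]
        rw [hg]
        exact hq
    · simp only [f]
      rw [hJ]
      simp only
      rw [hg]
  have hjac : ∀ z ∈ s, ENNReal.ofReal |((parallelDerivative N (J.symm z).2
      (C.graph (J.symm z).1)).comp (C.normalFrame N (J.symm z).1)).det| ≤
      (1 + ε) * touchingDensity S N (Φ (J.symm z)) := by
    intro z hz
    have hz2 : Φ (J.symm z) ∈ touchingSet S N := hz.2
    obtain ⟨h1, h2⟩ := hN.abs_det_parallelDerivative_le hm hz2.1 hz2.2.1.le hz2.2.2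
    have h3 := hdet (J.symm z).1 (ball_subset_ball (min_le_right _ _) hz.1.1.2)
    rw [touchingDensity, indicator_of_mem hz2]
    have h4 : (1 + ε : ℝ≥0∞) = ENNReal.ofReal (1 + ε) := by
      rw [ENNReal.ofReal_add zero_le_one ε.coe_nonneg]
      simp
    rw [h4, ← ENNReal.ofReal_mul (by positivity)]
    refine ENNReal.ofReal_le_ofReal ?_
    have h5 : ((parallelDerivative N (J.symm z).2 (C.graph (J.symm z).1)).comp
        (C.normalFrame N (J.symm z).1)).det = (parallelDerivative N (J.symm z).2
        (C.graph (J.symm z).1)).det * (C.normalFrame N (J.symm z).1).det :=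
      LinearMap.det_comp _ _
    rw [h5, abs_mul, mul_comm]
    exact mul_le_mul h3.le h2 (abs_nonneg _) (by positivity)
  have hcomp : Measurable fun x => touchingDensity S N (Φ x) := hD.comp hΦ
  calc volume (touchingCenters S N A) ≤ volume (f '' s) := measure_mono himage
    _ ≤ ∫⁻ z in s, ENNReal.ofReal |((parallelDerivative N (J.symm z).2
      (C.graph (J.symm z).1)).comp (C.normalFrame N (J.symm z).1)).det| :=
      addHaar_image_le_lintegral_abs_det_fderiv volume hs hf
    _ ≤ ∫⁻ z in s, (1 + ε) * touchingDensity S N (Φ (J.symm z)) :=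
      setLIntegral_mono' hs hjac
    _ = ∫⁻ x in s', (1 + ε) * touchingDensity S N (Φ x) :=
      C.frame.measurePreserving_symm.setLIntegral_comp_preimage hs' (hcomp.const_mul _)
    _ = (1 + ε) * ∫⁻ x in s', touchingDensity S N (Φ x) := lintegral_const_mul _ hcomp
    _ ≤ (1 + ε) * ∫⁻ x in (C.graph ⁻¹' A ∩ ball 0 δ) ×ˢ univ, touchingDensity S N (Φ x) := by
      gcongr
      exact inter_subset_left
    _ = (1 + ε) * ∫⁻ y in C.graph ⁻¹' A ∩ ball 0 δ, ∫⁻ t, touchingDensity S N (C.graph y, t) := by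
      rw [Measure.volume_eq_prod, ← Measure.prod_restrict, Measure.restrict_univ,
        lintegral_prod _ hcomp.aemeasurable]
    _ = (1 + ε) * ∫⁻ q in A, (∫⁻ t, touchingDensity S N (q, t))
        ∂((volume.restrict (ball 0 δ)).map C.graph) := by
      rw [setLIntegral_map hA hD.lintegral_prod_right' C.measurable_graph,
        Measure.restrict_restrict (C.measurable_graph hA)]
    _ ≤ _ := by
      gcongr

/-- The left side is subadditive and the right side additive in `A`, so compactness globalizes the
local bound; then `ε` tends to 0. -/
theorem IsExtendedNormal.volume_touchingCenters_le (hN : IsExtendedNormal S N) (hS : IsCompact S)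
    (hm : m ≠ 0) : volume (touchingCenters S N S) ≤
      ∫⁻ q in S, (∫⁻ t, touchingDensity S N (q, t)) ∂μHE[m] := by
  have key : ∀ ε : ℝ≥0, 0 < ε → volume (touchingCenters S N S) ≤
      (1 + ε) * ∫⁻ q in S, (∫⁻ t, touchingDensity S N (q, t)) ∂μHE[m] := by
    intro ε hε
    have h := hS.induction_on (p := fun s => ∃ s', MeasurableSet s' ∧ s ⊆ s' ∧
      ∀ A, MeasurableSet A → A ⊆ s' → volume (touchingCenters S N A) ≤
        (1 + ε) * ∫⁻ q in A, (∫⁻ t, touchingDensity S N (q, t)) ∂(μHE[m].restrict S))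
      ⟨∅, MeasurableSet.empty, le_rfl, fun A _ hA => by
        rw [subset_empty_iff.1 hA]; simp [touchingCenters]⟩
      (fun s t hst ⟨s', h1, h2, h3⟩ => ⟨s', h1, hst.trans h2, h3⟩)
      (by
        rintro s t ⟨s', h1, h2, h3⟩ ⟨t', h1', h2', h3'⟩
        refine ⟨s' ∪ t', h1.union h1', union_subset_union h2 h2', fun A hA hAs => ?_⟩
        have hsplit : touchingCenters S N A ⊆
            touchingCenters S N (A ∩ s') ∪ touchingCenters S N (A \ s') := by
          rw [touchingCenters, touchingCenters, touchingCenters, ← image_union, ← inter_union_distrib_left,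
            ← preimage_union, inter_union_sdiff]
        calc _ ≤ volume (touchingCenters S N (A ∩ s')) + volume (touchingCenters S N (A \ s')) :=
              (measure_mono hsplit).trans (measure_union_le _ _)
          _ ≤ _ := add_le_add (h3 _ (hA.inter h1) inter_subset_right)
              (h3' _ (hA.diff h1) (sdiff_subset_iff.2 hAs))
          _ = _ := by rw [← mul_add, lintegral_inter_add_sdiff _ _ h1])
      (fun x hx => by
        obtain ⟨C⟩ := hN.chart x hx
        obtain ⟨U, hU, hxU, h⟩ := C.exists_volume_touchingCenters_le hN hS hm hε
        exact ⟨U, mem_nhdsWithin_of_mem_nhds (hU.mem_nhds hxU), U, hU.measurableSet, le_rfl, h⟩)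
    obtain ⟨s', -, hs', h⟩ := h
    have h2 := h S hS.measurableSet hs'
    rwa [Measure.restrict_restrict hS.measurableSet, inter_self] at h2
  set I := ∫⁻ q in S, (∫⁻ t, touchingDensity S N (q, t)) ∂μHE[m]
  have hlim : Tendsto (fun ε : ℝ≥0 => (1 + (ε : ℝ≥0∞)) * I) (𝓝[>] 0) (𝓝 (1 * I)) := by
    refine ENNReal.Tendsto.mul_const ?_ (Or.inl one_ne_zero)
    have : Continuous fun ε : ℝ≥0 => 1 + (ε : ℝ≥0∞) := by fun_prop
    have h0 := (this.tendsto 0).mono_left (nhdsWithin_le_nhds (s := Ioi 0))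
    simpa using h0
  rw [one_mul] at hlim
  refine ge_of_tendsto hlim ?_
  filter_upwards [self_mem_nhdsWithin] with ε hε using key ε hε

/-- By the nearest point property, every point of `Ω` is the center of a touching ball. -/
theorem IsInterior.volume_le (hΩ : IsInterior S N Ω) (hN : IsExtendedNormal S N)
    (hS : IsCompact S) (hne : S.Nonempty) (hm : m ≠ 0) :
    volume Ω ≤ ∫⁻ q in S, (∫⁻ t, touchingDensity S N (q, t)) ∂μHE[m] := by
  refine (measure_mono fun x hx => ?_).trans (hN.volume_touchingCenters_le hS hm)
  obtain ⟨p, hp, t, ht, rfl, h⟩ := hΩ.exists_nearest hN hS hne hx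
  exact ⟨(p, t), ⟨⟨hp, ht, h⟩, hp⟩, rfl⟩

theorem lintegral_one_sub_mul_pow {h : ℝ} (hh : 0 < h) (m : ℕ) :
    ∫⁻ t in Ioc 0 h⁻¹, ENNReal.ofReal ((1 - t * h) ^ m) = ENNReal.ofReal (h⁻¹ / (m + 1)) := by
  have hd : ∀ t ∈ uIcc 0 h⁻¹, HasDerivAt (fun t => -(1 - t * h) ^ (m + 1) / ((m + 1) * h))
      ((1 - t * h) ^ m) t := by
    intro t _
    have h1 := ((((hasDerivAt_id t).mul_const h).const_sub 1).pow (m + 1)).neg.div_const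
      (((m : ℝ) + 1) * h)
    refine h1.congr_deriv ?_
    have : (m : ℝ) + 1 ≠ 0 := by positivity
    simp
    field_simp
  have hint : IntervalIntegrable (fun t : ℝ => (1 - t * h) ^ m) volume 0 h⁻¹ :=
    Continuous.intervalIntegrable (by fun_prop) _ _
  rw [← ofReal_integral_eq_lintegral_ofReal, ← intervalIntegral.integral_of_le (by positivity),
    intervalIntegral.integral_eq_sub_of_hasDerivAt hd hint]
  · congr 1
    have : (m : ℝ) + 1 ≠ 0 := by positivity
    field_simp
    simp
  · exact (intervalIntegrable_iff_integrableOn_Ioc_of_le (by positivity)).1 hint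
  · filter_upwards [ae_restrict_mem measurableSet_Ioc] with t ht
    have : t * h ≤ 1 := by
      have := mul_le_mul_of_nonneg_right ht.2 hh.le
      rwa [inv_mul_cancel₀ hh.ne'] at this
    exact pow_nonneg (by linarith) _

theorem IsExtendedNormal.touchingDensity_le (hN : IsExtendedNormal S N) (hm : m ≠ 0) (hp : p ∈ S)
    (hh : 0 < extendedMeanCurvature N p) (t : ℝ) : touchingDensity S N (p, t) ≤
      (Ioc 0 (extendedMeanCurvature N p)⁻¹).indicator
        (fun t => ENNReal.ofReal ((1 - t * extendedMeanCurvature N p) ^ m)) t := by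
  by_cases ht : (p, t) ∈ touchingSet S N
  · have h1 := (hN.abs_det_parallelDerivative_le hm hp ht.2.1.le ht.2.2).1
    rw [touchingDensity, indicator_of_mem ht, indicator_of_mem]
    exact ⟨ht.2.1, by rwa [← one_div, le_div_iff₀ hh]⟩
  · rw [touchingDensity, indicator_of_notMem ht]
    exact zero_le

/-- The equality case of the Heintze-Karcher inequality: there is an interior touching ball of
radius `1 / H` at each point. -/
theorem IsInterior.touching_of_integral_le (hΩ : IsInterior S N Ω) (hN : IsExtendedNormal S N)
    (hS : IsCompact S) (hne : S.Nonempty) (hm : m ≠ 0)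
    (hh : ∀ p ∈ S, 0 < extendedMeanCurvature N p)
    {φ : EuclideanSpace ℝ (Fin (m + 1)) → ℝ} (hφ : Continuous φ)
    (hφS : ∀ p ∈ S, φ p * extendedMeanCurvature N p = 1)
    (hint : ∫ x in S, φ x ∂μHE[m] ≤ (m + 1) * volume.real Ω) (hp : p ∈ S) :
    ∀ q ∈ S, φ p ≤ ‖q - p + φ p • N p‖ := by
  have hfin := hN.isFiniteMeasure hS
  have hNc := hN.contDiff.continuous
  have hφinv : ∀ p ∈ S, φ p = (extendedMeanCurvature N p)⁻¹ := fun p hp =>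
    eq_inv_of_mul_eq_one_left (hφS p hp)
  have hφpos : ∀ p ∈ S, 0 < φ p := fun p hp => by rw [hφinv p hp]; exact inv_pos.2 (hh p hp)
  have hfull : ∀ p ∈ S, ∫⁻ t in Ioc 0 (φ p),
      ENNReal.ofReal ((1 - t * extendedMeanCurvature N p) ^ m) = ENNReal.ofReal (φ p / (m + 1)) := by
    intro p hp
    rw [hφinv p hp]
    exact lintegral_one_sub_mul_pow (hh p hp) m
  have hle : ∀ p ∈ S, ∀ t, touchingDensity S N (p, t) ≤ (Ioc 0 (φ p)).indicator
      (fun t => ENNReal.ofReal ((1 - t * extendedMeanCurvature N p) ^ m)) t := by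
    intro p hp
    rw [hφinv p hp]
    exact hN.touchingDensity_le hm hp (hh p hp)
  have hle' : ∀ p ∈ S, ∫⁻ t, touchingDensity S N (p, t) ≤ ENNReal.ofReal (φ p / (m + 1)) := by
    intro p hp
    rw [← hfull p hp, ← lintegral_indicator measurableSet_Ioc]
    exact lintegral_mono (hle p hp)
  have hI : Integrable (fun p => φ p / (m + 1)) (μHE[m].restrict S) :=
    hN.integrable hS (by fun_prop)
  have htot : ∫⁻ p in S, ENNReal.ofReal (φ p / (m + 1)) ∂μHE[m] ≤ volume Ω := by
    rw [← ofReal_integral_eq_lintegral_ofReal hI, integral_div]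
    · have hv : volume Ω ≠ ⊤ := hΩ.isBounded.measure_lt_top.ne
      rw [← ENNReal.ofReal_toReal hv]
      refine ENNReal.ofReal_le_ofReal ?_
      rw [div_le_iff₀ (by positivity), mul_comm]
      exact hint
    · filter_upwards [ae_restrict_mem hS.measurableSet] with p hp
      have := hφpos p hp
      simp only [Pi.zero_apply]
      positivity
  -- The fibre integrals are at most `φ / (m + 1)`, while their total is at least the volume, which
  -- by hypothesis is at least the total of the bound. Finiteness forces equality almost everywhere.
  have hae := ae_eq_of_ae_le_of_lintegral_le
    (f := fun p => ∫⁻ t, touchingDensity S N (p, t)) (g := fun p => ENNReal.ofReal (φ p / (m + 1)))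
    (μ := μHE[m].restrict S)
    (by filter_upwards [ae_restrict_mem hS.measurableSet] with p hp using hle' p hp)
    (by
      refine ne_top_of_le_ne_top ?_ ((setLIntegral_mono' hS.measurableSet hle').trans htot)
      exact hΩ.isBounded.measure_lt_top.ne)
    (by fun_prop) (htot.trans (hΩ.volume_le hN hS hne hm))
  have hfibre : ∀ p ∈ S, ∫⁻ t, touchingDensity S N (p, t) = ENNReal.ofReal (φ p / (m + 1)) →
      ∀ q ∈ S, φ p ≤ ‖q - p + φ p • N p‖ := by
    intro p hp heq
    have h1 := ae_eq_of_ae_le_of_lintegral_le (μ := volume) (ae_of_all _ (hle p hp))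
      (by rw [heq]; exact ENNReal.ofReal_ne_top)
      (Measurable.aemeasurable (Measurable.indicator (by fun_prop) measurableSet_Ioc))
      (by rw [heq, lintegral_indicator measurableSet_Ioc, hfull p hp])
    set T := {t : ℝ | ∀ q ∈ S, t ≤ ‖q - p + t • N p‖} with hT
    have hTc : IsClosed T := by
      rw [hT]
      simp only [ofPred_forall]
      exact isClosed_iInter fun q => isClosed_iInter fun _ => isClosed_le (by fun_prop) (by fun_prop)
    -- Where touching fails, the density is 0 although its bound is positive. Such radii form an
    -- open null set, hence there are none.
    have h2 : Ioo 0 (φ p) ∩ Tᶜ = ∅ := by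
      refine (isOpen_Ioo.inter hTc.isOpen_compl).eq_empty_of_measure_zero (μ := volume) ?_
      rw [measure_eq_zero_iff_ae_notMem]
      filter_upwards [h1] with t ht hmem
      have h3 : (p, t) ∉ touchingSet S N := fun h => hmem.2 h.2.2
      rw [touchingDensity, indicator_of_notMem h3, indicator_of_mem (Ioo_subset_Ioc_self hmem.1)] at ht
      have h4 : t * extendedMeanCurvature N p < 1 := by
        rw [← hφS p hp]
        exact mul_lt_mul_of_pos_right hmem.1.2 (hh p hp)
      have h5 : 0 < (1 - t * extendedMeanCurvature N p) ^ m := pow_pos (by linarith) _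
      exact absurd ht.symm (ENNReal.ofReal_pos.2 h5).ne'
    have h3 : Ioo 0 (φ p) ⊆ T := by
      rwa [← disjoint_iff_inter_eq_empty, disjoint_compl_right_iff_subset] at h2
    have h4 := closure_minimal h3 hTc
    rw [closure_Ioo (hφpos p hp).ne] at h4
    exact h4 ⟨(hφpos p hp).le, le_rfl⟩
  by_contra hcon
  -- Failure is an open condition on `p`, and nonempty relatively open subsets of `S` have positive
  -- measure.
  set Q := {p | ∀ q ∈ S, φ p ≤ ‖q - p + φ p • N p‖} with hQ
  have hQc : IsClosed Q := by
    rw [hQ]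
    simp only [ofPred_forall]
    exact isClosed_iInter fun q => isClosed_iInter fun _ => isClosed_le (by fun_prop) (by fun_prop)
  refine (hN.measure_pos hp hQc.isOpen_compl hcon).ne' ?_
  rw [measure_eq_zero_iff_ae_notMem]
  filter_upwards [hae, ae_restrict_mem hS.measurableSet] with x hx hxS hmem
  exact hmem (hfibre x hxS hx)

end

/-! ### Rigidity: touching balls of radius 1/H force a sphere -/

section

variable {m : ℕ} {S Ω : Set (EuclideanSpace ℝ (Fin (m + 1)))}
  {N : EuclideanSpace ℝ (Fin (m + 1)) → EuclideanSpace ℝ (Fin (m + 1))}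
  {p v : EuclideanSpace ℝ (Fin (m + 1))}

/-- A function whose tangential derivatives vanish is constant on a connected hypersurface. -/
theorem IsExtendedNormal.eq_of_forall_fderiv_eq_zero (hN : IsExtendedNormal S N)
    (hS : IsPreconnected S) {F : Type*} [NormedAddCommGroup F] [NormedSpace ℝ F]
    {G : EuclideanSpace ℝ (Fin (m + 1)) → F} (hG : Differentiable ℝ G)
    (hG0 : ∀ q ∈ S, ∀ w ∈ tangentSpace S q, fderiv ℝ G q w = 0) {p q} (hp : p ∈ S) (hq : q ∈ S) :
    G p = G q := by
  have hloc : ∀ p ∈ S, ∀ᶠ x in 𝓝[S] p, G x = G p := by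
    intro p hp
    obtain ⟨C⟩ := hN.chart p hp
    obtain ⟨δ, hδ, hdom⟩ := Metric.eventually_nhds_iff_ball.1 C.eventually_graph_mem
    have hd : Differentiable ℝ (G ∘ C.graph) := hG.comp (C.contDiff_graph.differentiable (by simp))
    have hzero : EqOn (fderiv ℝ (G ∘ C.graph)) 0 (ball 0 δ) := by
      intro y hy
      rw [fderiv_comp y (hG _) (C.contDiff_graph.differentiable (by simp) y)]
      ext1 w
      exact hG0 _ (C.graph_mem (hdom y hy)) _ (C.fderiv_graph_mem_tangentSpace (hdom y hy) w)
    have hpp : C.proj p = 0 := by simp [GraphChart.proj]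
    have hev : ∀ᶠ x in 𝓝 p, C.proj x ∈ ball 0 δ := by
      refine C.contDiff_proj.continuous.continuousAt.eventually (isOpen_ball.mem_nhds ?_)
      rw [hpp]
      exact mem_ball_self hδ
    filter_upwards [self_mem_nhdsWithin, mem_nhdsWithin_of_mem_nhds hev,
      mem_nhdsWithin_of_mem_nhds (C.isOpen_domain.mem_nhds C.mem_domain)] with x hxS hx hxd
    have h1 := isOpen_ball.is_const_of_fderiv_eq_zero (convex_ball _ _).isPreconnected
      hd.differentiableOn hzero hx (mem_ball_self hδ)
    simpa [C.graph_proj hxd hxS, C.graph_zero] using h1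
  have : PreconnectedSpace S := Subtype.preconnectedSpace hS
  have h2 : IsLocallyConstant fun x : S => G x := by
    rw [IsLocallyConstant.iff_eventually_eq]
    intro x
    rw [eventually_nhds_subtype_iff S x fun y => G y = G x]
    exact hloc x x.2
  exact h2.apply_eq_of_preconnectedSpace ⟨p, hp⟩ ⟨q, hq⟩

theorem eq_zero_of_isSymmetric_of_trace_eq_zero {F : Type*} [NormedAddCommGroup F]
    [InnerProductSpace ℝ F] [FiniteDimensional ℝ F] {B : F →ₗ[ℝ] F} (hB : B.IsSymmetric)
    (hpos : ∀ w, 0 ≤ ⟪B w, w⟫) (htr : LinearMap.trace ℝ F B = 0) : B = 0 := by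
  have hk : Module.finrank ℝ F = Module.finrank ℝ F := rfl
  have hval : ∀ i, 0 ≤ hB.eigenvalues hk i := by
    intro i
    have h := hpos (hB.eigenvectorBasis hk i)
    rw [hB.apply_eigenvectorBasis, real_inner_smul_left, real_inner_self_eq_norm_sq,
      (hB.eigenvectorBasis hk).norm_eq_one] at h
    simpa using h
  have hsum := hB.trace_eq_sum_eigenvalues hk
  rw [htr] at hsum
  have hz := (Finset.sum_eq_zero_iff_of_nonneg fun i _ => hval i).1 (by simpa using hsum.symm)
  refine (hB.eigenvectorBasis hk).toBasis.ext fun i => ?_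
  rw [OrthonormalBasis.coe_toBasis, hB.apply_eigenvectorBasis, hz i (Finset.mem_univ i)]
  simp

/-- A vector-valued second order l'Hôpital rule, from the mean value inequality for `k u - u ^ 2 •
c` on `[0, s]`. -/
theorem tendsto_div_sq_of_hasDerivAt {F : Type*} [NormedAddCommGroup F] [NormedSpace ℝ F]
    {k k' : ℝ → F} {c : F} (h0 : k 0 = 0) (h0' : k' 0 = 0)
    (hd : ∀ᶠ s in 𝓝 0, HasDerivAt k (k' s) s)
    (hL : Tendsto (fun s => s⁻¹ • k' s) (𝓝[>] 0) (𝓝 ((2 : ℝ) • c))) :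
    Tendsto (fun s => (s ^ 2)⁻¹ • k s) (𝓝[>] 0) (𝓝 c) := by
  rw [Metric.tendsto_nhds]
  intro ε hε
  have h1 : ∀ᶠ s in 𝓝[>] 0, dist (s⁻¹ • k' s) ((2 : ℝ) • c) < ε / 2 :=
    Metric.tendsto_nhds.1 hL _ (half_pos hε)
  obtain ⟨b, hb0, hb⟩ := mem_nhdsGT_iff_exists_Ioo_subset.1
    (h1.and (mem_nhdsWithin_of_mem_nhds hd))
  filter_upwards [Ioo_mem_nhdsGT hb0] with s hs
  have hder : ∀ u ∈ Icc 0 s,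
      HasDerivWithinAt (fun u => k u - u ^ 2 • c) (k' u - (2 * u) • c) (Icc 0 s) u := by
    intro u hu
    have hku : HasDerivAt k (k' u) u := by
      rcases hu.1.eq_or_lt with rfl | hu0
      · exact hd.self_of_nhds
      · exact (hb ⟨hu0, hu.2.trans_lt hs.2⟩).2
    have h2 : HasDerivAt (fun u : ℝ => u ^ 2 • c) ((2 * u) • c) u := by
      simpa using (hasDerivAt_pow 2 u).smul_const c
    exact (hku.sub h2).hasDerivWithinAt
  have hbound : ∀ u ∈ Ico 0 s, ‖k' u - (2 * u) • c‖ ≤ ε / 2 * s := by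
    intro u hu
    rcases hu.1.eq_or_lt with rfl | hu0
    · simp only [h0', mul_zero, zero_smul, sub_zero, norm_zero]
      exact mul_nonneg (half_pos hε).le hs.1.le
    · have h2 := (hb ⟨hu0, hu.2.trans hs.2⟩).1
      rw [dist_eq_norm] at h2
      have h3 : k' u - (2 * u) • c = u • (u⁻¹ • k' u - (2 : ℝ) • c) := by
        rw [smul_sub, smul_inv_smul₀ hu0.ne', smul_smul, mul_comm]
      rw [h3, norm_smul, Real.norm_of_nonneg hu0.le, mul_comm]
      exact mul_le_mul h2.le hu.2.le hu0.le (half_pos hε).le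
  have h4 := norm_image_sub_le_of_norm_deriv_le_segment' hder hbound s ⟨hs.1.le, le_rfl⟩
  simp only [h0, ne_eq, OfNat.ofNat_ne_zero, not_false_eq_true, zero_pow, zero_smul, sub_zero] at h4
  have hs2 : 0 < s ^ 2 := pow_pos hs.1 2
  have h5 : (s ^ 2)⁻¹ • k s - c = (s ^ 2)⁻¹ • (k s - s ^ 2 • c) := by
    rw [smul_sub, inv_smul_smul₀ hs2.ne']
  rw [dist_eq_norm, h5, norm_smul, norm_inv, Real.norm_of_nonneg hs2.le, inv_mul_lt_iff₀ hs2]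
  nlinarith

namespace IsExtendedNormal

/-- If interior balls of radius equal to the reciprocal of the mean curvature touch everywhere,
then the hypersurface is umbilic. -/
theorem fderiv_eq_smul_of_touching (hN : IsExtendedNormal S N) (hm : m ≠ 0) (hp : p ∈ S) {r : ℝ}
    (hr : 0 < r) (hrh : r * extendedMeanCurvature N p = 1)
    (hball : ∀ q ∈ S, r ≤ ‖q - p + r • N p‖) {w} (hw : w ∈ tangentSpace S p) :
    fderiv ℝ N p w = extendedMeanCurvature N p • w := by
  obtain ⟨B, hsymm, hpos, hBapp, htr⟩ := hN.exists_touching_operator hm hp hr.le hball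
  -- At the radius `r = 1 / H` the semidefinite operator `B` has trace zero, so it vanishes.
  rw [hrh, sub_self, mul_zero] at htr
  have h1 := hBapp ⟨w, hw⟩
  rw [eq_zero_of_isSymmetric_of_trace_eq_zero hsymm hpos htr] at h1
  simp only [LinearMap.zero_apply, ZeroMemClass.coe_zero] at h1
  have h2 : w = r • fderiv ℝ N p w := (sub_eq_zero.1 h1.symm)
  conv_rhs => rw [h2]
  rw [smul_smul, mul_comm, hrh, one_smul]

/-- Umbilicity kills the second order term of the touching function. Its derivative along a curve
with velocity `w` is then asymptotic to `-r dH(w) ‖w‖² s²`, and the function starts at 0 and stays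
nonnegative. This also covers `m = 1`, where umbilicity is automatic. -/
theorem fderiv_extendedMeanCurvature_nonpos_of_touching (hN : IsExtendedNormal S N) (hp : p ∈ S)
    {r : ℝ} (hr : 0 < r) (hrh : r * extendedMeanCurvature N p = 1)
    (hball : ∀ q ∈ S, r ≤ ‖q - p + r • N p‖)
    (humb : ∀ q ∈ S, ∀ w ∈ tangentSpace S q, fderiv ℝ N q w = extendedMeanCurvature N q • w)
    {w} (hw : w ∈ tangentSpace S p) (hw0 : w ≠ 0) :
    fderiv ℝ (extendedMeanCurvature N) p w ≤ 0 := by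
  set h := extendedMeanCurvature N
  obtain ⟨γ, hγ, hγ0, hγ', hγS⟩ := (hN.chart p hp).some.exists_curve hw
  obtain ⟨h1, h2⟩ := hN.touching_function hp hr.le hball hγ hγS
  have hdγ : ∀ s, HasDerivAt γ (deriv γ s) s := fun s => (hγ.differentiable (by simp) s).hasDerivAt
  have hγ'c : Tendsto (deriv γ) (𝓝[>] 0) (𝓝 w) := by
    have : Continuous (deriv γ) := hγ.continuous_deriv (by simp)
    rw [← hγ']
    exact (this.tendsto 0).mono_left nhdsWithin_le_nhds
  set a := fderiv ℝ h p w
  set k : ℝ → EuclideanSpace ℝ (Fin (m + 1)) := fun s => N (γ s) - N p - h p • (γ s - p)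
  have hk : Tendsto (fun s => (s ^ 2)⁻¹ • k s) (𝓝[>] 0) (𝓝 ((2 : ℝ)⁻¹ • a • w)) := by
    refine tendsto_div_sq_of_hasDerivAt (k' := fun s => (h (γ s) - h p) • deriv γ s)
      (by simp [k, hγ0]) (by simp [hγ0]) ?_ ?_
    · filter_upwards [hγS.eventually_nhds] with s hs
      have hT := mem_tangentSpace_of_hasDerivAt (hdγ s) hs
      have h3 := (hN.contDiff.differentiable (by simp) (γ s)).hasFDerivAt.comp_hasDerivAt s (hdγ s)
      rw [humb _ hs.self_of_nhds _ hT] at h3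
      have h4 := (h3.sub_const (N p)).sub (((hdγ s).sub_const p).const_smul (h p))
      rw [← sub_smul] at h4
      exact h4
    · have hdh : HasFDerivAt h (fderiv ℝ h p) (γ 0) := by
        rw [hγ0]
        exact ((contDiff_extendedMeanCurvature hN.contDiff).differentiable (by simp) p).hasFDerivAt
      have h3 := (hdh.comp_hasDerivAt 0 (hdγ 0)).tendsto_slope_zero_right
      simp only [Function.comp_apply, zero_add, hγ0, hγ'] at h3
      have h4 := h3.smul hγ'c
      rw [smul_inv_smul₀ two_ne_zero]
      refine h4.congr fun s => ?_
      rw [smul_eq_mul, mul_smul]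
  have hlim := (hk.inner hγ'c).const_mul (-2 * r)
  have hfin : 0 ≤ -2 * r * ⟪(2 : ℝ)⁻¹ • a • w, w⟫ := by
    refine nonneg_of_tendsto_deriv_div_pow (k := 2) ?_ h2
      (mem_nhdsWithin_of_mem_nhds h1) (hlim.congr fun s => ?_)
    · simp [hγ0]
    · have h3 : γ s - p - r • (N (γ s) - N p) = -r • k s := by
        simp only [k]
        rw [smul_sub (-r) (N (γ s) - N p), smul_smul, neg_mul, hrh]
        module
      rw [h3, real_inner_smul_left, real_inner_smul_left]
      ring
  rw [real_inner_smul_left, real_inner_smul_left, real_inner_self_eq_norm_sq] at hfin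
  have h5 : 0 < r * ‖w‖ ^ 2 := mul_pos hr (by positivity)
  by_contra! hcon
  nlinarith [mul_pos hcon h5]

/-- If interior balls of radius equal to the reciprocal of the mean curvature touch everywhere,
then the hypersurface is contained in a sphere. -/
theorem exists_subset_sphere_of_touching (hN : IsExtendedNormal S N) (hm : m ≠ 0)
    (hS : IsConnected S) {φ : EuclideanSpace ℝ (Fin (m + 1)) → ℝ} (hφpos : ∀ p ∈ S, 0 < φ p)
    (hφS : ∀ p ∈ S, φ p * extendedMeanCurvature N p = 1)
    (hball : ∀ p ∈ S, ∀ q ∈ S, φ p ≤ ‖q - p + φ p • N p‖) :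
    ∃ (c : EuclideanSpace ℝ (Fin (m + 1))) (r : ℝ), 0 < r ∧ ∀ q ∈ S, q = c + r • N q := by
  set h := extendedMeanCurvature N
  have humb : ∀ q ∈ S, ∀ w ∈ tangentSpace S q, fderiv ℝ N q w = h q • w := fun q hq w hw =>
    hN.fderiv_eq_smul_of_touching hm hq (hφpos q hq) (hφS q hq) (hball q hq) hw
  have hnonpos : ∀ q ∈ S, ∀ w ∈ tangentSpace S q, fderiv ℝ h q w ≤ 0 := by
    intro q hq w hw
    by_cases hw0 : w = 0
    · rw [hw0, map_zero]
    · exact hN.fderiv_extendedMeanCurvature_nonpos_of_touching hq (hφpos q hq) (hφS q hq)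
        (hball q hq) humb hw hw0
  -- The inequality holds for both `w` and `-w`.
  have hzero : ∀ q ∈ S, ∀ w ∈ tangentSpace S q, fderiv ℝ h q w = 0 := fun q hq w hw =>
    le_antisymm (hnonpos q hq w hw) (by
      have := hnonpos q hq (-w) (neg_mem hw)
      rw [map_neg] at this
      linarith)
  obtain ⟨p, hp⟩ := hS.nonempty
  have hconst : ∀ q ∈ S, h q = h p := fun q hq => hN.eq_of_forall_fderiv_eq_zero
    hS.isPreconnected ((contDiff_extendedMeanCurvature hN.contDiff).differentiable (by simp))
    hzero hq hp
  have hNd : Differentiable ℝ N := hN.contDiff.differentiable (by simp)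
  -- The center of the touching ball does not move: the tangential derivative of `x - φ p • N x` is
  -- `1 - φ p * H = 0` times the identity.
  have hcenter : ∀ q ∈ S, q - φ p • N q = p - φ p • N p := fun q hq =>
    hN.eq_of_forall_fderiv_eq_zero (G := fun x => x - φ p • N x) hS.isPreconnected
      (by fun_prop) (fun x hx w hw => by
        have hd : HasFDerivAt (fun x => x - φ p • N x) (.id ℝ _ - φ p • fderiv ℝ N x) x :=
          (hasFDerivAt_id x).sub ((hNd x).hasFDerivAt.const_smul (φ p))
        rw [hd.fderiv, sub_apply, smul_apply, humb x hx w hw, hconst x hx, smul_smul, hφS p hp]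
        simp) hq hp
  refine ⟨p - φ p • N p, φ p, hφpos p hp, fun q hq => ?_⟩
  rw [← hcenter q hq]
  module

end IsExtendedNormal

/-- A hypersurface contained in a sphere with a bounded interior is the whole sphere. -/
theorem IsInterior.eq_sphere (hΩ : IsInterior S N Ω) {c : EuclideanSpace ℝ (Fin (m + 1))} {r : ℝ}
    (hr : 0 < r) (hne : S.Nonempty) (hN : ∀ p ∈ S, ‖N p‖ = 1) (hS : ∀ p ∈ S, p = c + r • N p) :
    S = sphere c r := by
  have hsub : S ⊆ sphere c r := by
    intro p hp
    rw [mem_sphere, dist_eq_norm]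
    conv_lhs => rw [hS p hp]
    rw [add_sub_cancel_left, norm_smul, hN p hp, mul_one, Real.norm_of_nonneg hr.le]
  refine hsub.antisymm fun q hq => ?_
  by_contra hqS
  obtain ⟨p, hp⟩ := hne
  obtain ⟨t, hxΩ, ht⟩ := ((hΩ.inward p hp).and (Ioo_mem_nhdsGT hr)).exists
  set x := p - t • N p
  have hx : x ∈ ball c r := by
    have h1 : x - c = (r - t) • N p := by
      rw [sub_right_comm, sub_eq_of_eq_add' (hS p hp), sub_smul]
    rw [mem_ball, dist_eq_norm, h1, norm_smul, hN p hp, mul_one, Real.norm_of_nonneg] <;>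
      linarith [ht.1, ht.2]
  set ray := (fun s : ℝ => c + s • (q - c)) '' Ici 1
  have hqray : q ∈ ray := ⟨1, self_mem_Ici, by simp⟩
  have hqc : ‖q - c‖ = r := by rwa [mem_sphere, dist_eq_norm] at hq
  -- A path from a point of `Ω` through the missing point `q` and out to infinity meets the sphere
  -- only at `q`, hence avoids `S` and stays in `Ω`, which is bounded.
  have hT : IsPreconnected (segment ℝ x q ∪ ray) :=
    IsPreconnected.union q (right_mem_segment ℝ x q) hqray (convex_segment x q).isPreconnected
      (isPreconnected_Ici.image _ (by fun_prop))
  have hTS : segment ℝ x q ∪ ray ⊆ Sᶜ := by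
    rintro y (hy | hy) hyS
    · obtain ⟨a, b, ha, hb, hab, rfl⟩ := hy
      have h1 := hsub hyS
      rcases ha.eq_or_lt with rfl | ha0
      · rw [zero_add] at hab
        rw [hab] at hyS
        exact hqS (by simpa using hyS)
      · rw [mem_sphere, dist_eq_norm] at h1
        rw [mem_ball, dist_eq_norm] at hx
        have h2 : a • x + b • q - c = a • (x - c) + b • (q - c) := by
          have : c = (a + b) • c := by rw [hab, one_smul]
          conv_lhs => rw [this]
          module
        have h3 := norm_add_le (a • (x - c)) (b • (q - c))
        rw [← h2, h1, norm_smul, norm_smul, hqc, Real.norm_of_nonneg ha, Real.norm_of_nonneg hb] at h3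
        nlinarith
    · obtain ⟨s, hs, rfl⟩ := hy
      have h1 := hsub hyS
      rw [mem_sphere, dist_eq_norm, add_sub_cancel_left, norm_smul, hqc,
        Real.norm_of_nonneg (zero_le_one.trans hs)] at h1
      have h2 : s = 1 := by
        have : s * r = 1 * r := by rw [h1, one_mul]
        exact mul_right_cancel₀ hr.ne' this
      rw [h2] at hyS
      exact hqS (by simpa using hyS)
  have hTΩ := hΩ.subset_of_isPreconnected _ hT hTS ⟨x, Or.inl (left_mem_segment ℝ x q), hxΩ⟩
  obtain ⟨R, hR⟩ := (isBounded_iff_subset_closedBall c).1 hΩ.isBounded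
  -- This point of the ray is at distance `r + |R|` from `c`, more than `R`.
  have hmem : c + (1 + |R| / r) • (q - c) ∈ closedBall c R :=
    hR (hTΩ (Or.inr ⟨1 + |R| / r, by rw [mem_Ici]; linarith [show 0 ≤ |R| / r by positivity], rfl⟩))
  rw [mem_closedBall, dist_eq_norm, add_sub_cancel_left, norm_smul, hqc,
    Real.norm_of_nonneg (by positivity), add_mul, div_mul_cancel₀ _ hr.ne'] at hmem
  linarith [le_abs_self R]

end

/-! ### Spheres have constant mean curvature; conclusion -/

section

variable {m : ℕ} {S Ω : Set (EuclideanSpace ℝ (Fin (m + 1)))}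
  {N : EuclideanSpace ℝ (Fin (m + 1)) → EuclideanSpace ℝ (Fin (m + 1))}
  {p v : EuclideanSpace ℝ (Fin (m + 1))}

namespace IsExtendedNormal

/-- The mean curvature of a round sphere is constant. -/
theorem exists_extendedMeanCurvature_eq_of_subset_sphere (hN : IsExtendedNormal S N) (hm : m ≠ 0)
    (hS : IsPreconnected S) {c : EuclideanSpace ℝ (Fin (m + 1))} {r : ℝ} (hr : 0 < r)
    (hsub : S ⊆ sphere c r) : ∃ H : ℝ, ∀ p ∈ S, extendedMeanCurvature N p = H := by
  have hNd : Differentiable ℝ N := hN.contDiff.differentiable (by simp)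
  have hperp : ∀ p ∈ S, ∀ w ∈ tangentSpace S p, ⟪p - c, w⟫ = 0 := by
    intro p hp w hw
    have hd : HasFDerivAt (fun x => x - c) (.id ℝ _) p := (hasFDerivAt_id p).sub_const c
    have h1 := fderiv_eq_zero_of_forall_eq hp (hd.inner ℝ hd) (c := r ^ 2)
      (eventually_mem_nhdsWithin.mono fun x hx => by
        have := hsub hx
        rw [mem_sphere, dist_eq_norm] at this
        rw [real_inner_self_eq_norm_sq, this]) hw
    simp only [ContinuousLinearMap.comp_apply, ContinuousLinearMap.prod_apply,
      fderivInnerCLM_apply, ContinuousLinearMap.id_apply] at h1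
    rw [real_inner_comm] at h1
    linarith [real_inner_comm (p - c) w]
  -- On `S` this equals `r` or `-r`. The sign is not needed, only that it is the same throughout,
  -- which follows from connectedness.
  set g : EuclideanSpace ℝ (Fin (m + 1)) → ℝ := fun x => ⟪N x, x - c⟫
  have hnormal : ∀ p ∈ S, p - c = g p • N p := by
    intro p hp
    have hT : p - c - g p • N p ∈ tangentSpace S p := by
      rw [hN.mem_tangentSpace_iff hp, inner_sub_right, real_inner_smul_right,
        real_inner_self_eq_norm_sq, hN.norm_eq_one p hp]
      simp [g]
    have h1 : ⟪p - c - g p • N p, p - c - g p • N p⟫ = 0 := by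
      rw [inner_sub_left, hperp p hp _ hT, real_inner_smul_left,
        (hN.mem_tangentSpace_iff hp).1 hT]
      simp
    exact sub_eq_zero.1 (inner_self_eq_zero.1 h1)
  have hg0 : ∀ p ∈ S, g p ≠ 0 := by
    intro p hp h0
    have h1 := hsub hp
    rw [mem_sphere, dist_eq_norm, hnormal p hp, h0] at h1
    simp at h1
    exact hr.ne h1
  have hgd : ∀ x, HasFDerivAt g ((fderivInnerCLM ℝ (N x, x - c)).comp
      ((fderiv ℝ N x).prod (.id ℝ _))) x := fun x =>
    (hNd x).hasFDerivAt.inner ℝ ((hasFDerivAt_id x).sub_const c)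
  rcases S.eq_empty_or_nonempty with rfl | ⟨p, hp⟩
  · exact ⟨0, by simp⟩
  have hgconst : ∀ q ∈ S, g q = g p := fun q hq =>
    hN.eq_of_forall_fderiv_eq_zero hS (fun x => (hgd x).differentiableAt) (fun x hx w hw => by
      rw [(hgd x).fderiv]
      simp only [ContinuousLinearMap.comp_apply, ContinuousLinearMap.prod_apply,
        fderivInnerCLM_apply, ContinuousLinearMap.id_apply]
      rw [(hN.mem_tangentSpace_iff hx).1 hw, hnormal x hx, real_inner_smul_right, real_inner_comm,
        hN.inner_fderiv hx hw]
      simp) hq hp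
  refine ⟨(g p)⁻¹, fun q hq => ?_⟩
  have hshape : shapeOperator S N q = (g p)⁻¹ • LinearMap.id := by
    apply LinearMap.ext
    intro w
    apply Subtype.ext
    rw [hN.coe_shapeOperator (fun _ _ => rfl) hq]
    have hd : HasFDerivAt (fun x => x - c - g p • N x) (.id ℝ _ - g p • fderiv ℝ N q) q :=
      ((hasFDerivAt_id q).sub_const c).sub ((hNd q).hasFDerivAt.const_smul (g p))
    have h1 := fderiv_eq_zero_of_forall_eq hq hd (c := 0)
      (eventually_mem_nhdsWithin.mono fun x hx => by
        rw [hnormal x hx, hgconst x hx, sub_self]) w.2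
    rw [sub_apply, smul_apply, ContinuousLinearMap.id_apply, sub_eq_zero] at h1
    have h2 : (g p)⁻¹ • (w : EuclideanSpace ℝ (Fin (m + 1))) = fderiv ℝ N q w := by
      conv_lhs => rw [h1]
      rw [inv_smul_smul₀ (hg0 p hp)]
    rw [← h2]
    rfl
  have h1 := hN.trace_shapeOperator (fun _ _ => rfl) hq hm
  rw [hshape, map_smul, LinearMap.trace_id, hN.finrank_tangentSpace hq, smul_eq_mul, mul_comm] at h1
  exact (mul_left_cancel₀ (by exact_mod_cast hm) h1).symm

end IsExtendedNormal

theorem IsClosedEmbeddedHypersurface.isRoundSphere_iff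
    (hS : IsClosedEmbeddedHypersurface S) (hm : m ≠ 0)
    {ν : EuclideanSpace ℝ (Fin (m + 1)) → EuclideanSpace ℝ (Fin (m + 1))}
    (hν : IsOutwardUnitNormal S ν) (hH : IsMeanConvex S ν) :
    IsRoundSphere S ↔
      ∫ p in S, (1 / meanCurvature S ν p ^ 2) *
        ⟪tangentialGradient S (meanCurvature S ν) p, p⟫ ∂μHE[m] ≤ 0 := by
  obtain ⟨N, hN, hνN⟩ := exists_isExtendedNormal hS.smooth hS.isCompact.isClosed hν.continuousOn
    hν.norm_eq_one hν.normal
  have hmean : EqOn (meanCurvature S ν) (extendedMeanCurvature N) S := fun p hp =>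
    hN.meanCurvature_eq hνN hp hm
  have hsmooth := contDiff_extendedMeanCurvature hN.contDiff
  constructor
  · rintro ⟨c, r, hr, hSc⟩
    obtain ⟨H, hconst⟩ := hN.exists_extendedMeanCurvature_eq_of_subset_sphere hm
      hS.isConnected.isPreconnected hr hSc.subset
    have h1 : ∀ p ∈ S, (1 / meanCurvature S ν p ^ 2) *
        ⟪tangentialGradient S (meanCurvature S ν) p, p⟫ = 0 := by
      intro p hp
      -- The constant `H` serves as the extension of the mean curvature, so its derivative is zero.
      rw [hN.inner_tangentialGradient (G := fun _ => H)
        (fun q hq => (hmean hq).trans (hconst q hq)) (differentiableAt_const H) hp]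
      simp
    rw [setIntegral_congr_fun hS.isCompact.measurableSet h1]
    simp
  · intro hint
    have hΩ := hν.isInterior hνN hS.isCompact
    have hpos : ∀ p ∈ S, 0 < extendedMeanCurvature N p := fun p hp => hmean hp ▸ hH p hp
    obtain ⟨φ, hφ, hφS⟩ := exists_contDiff_reciprocal hS.isCompact.isClosed hsmooth
      fun p hp => (hpos p hp).ne'
    -- The hypothesis becomes the reverse Heintze-Karcher inequality, as `m > 0`.
    rw [hΩ.integral_eq hN hS.isCompact hm hνN hφ hφS] at hint
    have hle : ∫ x in S, φ x ∂μHE[m] ≤ (m + 1) * volume.real (enclosedRegion S) := by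
      have hm' : (0 : ℝ) < m := by positivity
      linarith [nonpos_of_mul_nonpos_right hint hm']
    have hφpos : ∀ p ∈ S, 0 < φ p := fun p hp =>
      pos_of_mul_pos_left ((hφS p hp).symm ▸ one_pos) (hpos p hp).le
    obtain ⟨c, r, hr, hcr⟩ := hN.exists_subset_sphere_of_touching hm hS.isConnected hφpos hφS
      fun p hp => hΩ.touching_of_integral_le hN hS.isCompact hS.isConnected.nonempty hm hpos
        hφ.continuous hφS hle hp
    exact ⟨c, r, hr, hΩ.eq_sphere hr hS.isConnected.nonempty hN.norm_eq_one hcr⟩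

end

end EuclideanHypersurface

end

theorem theorem1p4 (n : ℕ) (hn : 2 ≤ n) (S : Set (EuclideanSpace ℝ (Fin n)))
    (hS : EuclideanHypersurface.IsClosedEmbeddedHypersurface S)
    (ν : EuclideanSpace ℝ (Fin n) → EuclideanSpace ℝ (Fin n))
    (hν : EuclideanHypersurface.IsOutwardUnitNormal S ν)
    (hH : EuclideanHypersurface.IsMeanConvex S ν) :
    EuclideanHypersurface.IsRoundSphere S ↔
      ∫ p in S, (1 / EuclideanHypersurface.meanCurvature S ν p ^ 2) *
        ⟪EuclideanHypersurface.tangentialGradient S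
          (EuclideanHypersurface.meanCurvature S ν) p, p⟫ ∂μHE[n - 1] ≤ 0 := by
  obtain ⟨m, rfl⟩ : ∃ m, n = m + 1 := ⟨n - 1, by omega⟩
  rw [Nat.add_sub_cancel]
  exact hS.isRoundSphere_iff (by omega) hν hH
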